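/- Let $m\ge 3$ and $n,k\ge 0$ be integers with $(m,n)\neq(3,0)$, and let $\mathbb{N}=\{0,1,2,\dots\}$. Let $\mathfrak{osp}(m|2n)$ be the complex orthosymplectic Lie superalgebra, with Cartan subalgebra dual to $\epsilon_1,\dots,\epsilon_{\lfloor m/2\rfloor},\delta_1,\dots,\delta_n$ and with the positive roots $\epsilon_a\pm\epsilon_b$ $(a<b)$, $\delta_i\pm\delta_j$ $(i<j)$, $2\delta_i$, $\epsilon_a\pm\delta_i$, and, if $m$ is odd, also $\epsilon_a$ and $\delta_i$. Modules are $\mathbb{Z}/2$-graded, submodules are graded, and isomorphisms preserve the grading. Let $L^{m|2n}_{(k,0,\dots,0)}$ be the irreducible $\mathfrak{osp}(m|2n)$-module with highest weight $k\epsilon_1$, with even highest weight vector, and let $L^{m-1|2n}_{(l,0,\dots,0)}$ be the corresponding modules of $\mathfrak{osp}(m-1|2n)$, which is embedded in $\mathfrak{osp}(m|2n)$ as the stabilizer of one even vector of an orthonormal basis of the even part of the natural module. These modules exist, and the following holds. 1. If $m-2n>1$, or $m-2n\in 1-2\mathbb{N}$ and $k<2+\frac{1-m}{2}+n$, or $m-2n\in-2\mathbb{N}$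 and either $k<2-\frac m2+n$ or $k>2-m+2n$, then, as $\mathfrak{osp}(m-1|2n)$-modules, $$L^{m|2n}_{(k,0,\dots,0)}\cong\bigoplus_{l=0}^{k}L^{m-1|2n}_{(l,0,\dots,0)}.$$ 2. If $m-2n\in-2\mathbb{N}$ and $2-\frac m2+n\le k\le 2-m+2n$, then, as $\mathfrak{osp}(m-1|2n)$-modules, $$L^{m|2n}_{(k,0,\dots,0)}\cong\bigoplus_{l=3-m+2n-k}^{k}L^{m-1|2n}_{(l,0,\dots,0)}.$$ 3. In the remaining cases, that is, if $m-2n\in1-2\mathbb{N}$ and $k\ge 2+\frac{1-m}{2}+n$, the module $L^{m|2n}_{(k,0,\dots,0)}$ is not completely reducible as an $\mathfrak{osp}(m-1|2n)$-module. -/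

import Mathlib

open scoped DirectSum

noncomputable section

namespace Osp

/-! ### The Lie superalgebra `osp(m|2n)` over `ℂ` -/

/-- Indices of the coordinates of the superspace `ℂ^{m|2n}`: `m` even ones, followed by `2n` odd
ones grouped in `n` pairs. -/
abbrev Idx (m n : ℕ) : Type := Fin m ⊕ (Fin n × Fin 2)

/-- The parity `[i]` of a coordinate. -/
def par {m n : ℕ} : Idx m n → ZMod 2
  | Sum.inl _ => 0
  | Sum.inr _ => 1

/-- The sign `(-1)^a` of a parity `a`. -/
def sgn (a : ZMod 2) : ℂ := if a = 0 then 1 else -1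

/-- The block `J`: block diagonal with `n` blocks `(1/2) * [[0, -1], [1, 0]]`. -/
def sympl (n : ℕ) : Matrix (Fin n × Fin 2) (Fin n × Fin 2) ℂ := fun a b =>
  if a.1 = b.1 then (if a.2 = 0 ∧ b.2 = 1 then -(1 / 2) else if a.2 = 1 ∧ b.2 = 0 then 1 / 2 else 0)
  else 0

/-- The orthosymplectic metric `g = diag(I_m, J)`. -/
def metric (m n : ℕ) : Matrix (Idx m n) (Idx m n) ℂ := Matrix.fromBlocks 1 0 0 (sympl n)

/-- The subspace `gl(m|2n)_p` of matrices that are homogeneous of parity `p`. -/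
def gl (m n : ℕ) (p : ZMod 2) : Submodule ℂ (Matrix (Idx m n) (Idx m n) ℂ) where
  carrier := {X | ∀ i j, par i + par j ≠ p → X i j = 0}
  add_mem' := by
    intro X Y hX hY i j h
    simp [hX i j h, hY i j h]
  zero_mem' := by
    intro i j _
    rfl
  smul_mem' := by
    intro c X hX i j h
    simp [hX i j h]

/-- The homogeneous part `osp(m|2n)_p`, for `p = 0` (even) and `p = 1` (odd). It consists of the
matrices `X` of parity `p` with `⟨X u, v⟩ + (-1)^{p [u]} ⟨u, X v⟩ = 0` for all basis vectors
`u = e_i`, `v = e_j`, where `⟨e_i, e_j⟩ = g_{ij}`. -/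
def osp (m n : ℕ) (p : ZMod 2) : Submodule ℂ (Matrix (Idx m n) (Idx m n) ℂ) where
  carrier := {X | X ∈ gl m n p ∧
    ∀ i j, (X.transpose * metric m n) i j + sgn (p * par i) * (metric m n * X) i j = 0}
  add_mem' := by
    rintro X Y ⟨hX, hX'⟩ ⟨hY, hY'⟩
    refine ⟨add_mem hX hY, fun i j => ?_⟩
    have h1 := hX' i j
    have h2 := hY' i j
    simp only [Matrix.transpose_add, Matrix.add_mul, Matrix.mul_add, Matrix.add_apply]
    linear_combination h1 + h2
  zero_mem' := ⟨zero_mem _, by simp⟩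
  smul_mem' := by
    rintro c X ⟨hX, hX'⟩
    refine ⟨Submodule.smul_mem _ c hX, fun i j => ?_⟩
    have h1 := hX' i j
    simp only [Matrix.transpose_smul, Matrix.smul_mul, Matrix.mul_smul, Matrix.smul_apply,
      smul_eq_mul]
    linear_combination c * h1

/-- The superbracket `[X, Y] = X Y - (-1)^{pq} Y X` of matrices of parities `p` and `q`. -/
def sbracket {m n : ℕ} (p q : ZMod 2) (X Y : Matrix (Idx m n) (Idx m n) ℂ) :
    Matrix (Idx m n) (Idx m n) ℂ := X * Y - sgn (p * q) • (Y * X)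

theorem sgn_add (a b : ZMod 2) : sgn (a + b) = sgn a * sgn b := by
  have h : ∀ c : ZMod 2, c = 0 ∨ c = 1 := by decide
  have h2 : (1 + 1 : ZMod 2) = 0 := by decide
  rcases h a with rfl | rfl <;> rcases h b with rfl | rfl <;> simp [sgn, h2]

theorem sgn_sq (a : ZMod 2) : sgn a * sgn a = 1 := by
  unfold sgn
  split_ifs <;> simp

theorem gl_mul_mem {m n : ℕ} {p q : ZMod 2} {X Y : Matrix (Idx m n) (Idx m n) ℂ}
    (hX : X ∈ gl m n p) (hY : Y ∈ gl m n q) : X * Y ∈ gl m n (p + q) := by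
  intro i j h
  rw [Matrix.mul_apply]
  refine Finset.sum_eq_zero fun k _ => ?_
  by_cases h1 : par i + par k = p
  · have h2 : par k + par j ≠ q := by
      intro h2
      apply h
      rw [← h1, ← h2]
      have h3 : par k + par k = 0 := CharTwo.add_self_eq_zero _
      linear_combination -h3
    rw [hY k j h2, mul_zero]
  · rw [hX i k h1, zero_mul]

theorem osp_mul_aux {m n : ℕ} {p q : ZMod 2} {X Y : Matrix (Idx m n) (Idx m n) ℂ}
    (hX : X ∈ osp m n p) (hY : Y ∈ osp m n q) (i j : Idx m n) :
    ((X * Y).transpose * metric m n) i j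
      = sgn (p * q) * sgn ((p + q) * par i) * (metric m n * (Y * X)) i j := by
  obtain ⟨-, hX2⟩ := hX
  obtain ⟨hY1, hY2⟩ := hY
  rw [Matrix.transpose_mul, Matrix.mul_assoc, Matrix.mul_apply, ← Matrix.mul_assoc,
    Matrix.mul_apply]
  have e1 : ∀ k, (Y.transpose) i k * (X.transpose * metric m n) k j
      = - (sgn (p * q) * sgn (p * par i)) * ((Y.transpose) i k * (metric m n * X) k j) := by
    intro k
    have h1 := hX2 k j
    by_cases h : par k + par i = q
    · have h2 : p * par k = p * q + p * par i := by
        have h3 : par i + par i = 0 := CharTwo.add_self_eq_zero _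
        linear_combination p * h - p * h3
      rw [h2, sgn_add] at h1
      linear_combination (Y.transpose) i k * h1
    · simp [Matrix.transpose_apply, hY1 k i h]
  rw [Finset.sum_congr rfl fun k _ => e1 k, ← Finset.mul_sum, ← Matrix.mul_apply,
    ← Matrix.mul_assoc, Matrix.mul_apply, Finset.mul_sum, Finset.mul_sum]
  refine Finset.sum_congr rfl fun k _ => ?_
  rw [add_mul, sgn_add]
  linear_combination (-(sgn (p * q) * sgn (p * par i)) * X k j) * hY2 i k

/-- `osp(m|2n)` is closed under the superbracket. -/
theorem sbracket_mem {m n : ℕ} {p q : ZMod 2} {X Y : Matrix (Idx m n) (Idx m n) ℂ}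
    (hX : X ∈ osp m n p) (hY : Y ∈ osp m n q) : sbracket p q X Y ∈ osp m n (p + q) := by
  refine ⟨sub_mem (gl_mul_mem hX.1 hY.1)
    (Submodule.smul_mem _ _ (add_comm q p ▸ gl_mul_mem hY.1 hX.1)), fun i j => ?_⟩
  have h1 := osp_mul_aux hX hY i j
  have h2 := osp_mul_aux hY hX i j
  rw [mul_comm q p, add_comm q p] at h2
  simp only [sbracket, Matrix.transpose_sub, Matrix.transpose_smul, Matrix.sub_mul,
    Matrix.mul_sub, Matrix.smul_mul, Matrix.mul_smul, Matrix.sub_apply, Matrix.smul_apply,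
    smul_eq_mul]
  have h3 := sgn_sq (p * q)
  linear_combination h1 - sgn (p * q) * h2
    - sgn ((p + q) * par i) * (metric m n * (X * Y)) i j * h3

/-! ### The inclusion `osp(m'|2n) ⊆ osp(m|2n)` for `m' ≤ m` -/

/-- The inclusion of the first `m'` even and of all odd coordinates. -/
def idxIncl {m' m : ℕ} (h : m' ≤ m) (n : ℕ) : Idx m' n → Idx m n :=
  Sum.map (Fin.castLE h) id

/-- The matrix of the inclusion `ℂ^{m'|2n} → ℂ^{m|2n}`. -/
def inclMat {m' m : ℕ} (h : m' ≤ m) (n : ℕ) : Matrix (Idx m n) (Idx m' n) ℂ :=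
  fun i j => if i = idxIncl h n j then 1 else 0

/-- Extension of a matrix by zero on the omitted even coordinates. -/
def extend {m' m : ℕ} (h : m' ≤ m) (n : ℕ) (X : Matrix (Idx m' n) (Idx m' n) ℂ) :
    Matrix (Idx m n) (Idx m n) ℂ := inclMat h n * X * (inclMat h n).transpose

theorem idxIncl_injective {m' m : ℕ} (h : m' ≤ m) (n : ℕ) : Function.Injective (idxIncl h n) :=
  Sum.map_injective.2 ⟨Fin.castLE_injective h, Function.injective_id⟩

theorem inclMat_transpose_mul {m' m : ℕ} (h : m' ≤ m) (n : ℕ) :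
    (inclMat h n).transpose * inclMat h n = 1 := by
  ext i j
  simp [Matrix.mul_apply, inclMat, Matrix.one_apply, (idxIncl_injective h n).eq_iff, eq_comm]

theorem metric_mul_inclMat {m' m : ℕ} (h : m' ≤ m) (n : ℕ) :
    metric m n * inclMat h n = inclMat h n * metric m' n := by
  ext i j
  rcases i with i | i <;> rcases j with j | j <;>
    simp [Matrix.mul_apply, inclMat, metric, idxIncl, Matrix.one_apply]

theorem inclMat_transpose_mul_metric {m' m : ℕ} (h : m' ≤ m) (n : ℕ) :
    (inclMat h n).transpose * metric m n = metric m' n * (inclMat h n).transpose := by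
  ext i j
  rcases i with i | i <;> rcases j with j | j <;>
    simp [Matrix.mul_apply, inclMat, metric, idxIncl, Matrix.one_apply]
  rw [Finset.sum_eq_single i]
  · simp
  · intro b _ hb
    simp [hb.symm]
  · simp

theorem extend_mul {m' m : ℕ} (h : m' ≤ m) (n : ℕ) (X Y : Matrix (Idx m' n) (Idx m' n) ℂ) :
    extend h n (X * Y) = extend h n X * extend h n Y := by
  have e : ∀ Z : Matrix (Idx m' n) (Idx m n) ℂ,
      (inclMat h n).transpose * (inclMat h n * Z) = Z := by
    intro Z
    rw [← Matrix.mul_assoc, inclMat_transpose_mul, Matrix.one_mul]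
  simp only [extend, Matrix.mul_assoc, e]

theorem extend_sbracket {m' m : ℕ} (h : m' ≤ m) (n : ℕ) (p q : ZMod 2)
    (X Y : Matrix (Idx m' n) (Idx m' n) ℂ) :
    extend h n (sbracket p q X Y) = sbracket p q (extend h n X) (extend h n Y) := by
  simp only [sbracket, ← extend_mul]
  simp [extend, Matrix.mul_sub, Matrix.sub_mul]

theorem par_idxIncl {m' m : ℕ} (h : m' ≤ m) (n : ℕ) (i : Idx m' n) :
    par (idxIncl h n i) = par i := by
  rcases i with i | i <;> rfl

theorem extend_mem {m' m : ℕ} (h : m' ≤ m) (n : ℕ) {p : ZMod 2}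
    {X : Matrix (Idx m' n) (Idx m' n) ℂ} (hX : X ∈ osp m' n p) : extend h n X ∈ osp m n p := by
  refine ⟨fun i j hij => ?_, fun i j => ?_⟩
  · simp only [extend, Matrix.mul_apply, Matrix.transpose_apply, inclMat]
    refine Finset.sum_eq_zero fun b _ => ?_
    split_ifs with hb
    · rw [mul_one]
      refine Finset.sum_eq_zero fun a _ => ?_
      split_ifs with ha
      · rw [one_mul]
        apply hX.1
        rw [← par_idxIncl h n a, ← par_idxIncl h n b, ← ha, ← hb]
        exact hij
      · rw [zero_mul]
    · rw [mul_zero]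
  · have e1 : (extend h n X).transpose * metric m n
        = inclMat h n * (X.transpose * metric m' n) * (inclMat h n).transpose := by
      simp only [extend, Matrix.transpose_mul, Matrix.transpose_transpose, Matrix.mul_assoc,
        inclMat_transpose_mul_metric]
    have e2 : metric m n * extend h n X
        = inclMat h n * (metric m' n * X) * (inclMat h n).transpose := by
      simp only [extend, ← Matrix.mul_assoc, metric_mul_inclMat]
    rw [e1, e2]
    rw [Matrix.mul_apply, Matrix.mul_apply (M := inclMat h n * (metric m' n * X)),
      Finset.mul_sum, ← Finset.sum_add_distrib]
    refine Finset.sum_eq_zero fun b _ => ?_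
    rw [Matrix.mul_apply, Matrix.mul_apply (M := inclMat h n), Finset.sum_mul, Finset.sum_mul,
      Finset.mul_sum, ← Finset.sum_add_distrib]
    refine Finset.sum_eq_zero fun a _ => ?_
    have h1 := hX.2 a b
    by_cases hi : i = idxIncl h n a
    · rw [hi, par_idxIncl]
      linear_combination (inclMat h n (idxIncl h n a) a * (inclMat h n).transpose b j) * h1
    · simp [inclMat, hi]

/-- The inclusion of Lie superalgebras `osp(m'|2n) → osp(m|2n)` as the stabilizer of the last
`m - m'` even basis vectors. -/
def ospIncl {m' m : ℕ} (h : m' ≤ m) (n : ℕ) (p : ZMod 2) : osp m' n p →ₗ[ℂ] osp m n p where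
  toFun X := ⟨extend h n X, extend_mem h n X.2⟩
  map_add' X Y := by
    ext1
    simp [extend, Matrix.mul_add, Matrix.add_mul]
  map_smul' c X := by
    ext1
    simp [extend]

/-! ### Modules -/

/-- An `osp(m|2n)`-module structure on the complex vector space `V`: a `ℤ/2`-grading
`V = V_0 ⊕ V_1` and an action of `osp(m|2n)` that is additive on parities and sends the
superbracket to the supercommutator. -/
structure Rep (m n : ℕ) (V : Type*) [AddCommGroup V] [Module ℂ V] where
  deg : ZMod 2 → Submodule ℂ V
  isCompl : IsCompl (deg 0) (deg 1)
  act : (p : ZMod 2) → osp m n p →ₗ[ℂ] Module.End ℂ V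
  act_deg : ∀ (p q : ZMod 2) (X : osp m n p), ∀ v ∈ deg q, act p X v ∈ deg (p + q)
  act_bracket : ∀ (p q : ZMod 2) (X : osp m n p) (Y : osp m n q),
    act (p + q) ⟨sbracket p q X.1 Y.1, sbracket_mem X.2 Y.2⟩
      = act p X * act q Y - sgn (p * q) • (act q Y * act p X)

namespace Rep

variable {m n : ℕ} {V W : Type*} [AddCommGroup V] [Module ℂ V] [AddCommGroup W] [Module ℂ W]

/-- (Graded) submodules. -/
def IsSubmodule (ρ : Rep m n V) (U : Submodule ℂ V) : Prop :=
  (∀ (p : ZMod 2) (X : osp m n p), ∀ v ∈ U, ρ.act p X v ∈ U) ∧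
    U = (U ⊓ ρ.deg 0) ⊔ (U ⊓ ρ.deg 1)

/-- Irreducible modules. -/
def IsIrreducible (ρ : Rep m n V) : Prop :=
  Nontrivial V ∧ ∀ U, ρ.IsSubmodule U → U = ⊥ ∨ U = ⊤

/-- Completely reducible modules: every submodule has a complementary submodule. -/
def IsCompletelyReducible (ρ : Rep m n V) : Prop :=
  ∀ U, ρ.IsSubmodule U → ∃ U', ρ.IsSubmodule U' ∧ IsCompl U U'

/-- Isomorphic modules, through an isomorphism that preserves parities. -/
def Isomorphic (ρ : Rep m n V) (σ : Rep m n W) : Prop :=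
  ∃ e : V ≃ₗ[ℂ] W, (∀ p, ∀ v ∈ ρ.deg p, e v ∈ σ.deg p) ∧
    ∀ (p : ZMod 2) (X : osp m n p) (v : V), e (ρ.act p X v) = σ.act p X (e v)

/-- Restriction of an `osp(m|2n)`-module to `osp(m'|2n)`. -/
def restrict {m' : ℕ} (h : m' ≤ m) (ρ : Rep m n V) : Rep m' n V where
  deg := ρ.deg
  isCompl := ρ.isCompl
  act p := ρ.act p ∘ₗ ospIncl h n p
  act_deg p q X v hv := ρ.act_deg p q _ v hv
  act_bracket p q X Y := by
    have e := ρ.act_bracket p q (ospIncl h n p X) (ospIncl h n q Y)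
    simp only [LinearMap.comp_apply]
    rw [← e]
    congr 1
    ext1
    exact extend_sbracket h n p q X.1 Y.1

/-- The direct sum of a family of modules. -/
def directSum {ι : Type*} {V : ι → Type*} [∀ i, AddCommGroup (V i)] [∀ i, Module ℂ (V i)]
    (ρ : ∀ i, Rep m n (V i)) : Rep m n (⨁ i, V i) where
  deg p := ⨅ i, ((ρ i).deg p).comap (DirectSum.component ℂ ι V i)
  isCompl := by
    classical
    constructor
    · rw [Submodule.disjoint_def]
      intro x h0 h1
      ext i
      rw [Submodule.mem_iInf] at h0 h1
      exact (Submodule.disjoint_def.1 (ρ i).isCompl.disjoint) _ (h0 i) (h1 i)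
    · have key : ∀ (p : ZMod 2) (i : ι) (v : V i), v ∈ (ρ i).deg p →
          DirectSum.lof ℂ ι V i v ∈ ⨅ j, ((ρ j).deg p).comap (DirectSum.component ℂ ι V j) := by
        intro p i v hv
        rw [Submodule.mem_iInf]
        intro j
        rw [Submodule.mem_comap]
        by_cases hij : i = j
        · subst hij
          rw [DirectSum.component.lof_self]
          exact hv
        · rw [DirectSum.component.of, dif_neg hij]
          exact zero_mem _
      rw [codisjoint_iff, eq_top_iff]
      intro x _
      induction x using DirectSum.induction_on with
      | zero => exact zero_mem _
      | of i v =>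
        have hv : v ∈ (ρ i).deg 0 ⊔ (ρ i).deg 1 := by
          rw [(ρ i).isCompl.sup_eq_top]
          trivial
        obtain ⟨a, ha, b, hb, rfl⟩ := Submodule.mem_sup.1 hv
        rw [map_add]
        exact Submodule.add_mem_sup (key 0 i a ha) (key 1 i b hb)
      | add x y hx hy => exact add_mem (hx trivial) (hy trivial)
  act p :=
    { toFun := fun X => DirectSum.lmap fun i => (ρ i).act p X
      map_add' := fun X Y => by
        ext
        simp
      map_smul' := fun c X => by
        apply LinearMap.ext
        intro v
        ext i
        simp [DirectSum.smul_apply] }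
  act_deg p q X v hv := by
    rw [Submodule.mem_iInf] at hv ⊢
    intro i
    exact (ρ i).act_deg p q X _ (hv i)
  act_bracket p q X Y := by
    apply LinearMap.ext
    intro v
    ext i
    have e := LinearMap.congr_fun ((ρ i).act_bracket p q X Y) (v i)
    simpa [DirectSum.smul_apply] using e

end Rep

/-! ### Highest weights -/

/-- Weights, in coordinates with respect to `ε_1, …, ε_{⌊m/2⌋}, δ_1, …, δ_n`. -/
abbrev Weight (m n : ℕ) : Type := Fin (m / 2) ⊕ Fin n → ℂ

/-- The weight `ε_a`. -/
def eps {m n : ℕ} (a : Fin (m / 2)) : Weight m n := Pi.single (Sum.inl a) 1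

/-- The weight `δ_i`. -/
def del {m n : ℕ} (i : Fin n) : Weight m n := Pi.single (Sum.inr i) 1

/-- The elements of the Cartan subalgebra dual to the `ε_a` and `δ_i`, as matrices. The first
kind is the infinitesimal rotation `√-1 (E_{2a-1,2a} - E_{2a,2a-1})` in the plane of the even
coordinates `2a-1` and `2a` (counted from one), the second one is `diag(1, -1)` on the `i`-th pair
of odd coordinates. -/
def cartanMat (m n : ℕ) : Fin (m / 2) ⊕ Fin n → Matrix (Idx m n) (Idx m n) ℂ
  | Sum.inl a =>
      Complex.I • (Matrix.single (Sum.inl ⟨2 * a, by omega⟩) (Sum.inl ⟨2 * a + 1, by omega⟩) 1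
        - Matrix.single (Sum.inl ⟨2 * a + 1, by omega⟩) (Sum.inl ⟨2 * a, by omega⟩) 1)
  | Sum.inr i =>
      Matrix.single (Sum.inr (i, 0)) (Sum.inr (i, 0)) 1
        - Matrix.single (Sum.inr (i, 1)) (Sum.inr (i, 1)) 1

theorem cartanMat_mem (m n : ℕ) (s : Fin (m / 2) ⊕ Fin n) : cartanMat m n s ∈ osp m n 0 := by
  rcases s with a | c
  · refine ⟨fun i j hij => ?_, fun i j => ?_⟩
    · rcases i with i | i <;> rcases j with j | j <;>
        simp [cartanMat, par] at hij ⊢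
    · rcases i with i | i <;> rcases j with j | j <;>
        simp [cartanMat, Matrix.mul_apply, metric, sgn, Matrix.single_apply, Matrix.one_apply]
      ring
  · refine ⟨fun i j hij => ?_, fun i j => ?_⟩
    · rcases i with i | i <;> rcases j with j | j <;>
        simp [cartanMat, Matrix.single_apply, par] at hij ⊢
      exact absurd (by decide) hij
    · rcases i with i | ⟨i, x⟩ <;> rcases j with j | ⟨j, y⟩ <;>
        simp [cartanMat, Matrix.mul_apply, metric, sgn, Matrix.single_apply, sympl,
          Fintype.sum_prod_type]
      fin_cases x <;> fin_cases y <;> simp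

/-- The elements of the Cartan subalgebra dual to the `ε_a` and `δ_i`. -/
def cartan (m n : ℕ) (s : Fin (m / 2) ⊕ Fin n) : osp m n 0 :=
  ⟨cartanMat m n s, cartanMat_mem m n s⟩

/-- `X` has weight `μ` for the adjoint action of the Cartan subalgebra. -/
def HasWeight {m n : ℕ} {p : ZMod 2} (X : osp m n p) (μ : Weight m n) : Prop :=
  ∀ s, sbracket 0 p (cartanMat m n s) X.1 = μ s • X.1

/-- The positive roots: the usual ones of `o(m)` and `sp(2n)`, and the odd roots `ε_a ± δ_i`, and
`δ_i` if `m` is odd. -/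
inductive IsPositiveRoot {m n : ℕ} : Weight m n → Prop
  | eps_add_eps (a b : Fin (m / 2)) : a < b → IsPositiveRoot (eps a + eps b)
  | eps_sub_eps (a b : Fin (m / 2)) : a < b → IsPositiveRoot (eps a - eps b)
  | eps_single (a : Fin (m / 2)) : Odd m → IsPositiveRoot (eps a)
  | del_add_del (i j : Fin n) : i < j → IsPositiveRoot (del i + del j)
  | del_sub_del (i j : Fin n) : i < j → IsPositiveRoot (del i - del j)
  | two_del (i : Fin n) : IsPositiveRoot ((2 : ℂ) • del i)
  | eps_add_del (a : Fin (m / 2)) (i : Fin n) : IsPositiveRoot (eps a + del i)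
  | eps_sub_del (a : Fin (m / 2)) (i : Fin n) : IsPositiveRoot (eps a - del i)
  | del_single (i : Fin n) : Odd m → IsPositiveRoot (del i)

/-- `v` is a highest weight vector of weight `μ`. -/
def Rep.IsHighestWeightVector {m n : ℕ} {V : Type*} [AddCommGroup V] [Module ℂ V]
    (ρ : Rep m n V) (μ : Weight m n) (v : V) : Prop :=
  v ≠ 0 ∧ (∀ s, ρ.act 0 (cartan m n s) v = μ s • v) ∧
    ∀ (α : Weight m n), IsPositiveRoot α → ∀ (p : ZMod 2) (X : osp m n p), HasWeight X α →
      ρ.act p X v = 0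

/-- The weight `(k, 0, …, 0) = k ε_1`. -/
def firstWeight (m n k : ℕ) : Weight m n
  | Sum.inl a => if (a : ℕ) = 0 then (k : ℂ) else 0
  | Sum.inr _ => 0

/-- `ρ` is (a copy of) the irreducible module `L_{(k,0,…,0)}^{m|2n}`: it is irreducible with highest
weight `(k, 0, …, 0)`, and graded such that its highest weight vector is even. -/
def Rep.IsL {m n : ℕ} {V : Type*} [AddCommGroup V] [Module ℂ V] (ρ : Rep m n V) (k : ℕ) : Prop :=
  ρ.IsIrreducible ∧ ∃ v ∈ ρ.deg 0, ρ.IsHighestWeightVector (firstWeight m n k) v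

/-- The module `L_{(k,0,…,0)}^{m|2n}` exists. -/
def ExistsL (m n k : ℕ) : Prop :=
  ∃ (V : Type) (_ : AddCommGroup V) (_ : Module ℂ V) (ρ : Rep m n V), ρ.IsL k

end Osp

end

noncomputable section

namespace Osp

namespace Rep

variable {m n : ℕ} {V W : Type*} [AddCommGroup V] [Module ℂ V] [AddCommGroup W] [Module ℂ W]

/-! ### Submodules, products and isomorphisms -/

/-! Write m = r + 3 and μ = r - 2n = m - 2n - 3. The modules are realised conformally. A function of
degree k on the isotropic cone of ℂ^{m|2n} is determined by its values on the slice X₀ - iX₁ = 1,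
whose points are ((1 - R²)/2, i(1 + R²)/2, x) with x in ℂ^{r+1|2n}; so osp(m|2n) acts on polynomials
in x. Elements raising ε₁ act by the derivatives ∂_a, the Cartan element dual to ε₁ by k - E with E
the Euler operator, and elements lowering ε₁ by K_a = 2x^a(E - k) - R²∂_a. The constant 1 is a
highest weight vector of weight kε₁. A nonzero submodule is stable under E and all ∂_a, hence
contains a homogeneous vector killed by all ∂_a, that is, a nonzero constant. So the submodule `full
k` generated by 1 is irreducible. Irreducible highest weight modules are unique
(`isomorphic_of_highestWeight`), so every copy of the module may be replaced by this one.

The subalgebra osp(m-1|2n) acts in the same way through the coordinates y other than the last even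
one, t. Homogeneous polynomials killed by all ∂_y are multiples of a power t^j, which has weight (k
- j)ε₁ and generates `branch k j`. This summand is irreducible as soon as it contains no other power
of t. An operator commuting with all K_y (`casimir_K`) acts on it by (k - j)(k + μ - j), and the
reflection t ↦ -t acts by (-1)^j. Hence t^e can lie in the branch of t^j only if e = j, or if e + j
= 2k + μ and this number is even; distinct branches are independent away from the same coincidence.
For μ ≥ 0 the powers in `full k` moreover satisfy e ≤ k (`le_of_mem_gen_vac`).

It remains to see which t^j occur. Eliminating |y|²t^p between K_t t^{p+1} and the metric
contraction of K_y K_y t^p gives, modulo any K_y-stable subspace containing t^p with p ≠ k, (2(p+1)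
- 2k - μ) K_t t^{p+1} ≡ 2(p+1-k)(p+1-2k-μ) t^{p+2} (`K_t_tpow_sub_mem`). The right coefficient shows
that 1, t, t², … appear one after another until the exponent reaches k, or 2k + μ if that is
positive and smaller. The left coefficient, if nonzero, shows that the sum of these branches is
stable under K_t and therefore is all of `full k` (`full_eq`). This yields the two decompositions.

If instead 2l = 2k + μ for some 1 ≤ l < k, the left coefficient vanishes at p + 1 = l, and t^{l+1}
lies in the branch of t^{l-1}. It generates a submodule without a complement, because a complement
would have to contain t^{l-1} for reasons of degree. -/

theorem IsSubmodule.exists_decomp {ρ : Rep m n V} {U : Submodule ℂ V} (hU : ρ.IsSubmodule U)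
    {v : V} (hv : v ∈ U) : ∃ a b, a ∈ U ∧ a ∈ ρ.deg 0 ∧ b ∈ U ∧ b ∈ ρ.deg 1 ∧ a + b = v := by
  rw [hU.2] at hv
  obtain ⟨a, ha, b, hb, rfl⟩ := Submodule.mem_sup.1 hv
  exact ⟨a, b, ha.1, ha.2, hb.1, hb.2, rfl⟩

theorem isSubmodule_of {ρ : Rep m n V} {U : Submodule ℂ V}
    (h : ∀ (p : ZMod 2) (X : osp m n p), ∀ v ∈ U, ρ.act p X v ∈ U)
    (h' : ∀ v ∈ U, ∃ a b, a ∈ U ∧ a ∈ ρ.deg 0 ∧ b ∈ U ∧ b ∈ ρ.deg 1 ∧ a + b = v) :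
    ρ.IsSubmodule U := by
  refine ⟨h, le_antisymm (fun v hv => ?_) (sup_le inf_le_left inf_le_left)⟩
  obtain ⟨a, b, ha, ha', hb, hb', rfl⟩ := h' v hv
  exact Submodule.add_mem_sup ⟨ha, ha'⟩ ⟨hb, hb'⟩

/-- The module structure on a submodule. -/
def sub (ρ : Rep m n V) (U : Submodule ℂ V) (hU : ρ.IsSubmodule U) : Rep m n U where
  deg p := (ρ.deg p).comap U.subtype
  isCompl := by
    constructor
    · rw [Submodule.disjoint_def]
      intro x h0 h1
      exact Subtype.ext ((Submodule.disjoint_def.1 ρ.isCompl.disjoint) _ h0 h1)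
    · rw [codisjoint_iff, eq_top_iff]
      rintro ⟨x, hx⟩ _
      obtain ⟨a, b, ha, ha', hb, hb', rfl⟩ := hU.exists_decomp hx
      exact Submodule.mem_sup.2 ⟨⟨a, ha⟩, ha', ⟨b, hb⟩, hb', rfl⟩
  act p :=
    { toFun := fun X => (ρ.act p X).restrict (hU.1 p X)
      map_add' := fun X Y => by
        ext v
        simp
      map_smul' := fun c X => by
        ext v
        simp }
  act_deg p q X v hv := ρ.act_deg p q X _ hv
  act_bracket p q X Y := by
    ext v
    exact LinearMap.congr_fun (ρ.act_bracket p q X Y) v.1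

theorem IsSubmodule.map_subtype {ρ : Rep m n V} {U : Submodule ℂ V} (hU : ρ.IsSubmodule U)
    {N : Submodule ℂ U} (hN : (ρ.sub U hU).IsSubmodule N) :
    ρ.IsSubmodule (N.map U.subtype) := by
  refine isSubmodule_of ?_ ?_
  · rintro p X _ ⟨u, hu, rfl⟩
    exact ⟨_, hN.1 p X u hu, rfl⟩
  · rintro _ ⟨u, hu, rfl⟩
    obtain ⟨a, b, ha, ha', hb, hb', rfl⟩ := hN.exists_decomp hu
    exact ⟨a, b, ⟨a, ha, rfl⟩, ha', ⟨b, hb, rfl⟩, hb', rfl⟩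

theorem IsSubmodule.comap_subtype {ρ : Rep m n V} {U N : Submodule ℂ V} (hU : ρ.IsSubmodule U)
    (hN : ρ.IsSubmodule N) (hNU : N ≤ U) : (ρ.sub U hU).IsSubmodule (N.comap U.subtype) := by
  refine isSubmodule_of (fun p X u hu => hN.1 p X _ hu) ?_
  rintro ⟨u, hu'⟩ hu
  obtain ⟨a, b, ha, ha', hb, hb', rfl⟩ := hN.exists_decomp hu
  exact ⟨⟨a, hNU ha⟩, ⟨b, hNU hb⟩, ha, ha', hb, hb', rfl⟩

/-- The product of two modules. -/
def prod (ρ : Rep m n V) (σ : Rep m n W) : Rep m n (V × W) where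
  deg p := (ρ.deg p).prod (σ.deg p)
  isCompl := by
    constructor
    · rw [Submodule.disjoint_def]
      intro x h0 h1
      exact Prod.ext ((Submodule.disjoint_def.1 ρ.isCompl.disjoint) _ h0.1 h1.1)
        ((Submodule.disjoint_def.1 σ.isCompl.disjoint) _ h0.2 h1.2)
    · rw [codisjoint_iff, eq_top_iff]
      rintro ⟨x, y⟩ _
      have hx : x ∈ ρ.deg 0 ⊔ ρ.deg 1 := by rw [ρ.isCompl.sup_eq_top]; trivial
      have hy : y ∈ σ.deg 0 ⊔ σ.deg 1 := by rw [σ.isCompl.sup_eq_top]; trivial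
      obtain ⟨a, ha, b, hb, rfl⟩ := Submodule.mem_sup.1 hx
      obtain ⟨c, hc, d, hd, rfl⟩ := Submodule.mem_sup.1 hy
      exact Submodule.mem_sup.2 ⟨(a, c), ⟨ha, hc⟩, (b, d), ⟨hb, hd⟩, rfl⟩
  act p :=
    { toFun := fun X => (ρ.act p X).prodMap (σ.act p X)
      map_add' := fun X Y => by
        ext v <;> simp
      map_smul' := fun c X => by
        ext v <;> simp }
  act_deg p q X v hv := ⟨ρ.act_deg p q X _ hv.1, σ.act_deg p q X _ hv.2⟩
  act_bracket p q X Y := by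
    apply LinearMap.ext
    rintro ⟨v, w⟩
    exact Prod.ext (LinearMap.congr_fun (ρ.act_bracket p q X Y) v)
      (LinearMap.congr_fun (σ.act_bracket p q X Y) w)

theorem prod_act (ρ : Rep m n V) (σ : Rep m n W) (p : ZMod 2) (X : osp m n p) (v : V) (w : W) :
    (ρ.prod σ).act p X (v, w) = (ρ.act p X v, σ.act p X w) := rfl

/-- The two homogeneous components of the preimage are sent to homogeneous components of `w`; the
one of the wrong parity vanishes because the two degrees of `σ` meet in zero. -/
theorem symm_mem_deg {ρ : Rep m n V} {σ : Rep m n W} (e : V ≃ₗ[ℂ] W)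
    (h1 : ∀ p, ∀ v ∈ ρ.deg p, e v ∈ σ.deg p) (p : ZMod 2) {w : W} (hw : w ∈ σ.deg p) :
    e.symm w ∈ ρ.deg p := by
  have hv : e.symm w ∈ ρ.deg 0 ⊔ ρ.deg 1 := by rw [ρ.isCompl.sup_eq_top]; trivial
  obtain ⟨a, ha, b, hb, hab⟩ := Submodule.mem_sup.1 hv
  have hw' : e a + e b = w := by rw [← map_add, hab, e.apply_symm_apply]
  have hp : ∀ c : ZMod 2, c = 0 ∨ c = 1 := by decide
  have hdis := Submodule.disjoint_def.1 σ.isCompl.disjoint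
  rcases hp p with rfl | rfl
  · have : e b = 0 := hdis _
      ((Submodule.add_mem_iff_right _ (h1 0 a ha)).1 (by rwa [hw'])) (h1 1 b hb)
    rw [e.map_eq_zero_iff] at this
    rwa [← hab, this, add_zero]
  · have : e a = 0 := hdis _ (h1 0 a ha)
      ((Submodule.add_mem_iff_left _ (h1 1 b hb)).1 (by rwa [hw']))
    rw [e.map_eq_zero_iff] at this
    rwa [← hab, this, zero_add]

theorem symm_act {ρ : Rep m n V} {σ : Rep m n W} (e : V ≃ₗ[ℂ] W)
    (h2 : ∀ (p : ZMod 2) (X : osp m n p) (v : V), e (ρ.act p X v) = σ.act p X (e v))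
    (p : ZMod 2) (X : osp m n p) (w : W) : e.symm (σ.act p X w) = ρ.act p X (e.symm w) := by
  rw [e.symm_apply_eq, h2, e.apply_symm_apply]

theorem Isomorphic.symm {ρ : Rep m n V} {σ : Rep m n W} (h : ρ.Isomorphic σ) :
    σ.Isomorphic ρ := by
  obtain ⟨e, h1, h2⟩ := h
  exact ⟨e.symm, fun p w hw => symm_mem_deg e h1 p hw, symm_act e h2⟩

theorem Isomorphic.trans {X : Type*} [AddCommGroup X] [Module ℂ X] {ρ : Rep m n V}
    {σ : Rep m n W} {τ : Rep m n X} (h : ρ.Isomorphic σ) (h' : σ.Isomorphic τ) :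
    ρ.Isomorphic τ := by
  obtain ⟨e, h1, h2⟩ := h
  obtain ⟨f, h3, h4⟩ := h'
  exact ⟨e.trans f, fun p v hv => h3 p _ (h1 p v hv), fun p X v => by simp [h2, h4]⟩

theorem Isomorphic.restrict {m' : ℕ} (h : m' ≤ m) {ρ : Rep m n V} {σ : Rep m n W}
    (hi : ρ.Isomorphic σ) : (ρ.restrict h).Isomorphic (σ.restrict h) := by
  obtain ⟨e, h1, h2⟩ := hi
  exact ⟨e, h1, fun p X v => h2 p _ v⟩

theorem IsSubmodule.map_equiv {ρ : Rep m n V} {σ : Rep m n W} (e : V ≃ₗ[ℂ] W)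
    (h1 : ∀ p, ∀ v ∈ ρ.deg p, e v ∈ σ.deg p)
    (h2 : ∀ (p : ZMod 2) (X : osp m n p) (v : V), e (ρ.act p X v) = σ.act p X (e v))
    {U : Submodule ℂ V} (hU : ρ.IsSubmodule U) : σ.IsSubmodule (U.map e.toLinearMap) := by
  refine isSubmodule_of ?_ ?_
  · rintro p X _ ⟨u, hu, rfl⟩
    exact ⟨_, hU.1 p X u hu, h2 p X u⟩
  · rintro _ ⟨u, hu, rfl⟩
    obtain ⟨a, b, ha, ha', hb, hb', rfl⟩ := hU.exists_decomp hu
    exact ⟨e a, e b, ⟨a, ha, rfl⟩, h1 0 a ha', ⟨b, hb, rfl⟩, h1 1 b hb', (map_add e a b).symm⟩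

theorem IsCompletelyReducible.of_isomorphic {ρ : Rep m n V} {σ : Rep m n W}
    (h : ρ.Isomorphic σ) (hρ : ρ.IsCompletelyReducible) : σ.IsCompletelyReducible := by
  obtain ⟨e, h1, h2⟩ := h
  intro U hU
  obtain ⟨U', hU', hc⟩ := hρ _ (IsSubmodule.map_equiv e.symm (fun p w hw => symm_mem_deg e h1 p hw)
    (symm_act e h2) hU)
  refine ⟨_, IsSubmodule.map_equiv e h1 h2 hU', ?_⟩
  have h5 : IsCompl ((U.map e.symm.toLinearMap).map e.toLinearMap) (U'.map e.toLinearMap) :=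
    (Submodule.orderIsoMapComap e).isCompl hc
  rwa [← Submodule.map_comp, LinearEquiv.comp_symm, Submodule.map_id] at h5

/-! ### The subspace generated by a vector under a family of elements -/

/-- The smallest subspace that contains `v` and is stable under the elements of `S`. -/
def closure (ρ : Rep m n V) (S : ∀ p, Set (osp m n p)) (v : V) : Submodule ℂ V :=
  sInf {U | v ∈ U ∧ ∀ p, ∀ X ∈ S p, ∀ w ∈ U, ρ.act p X w ∈ U}

theorem mem_closure_self (ρ : Rep m n V) (S : ∀ p, Set (osp m n p)) (v : V) :
    v ∈ ρ.closure S v := by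
  simp only [closure, Submodule.mem_sInf]
  exact fun U hU => hU.1

theorem act_mem_closure (ρ : Rep m n V) (S : ∀ p, Set (osp m n p)) (v : V) {p : ZMod 2}
    {X : osp m n p} (hX : X ∈ S p) {w : V} (hw : w ∈ ρ.closure S v) :
    ρ.act p X w ∈ ρ.closure S v := by
  simp only [closure, Submodule.mem_sInf] at hw ⊢
  exact fun U hU => hU.2 p X hX w (hw U hU)

theorem closure_le (ρ : Rep m n V) (S : ∀ p, Set (osp m n p)) {v : V} {U : Submodule ℂ V}
    (hv : v ∈ U) (h : ∀ p, ∀ X ∈ S p, ∀ w ∈ U, ρ.act p X w ∈ U) : ρ.closure S v ≤ U :=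
  sInf_le ⟨hv, h⟩

theorem act_act (ρ : Rep m n V) {p q : ZMod 2} (X : osp m n p) (Y : osp m n q) (v : V) :
    ρ.act p X (ρ.act q Y v) = ρ.act (p + q) ⟨sbracket p q X.1 Y.1, sbracket_mem X.2 Y.2⟩ v
      + sgn (p * q) • ρ.act q Y (ρ.act p X v) := by
  rw [ρ.act_bracket p q X Y]
  simp

/-- The vectors of the closure that all of osp keeps inside the closure form an `S`-stable subspace,
because XYw = [X,Y]w ± YXw. So stability under the whole algebra only has to be tested on the
generator, and no ordering of monomials is needed. -/
theorem act_closure (ρ : Rep m n V) (S : ∀ p, Set (osp m n p)) {v : V}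
    (h : ∀ p (X : osp m n p), ρ.act p X v ∈ ρ.closure S v) (p : ZMod 2) (X : osp m n p) (w : V)
    (hw : w ∈ ρ.closure S v) : ρ.act p X w ∈ ρ.closure S v := by
  let N : Submodule ℂ V :=
    { carrier := {w | w ∈ ρ.closure S v ∧
        ∀ p (X : osp m n p), ρ.act p X w ∈ ρ.closure S v}
      add_mem' := by
        rintro a b ⟨ha, ha'⟩ ⟨hb, hb'⟩
        refine ⟨add_mem ha hb, fun p X => ?_⟩
        rw [map_add]
        exact add_mem (ha' p X) (hb' p X)
      zero_mem' := ⟨zero_mem _, fun p X => by rw [map_zero]; exact zero_mem _⟩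
      smul_mem' := by
        rintro c a ⟨ha, ha'⟩
        refine ⟨Submodule.smul_mem _ c ha, fun p X => ?_⟩
        rw [map_smul]
        exact Submodule.smul_mem _ c (ha' p X) }
  have hN : ρ.closure S v ≤ N := by
    refine ρ.closure_le S ⟨ρ.mem_closure_self S v, h⟩ ?_
    rintro q Y hY w ⟨hw, hw'⟩
    refine ⟨ρ.act_mem_closure S v hY hw, fun p X => ?_⟩
    rw [act_act]
    exact add_mem (hw' _ _) (Submodule.smul_mem _ _ (ρ.act_mem_closure S v hY (hw' p X)))
  exact (hN hw).2 p X

theorem isSubmodule_closure (ρ : Rep m n V) (S : ∀ p, Set (osp m n p)) {v : V}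
    (hv : v ∈ ρ.deg 0) (h : ∀ p (X : osp m n p), ρ.act p X v ∈ ρ.closure S v) :
    ρ.IsSubmodule (ρ.closure S v) := by
  refine ⟨ρ.act_closure S h, le_antisymm ?_ (sup_le inf_le_left inf_le_left)⟩
  refine ρ.closure_le S (Submodule.mem_sup_left ⟨ρ.mem_closure_self S v, hv⟩) ?_
  intro p X hX w hw
  obtain ⟨a, ha, b, hb, rfl⟩ := Submodule.mem_sup.1 hw
  have hp : ∀ c : ZMod 2, c = 0 ∨ c = 1 := by decide
  have h0 := ρ.act_deg p 0 X a ha.2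
  have h1 := ρ.act_deg p 1 X b hb.2
  have h2 := ρ.act_mem_closure S v hX ha.1
  have h3 := ρ.act_mem_closure S v hX hb.1
  rw [map_add]
  rcases hp p with rfl | rfl
  · rw [zero_add] at h0 h1
    exact Submodule.add_mem_sup ⟨h2, h0⟩ ⟨h3, h1⟩
  · rw [add_zero] at h0
    rw [show (1 + 1 : ZMod 2) = 0 by decide] at h1
    rw [add_comm]
    exact Submodule.add_mem_sup ⟨h3, h1⟩ ⟨h2, h0⟩

/-! ### Direct sums -/

theorem isomorphic_directSum {ι : Type*} {W : ι → Type*} [∀ i, AddCommGroup (W i)]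
    [∀ i, Module ℂ (W i)] (ρ : Rep m n V) (σ : ∀ i, Rep m n (W i)) (U : ι → Submodule ℂ V)
    (hU : ∀ i, ρ.IsSubmodule (U i)) (hind : iSupIndep U) (htop : ⨆ i, U i = ⊤)
    (hiso : ∀ i, (σ i).Isomorphic (ρ.sub (U i) (hU i))) : ρ.Isomorphic (directSum σ) := by
  classical
  refine Isomorphic.symm ?_
  choose e h1 h2 using hiso
  have hint : DirectSum.IsInternal U :=
    (DirectSum.isInternal_submodule_iff_iSupIndep_and_iSup_eq_top U).2 ⟨hind, htop⟩
  let f : (⨁ i, W i) ≃ₗ[ℂ] V := (DirectSum.congrLinearEquiv e).trans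
    (LinearEquiv.ofBijective (DirectSum.coeLinearMap U) hint)
  have hf : ∀ i w, f (DirectSum.lof ℂ ι W i w) = (e i w : V) := by
    intro i w
    simp only [f, LinearEquiv.trans_apply, DirectSum.coe_congrLinearEquiv, DirectSum.lmap_lof]
    exact DirectSum.coeLinearMap_lof U i (e i w)
  refine ⟨f, fun p v hv => ?_, fun p X v => ?_⟩
  · replace hv : ∀ i, v i ∈ (σ i).deg p := by
      intro i
      exact (Submodule.mem_iInf _).1 hv i
    rw [← DirectSum.sum_support_of v, map_sum]
    refine sum_mem fun i _ => ?_
    exact (hf i (v i)).symm ▸ h1 i p _ (hv i)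
  · induction v using DirectSum.induction_on with
    | zero => simp
    | of i w =>
      have h3 : (directSum σ).act p X (DirectSum.lof ℂ ι W i w)
          = DirectSum.lof ℂ ι W i ((σ i).act p X w) := DirectSum.lmap_lof _ _ _
      change f ((directSum σ).act p X (DirectSum.lof ℂ ι W i w))
        = ρ.act p X (f (DirectSum.lof ℂ ι W i w))
      rw [h3, hf, hf, h2]
      rfl
    | add x y hx hy => simp [map_add, hx, hy]

end Rep

theorem zmod_two_cases (a : ZMod 2) : a = 0 ∨ a = 1 := by
  revert a
  decide

@[simp]
theorem sgn_zero : sgn 0 = 1 := by simp [sgn]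

@[simp]
theorem sgn_one : sgn 1 = -1 := by simp [sgn]

@[simp]
theorem par_inl {m n : ℕ} (i : Fin m) : par (Sum.inl i : Idx m n) = 0 := rfl

@[simp]
theorem par_inr {m n : ℕ} (i : Fin n × Fin 2) : par (Sum.inr i : Idx m n) = 1 := rfl

/-! ### The inverse metric -/

/-- The inverse of the metric. -/
def metricInv (m n : ℕ) : Matrix (Idx m n) (Idx m n) ℂ :=
  Matrix.fromBlocks 1 0 0 ((-4 : ℂ) • sympl n)

/-- This is the source of the factor -4 in `metricInv`. -/
theorem sympl_mul_sympl (n : ℕ) : sympl n * sympl n = (-(1 / 4) : ℂ) • 1 := by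
  ext ⟨i, x⟩ ⟨j, y⟩
  simp only [Matrix.mul_apply, Fintype.sum_prod_type, Matrix.smul_apply, Matrix.one_apply]
  rw [Finset.sum_eq_single i]
  · fin_cases x <;> fin_cases y <;> by_cases h : i = j <;> simp [sympl, h] <;> norm_num
  · intro b _ hb
    simp [sympl, hb.symm]
  · simp

theorem metric_mul_metricInv (m n : ℕ) : metric m n * metricInv m n = 1 := by
  rw [metric, metricInv, Matrix.fromBlocks_multiply]
  simp [sympl_mul_sympl, smul_smul, Matrix.fromBlocks_one]

theorem metricInv_mul_metric (m n : ℕ) : metricInv m n * metric m n = 1 := by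
  rw [metric, metricInv, Matrix.fromBlocks_multiply]
  simp [sympl_mul_sympl, smul_smul, Matrix.fromBlocks_one]

theorem sympl_swap (n : ℕ) (i j) : sympl n j i = -sympl n i j := by
  obtain ⟨i, x⟩ := i
  obtain ⟨j, y⟩ := j
  by_cases h : i = j
  · fin_cases x <;> fin_cases y <;> simp [sympl, h]
  · simp [sympl, h, Ne.symm h]

theorem metric_swap {m n : ℕ} (i j : Idx m n) : metric m n j i = sgn (par i) * metric m n i j := by
  rcases i with i | i <;> rcases j with j | j
  · simp [metric, Matrix.one_apply, eq_comm]
  · simp [metric]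
  · simp [metric]
  · simp [metric, sympl_swap n i]

theorem metricInv_swap {m n : ℕ} (i j : Idx m n) :
    metricInv m n j i = sgn (par i) * metricInv m n i j := by
  rcases i with i | i <;> rcases j with j | j
  · simp [metricInv, Matrix.one_apply, eq_comm]
  · simp [metricInv]
  · simp [metricInv]
  · simp [metricInv, sympl_swap n i]

theorem metric_eq_zero {m n : ℕ} {i j : Idx m n} (h : par i ≠ par j) : metric m n i j = 0 := by
  rcases i with i | i <;> rcases j with j | j <;> simp [metric] at h ⊢

theorem metricInv_eq_zero {m n : ℕ} {i j : Idx m n} (h : par i ≠ par j) :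
    metricInv m n i j = 0 := by
  rcases i with i | i <;> rcases j with j | j <;> simp [metricInv] at h ⊢

theorem sgn_mul_self (a : ZMod 2) : sgn (a * a) = sgn a := by
  rcases zmod_two_cases a with rfl | rfl <;> simp

/-- A product `Z g` with `Z` super-antisymmetric belongs to `osp(m|2n)`. -/
theorem mul_metric_mem_osp {m n : ℕ} {p : ZMod 2} {Z : Matrix (Idx m n) (Idx m n) ℂ}
    (hZ : Z ∈ gl m n p) (h : ∀ i l, Z l i = -(sgn (par i * par l) * Z i l)) :
    Z * metric m n ∈ osp m n p := by
  refine ⟨?_, fun i j => ?_⟩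
  · have : metric m n ∈ gl m n 0 := by
      intro i j hij
      refine metric_eq_zero fun h => hij ?_
      rw [h, CharTwo.add_self_eq_zero]
    simpa using gl_mul_mem hZ this
  · rw [Matrix.transpose_mul, Matrix.mul_assoc, Matrix.mul_apply, Matrix.mul_apply,
      Finset.mul_sum, ← Finset.sum_add_distrib]
    refine Finset.sum_eq_zero fun k _ => ?_
    rw [Matrix.mul_apply, Matrix.mul_apply, Finset.mul_sum, Finset.mul_sum, Finset.mul_sum,
      ← Finset.sum_add_distrib]
    refine Finset.sum_eq_zero fun l _ => ?_
    simp only [Matrix.transpose_apply]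
    rw [metric_swap i k, h k l]
    by_cases h1 : par i = par k
    · by_cases h2 : par k + par l = p
      · have h3 : sgn (p * par i) = sgn (par i) * sgn (par k * par l) := by
          rw [← h1, ← sgn_add, ← h2, ← h1]
          congr 1
          rcases zmod_two_cases (par i) with h | h <;> simp [h]
        rw [h3]
        ring
      · rw [hZ k l h2]
        ring
    · rw [metric_eq_zero h1]
      ring

/-- For `X` in `osp(m|2n)` the product `X g⁻¹` is super-antisymmetric. -/
theorem mul_metricInv_swap {m n : ℕ} {p : ZMod 2} {X : Matrix (Idx m n) (Idx m n) ℂ}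
    (hX : X ∈ osp m n p) (i l : Idx m n) :
    (X * metricInv m n) l i
      = -(sgn (par i * par l) * (X * metricInv m n) i l) := by
  have hgl : X * metricInv m n ∈ gl m n p := by
    have : metricInv m n ∈ gl m n 0 := by
      intro i j hij
      refine metricInv_eq_zero fun h => hij ?_
      rw [h, CharTwo.add_self_eq_zero]
    simpa using gl_mul_mem hX.1 this
  have e1 : (X * metricInv m n).transpose
      = (metricInv m n).transpose * (X.transpose * metric m n) * metricInv m n := by
    rw [Matrix.transpose_mul, Matrix.mul_assoc, Matrix.mul_assoc, metric_mul_metricInv,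
      Matrix.mul_one]
  have e2 : (metricInv m n).transpose * (X.transpose * metric m n)
      = (Matrix.of fun i j => -(sgn (par i) * sgn (p * par i)
        * (metricInv m n * (metric m n * X)) i j)) := by
    ext i j
    rw [Matrix.mul_apply, Matrix.of_apply, Matrix.mul_apply, Finset.mul_sum,
      ← Finset.sum_neg_distrib]
    refine Finset.sum_congr rfl fun k _ => ?_
    rw [Matrix.transpose_apply, metricInv_swap]
    by_cases h : par i = par k
    · have := hX.2 k j
      rw [h]
      linear_combination sgn (par k) * metricInv m n i k * this
    · rw [metricInv_eq_zero h]
      ring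
  have e3 : (X * metricInv m n) l i = -(sgn (par i) * sgn (p * par i)
      * (X * metricInv m n) i l) := by
    rw [← Matrix.transpose_apply (X * metricInv m n), e1, e2, ← Matrix.mul_assoc,
      metricInv_mul_metric, Matrix.one_mul, Matrix.mul_apply, Matrix.mul_apply, Finset.mul_sum,
      ← Finset.sum_neg_distrib]
    refine Finset.sum_congr rfl fun k _ => ?_
    rw [Matrix.of_apply]
    ring
  rw [e3]
  -- Entries of parity other than `p` vanish; for the others par i + p·par i = par i·par l in `ZMod
  -- 2`.
  by_cases h : par i + par l = p
  · rw [← sgn_add, ← h]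
    congr 4
    rcases zmod_two_cases (par i) with h | h <;> simp [h, ← add_assoc,
      show (1 + 1 : ZMod 2) = 0 by decide]
  · rw [hgl i l h]
    ring

/-! ### Elements of `osp(m|2n)` from pairs of vectors -/

/-- The vector `u` is homogeneous of parity `a`. -/
def IsHomogeneousVec {m n : ℕ} (a : ZMod 2) (u : Idx m n → ℂ) : Prop := ∀ i, par i ≠ a → u i = 0

/-- The element of `osp(m|2n)` given by two vectors `u` and `w` of parities `a` and `b`. -/
def wedge {m n : ℕ} (a b : ZMod 2) (u w : Idx m n → ℂ) : Matrix (Idx m n) (Idx m n) ℂ :=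
  (Matrix.vecMulVec u w - sgn (a * b) • Matrix.vecMulVec w u) * metric m n

/-- The matrix u wᵀ ∓ w uᵀ is super-antisymmetric, and right multiplication by the metric sends such
matrices into osp. -/
theorem wedge_mem {m n : ℕ} {a b : ZMod 2} {u w : Idx m n → ℂ} (hu : IsHomogeneousVec a u)
    (hw : IsHomogeneousVec b w) : wedge a b u w ∈ osp m n (a + b) := by
  refine mul_metric_mem_osp (fun i j hij => ?_) fun i l => ?_
  · simp only [Matrix.sub_apply, Matrix.smul_apply, Matrix.vecMulVec_apply, smul_eq_mul]
    have h1 : u i * w j = 0 := by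
      by_cases h : par i = a
      · rw [hw j fun h' => hij (by rw [h, h']), mul_zero]
      · rw [hu i h, zero_mul]
    have h2 : w i * u j = 0 := by
      by_cases h : par i = b
      · rw [hu j fun h' => hij (by rw [h, h', add_comm]), mul_zero]
      · rw [hw i h, zero_mul]
    rw [h1, h2]
    ring
  · simp only [Matrix.sub_apply, Matrix.smul_apply, Matrix.vecMulVec_apply, smul_eq_mul]
    have h1 : (sgn (par i * par l) - sgn (a * b)) * (u i * w l) = 0 := by
      by_cases h : par i = a
      · by_cases h' : par l = b
        · rw [h, h']
          ring
        · rw [hw l h']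
          ring
      · rw [hu i h]
        ring
    have h2 : (sgn (par i * par l) - sgn (a * b)) * (w i * u l) = 0 := by
      by_cases h : par i = b
      · by_cases h' : par l = a
        · rw [h, h', mul_comm b a]
          ring
        · rw [hu l h']
          ring
      · rw [hw i h]
        ring
    linear_combination h1 - sgn (a * b) * h2 - (w i * u l) * sgn_sq (a * b)

theorem wedge_swap {m n : ℕ} (a b : ZMod 2) (u w : Idx m n → ℂ) :
    wedge b a w u = -(sgn (a * b) • wedge a b u w) := by
  rw [wedge, wedge, ← Matrix.smul_mul, ← Matrix.neg_mul, smul_sub, smul_smul, sgn_sq, one_smul,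
    mul_comm b a]
  congr 1
  abel

/-- The bracket of an even element with `wedge`. -/
theorem sbracket_wedge {m n : ℕ} (p a b : ZMod 2) {H : Matrix (Idx m n) (Idx m n) ℂ}
    (hH : H ∈ osp m n 0) (u w : Idx m n → ℂ) :
    sbracket 0 p H (wedge a b u w) = wedge a b (H.mulVec u) w + wedge a b u (H.mulVec w) := by
  have h1 : metric m n * H = -(H.transpose * metric m n) := by
    ext i j
    have := hH.2 i j
    simp only [zero_mul, sgn_zero, one_mul] at this
    rw [Matrix.neg_apply]
    linear_combination this
  simp only [sbracket, wedge, zero_mul, sgn_zero, one_smul, Matrix.mul_assoc, h1, Matrix.mul_neg]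
  simp only [← Matrix.mul_assoc, sub_neg_eq_add, ← Matrix.add_mul]
  congr 1
  simp only [Matrix.mul_sub, Matrix.sub_mul, Matrix.mul_smul, Matrix.smul_mul,
    Matrix.mul_vecMulVec, Matrix.vecMulVec_mul, Matrix.vecMul_transpose]
  abel

/-! ### Weight vectors of the natural module -/

/-- The isotropic vector `e_{2a-1} - η √-1 e_{2a}` of weight `η ε_a`, for `η = 1` or `η = -1`. -/
def isoVec (m n : ℕ) (a : Fin (m / 2)) (η : ℂ) : Idx m n → ℂ :=
  Pi.single (Sum.inl ⟨2 * a, by omega⟩) 1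
    - (η * Complex.I) • Pi.single (Sum.inl ⟨2 * a + 1, by omega⟩) 1

/-- A basis of weight vectors of the natural module, with parities and weights. -/
inductive IsBasic {m n : ℕ} : ZMod 2 → Weight m n → (Idx m n → ℂ) → Prop
  | iso (a : Fin (m / 2)) (η : ℂ) (h : η = 1 ∨ η = -1) : IsBasic 0 (η • eps a) (isoVec m n a η)
  | last (h : Odd m) : IsBasic 0 0 (Pi.single (Sum.inl ⟨m - 1, by have := h.pos; omega⟩) 1)
  | odd (i : Fin n) (x : Fin 2) :
      IsBasic 1 ((if x = 0 then 1 else -1 : ℂ) • del i) (Pi.single (Sum.inr (i, x)) 1)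

theorem isHomogeneousVec_single {m n : ℕ} (j : Idx m n) :
    IsHomogeneousVec (par j) (Pi.single j (1 : ℂ)) := by
  intro i hi
  rw [Pi.single_eq_of_ne]
  rintro rfl
  exact hi rfl

theorem IsBasic.isHomogeneousVec {m n : ℕ} {a : ZMod 2} {ν : Weight m n} {u : Idx m n → ℂ}
    (h : IsBasic a ν u) : IsHomogeneousVec a u := by
  cases h with
  | iso a η h =>
    intro i hi
    have h1 := isHomogeneousVec_single (n := n) (Sum.inl ⟨2 * a, by omega⟩ : Idx m n) i hi
    have h2 := isHomogeneousVec_single (n := n) (Sum.inl ⟨2 * a + 1, by omega⟩ : Idx m n) i hi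
    simp [isoVec, h1, h2]
  | last h => exact isHomogeneousVec_single (Sum.inl _)
  | odd i x => exact isHomogeneousVec_single (Sum.inr _)

theorem cartanMat_inl_mulVec {m n : ℕ} (b : Fin (m / 2)) (v : Idx m n → ℂ) :
    (cartanMat m n (Sum.inl b)).mulVec v
      = Complex.I • (Pi.single (Sum.inl ⟨2 * b, by omega⟩) (v (Sum.inl ⟨2 * b + 1, by omega⟩))
        - Pi.single (Sum.inl ⟨2 * b + 1, by omega⟩) (v (Sum.inl ⟨2 * b, by omega⟩))) := by
  simp only [cartanMat, Matrix.smul_mulVec, Matrix.sub_mulVec, Matrix.single_mulVec, one_mul]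
  rfl

theorem cartanMat_inr_mulVec {m n : ℕ} (i : Fin n) (v : Idx m n → ℂ) :
    (cartanMat m n (Sum.inr i)).mulVec v
      = Pi.single (Sum.inr (i, 0)) (v (Sum.inr (i, 0)))
        - Pi.single (Sum.inr (i, 1)) (v (Sum.inr (i, 1))) := by
  simp only [cartanMat, Matrix.sub_mulVec, Matrix.single_mulVec, one_mul]
  rfl

theorem IsBasic.mulVec {m n : ℕ} {a : ZMod 2} {ν : Weight m n} {u : Idx m n → ℂ}
    (h : IsBasic a ν u) (s : Fin (m / 2) ⊕ Fin n) : (cartanMat m n s).mulVec u = ν s • u := by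
  cases h with
  | iso a η h =>
    rcases s with b | i
    · rw [cartanMat_inl_mulVec]
      by_cases hab : b = a
      · subst hab
        have hη : η * η = 1 := by rcases h with rfl | rfl <;> norm_num
        ext i
        simp [eps, isoVec, Pi.single_apply]
        split_ifs with h1 h2
        · rw [h1] at h2
          simp at h2
        · linear_combination (-η) * Complex.I_mul_I
        · linear_combination Complex.I * hη
        · ring
      · have h1 : (b : ℕ) ≠ a := fun h => hab (Fin.ext h)
        ext i
        simp [eps, isoVec, Pi.single_apply, hab, h1, show ¬ (2 * (b : ℕ) + 1 = 2 * a) by omega,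
          show ¬ (2 * (b : ℕ) = 2 * a + 1) by omega]
    · rw [cartanMat_inr_mulVec]
      simp [isoVec, eps]
  | last h =>
    rcases s with b | i
    · have h1 := h.pos
      have h2 : ¬ (2 * (b : ℕ) = m - 1) := by have := b.2; rcases h with ⟨c, rfl⟩; omega
      have h3 : ¬ (2 * (b : ℕ) + 1 = m - 1) := by have := b.2; rcases h with ⟨c, rfl⟩; omega
      rw [cartanMat_inl_mulVec]
      simp [h2, h3]
    · rw [cartanMat_inr_mulVec]
      simp
  | odd i x =>
    rcases s with b | j
    · rw [cartanMat_inl_mulVec]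
      simp [del]
    · rw [cartanMat_inr_mulVec]
      by_cases hij : j = i
      · subst hij
        fin_cases x <;> simp [del]
      · simp [del, hij]

/-- In each rotation plane the two coordinate vectors are half the sum, and √-1/2 times the
difference, of the two isotropic vectors; for odd `m` one coordinate is left over. -/
theorem single_mem_span_isBasic {m n : ℕ} (j : Idx m n) :
    (Pi.single j 1 : Idx m n → ℂ) ∈ Submodule.span ℂ {u | ∃ ν, IsBasic (par j) ν u} := by
  rcases j with j | ⟨i, x⟩
  · by_cases hj : (j : ℕ) / 2 < m / 2
    · have h1 : isoVec m n ⟨j / 2, hj⟩ 1 ∈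
          Submodule.span ℂ {u | ∃ ν, IsBasic (par (Sum.inl j : Idx m n)) ν u} :=
        Submodule.subset_span ⟨_, IsBasic.iso _ _ (Or.inl rfl)⟩
      have h2 : isoVec m n ⟨j / 2, hj⟩ (-1) ∈
          Submodule.span ℂ {u | ∃ ν, IsBasic (par (Sum.inl j : Idx m n)) ν u} :=
        Submodule.subset_span ⟨_, IsBasic.iso _ _ (Or.inr rfl)⟩
      rcases Nat.even_or_odd' (j : ℕ) with ⟨c, hc | hc⟩
      · have : (Pi.single (Sum.inl j) 1 : Idx m n → ℂ)
            = (1 / 2 : ℂ) • (isoVec m n ⟨j / 2, hj⟩ 1 + isoVec m n ⟨j / 2, hj⟩ (-1)) := by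
          have hj' : (⟨2 * (j / 2), by omega⟩ : Fin m) = j := Fin.ext (by simp; omega)
          ext i
          simp [isoVec, hj']
          ring
        rw [this]
        exact Submodule.smul_mem _ _ (add_mem h1 h2)
      · have : (Pi.single (Sum.inl j) 1 : Idx m n → ℂ)
            = (Complex.I / 2 : ℂ) • (isoVec m n ⟨j / 2, hj⟩ 1 - isoVec m n ⟨j / 2, hj⟩ (-1)) := by
          have hj' : (⟨2 * (j / 2) + 1, by omega⟩ : Fin m) = j := Fin.ext (by simp; omega)
          ext i
          simp [isoVec, hj']
          linear_combination (Pi.single (Sum.inl j) 1 : Idx m n → ℂ) i * Complex.I_mul_I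
        rw [this]
        exact Submodule.smul_mem _ _ (sub_mem h1 h2)
    · have hm : Odd m := by
        rw [Nat.odd_iff]
        have := j.2
        omega
      have hj' : j = ⟨m - 1, by have := hm.pos; omega⟩ := Fin.ext (by
        have := j.2
        simp
        omega)
      rw [hj']
      exact Submodule.subset_span ⟨_, IsBasic.last hm⟩
  · exact Submodule.subset_span ⟨_, IsBasic.odd i x⟩

/-! ### The triangular decomposition -/

/-- `μ` is a root for the given choice of positive roots. -/
def IsRoot {m n : ℕ} (μ : Weight m n) : Prop := IsPositiveRoot μ ∨ IsPositiveRoot (-μ)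

theorem isRoot_eps {m n : ℕ} {a b : Fin (m / 2)} (hab : a ≠ b) {η η' : ℂ} (h : η = 1 ∨ η = -1)
    (h' : η' = 1 ∨ η' = -1) : IsRoot (η • eps a + η' • eps b : Weight m n) := by
  have key : ∀ {a b : Fin (m / 2)}, a < b → ∀ {η η' : ℂ}, (η = 1 ∨ η = -1) →
      (η' = 1 ∨ η' = -1) → IsRoot (η • eps a + η' • eps b : Weight m n) := by
    intro a b hab η η' h h'
    rcases h with rfl | rfl <;> rcases h' with rfl | rfl
    · exact Or.inl (by simpa using IsPositiveRoot.eps_add_eps a b hab)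
    · exact Or.inl (by simpa [sub_eq_add_neg] using IsPositiveRoot.eps_sub_eps a b hab)
    · exact Or.inr (by simpa [sub_eq_add_neg, add_comm] using IsPositiveRoot.eps_sub_eps a b hab)
    · exact Or.inr (by simpa [add_comm] using IsPositiveRoot.eps_add_eps a b hab)
  rcases lt_or_gt_of_ne hab with hlt | hlt
  · exact key hlt h h'
  · rw [add_comm]
    exact key hlt h' h

theorem isRoot_del {m n : ℕ} {i j : Fin n} (hij : i ≠ j) {η η' : ℂ} (h : η = 1 ∨ η = -1)
    (h' : η' = 1 ∨ η' = -1) : IsRoot (η • del i + η' • del j : Weight m n) := by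
  have key : ∀ {i j : Fin n}, i < j → ∀ {η η' : ℂ}, (η = 1 ∨ η = -1) →
      (η' = 1 ∨ η' = -1) → IsRoot (η • del i + η' • del j : Weight m n) := by
    intro a b hab η η' h h'
    rcases h with rfl | rfl <;> rcases h' with rfl | rfl
    · exact Or.inl (by simpa using IsPositiveRoot.del_add_del a b hab)
    · exact Or.inl (by simpa [sub_eq_add_neg] using IsPositiveRoot.del_sub_del a b hab)
    · exact Or.inr (by simpa [sub_eq_add_neg, add_comm] using IsPositiveRoot.del_sub_del a b hab)
    · exact Or.inr (by simpa [add_comm] using IsPositiveRoot.del_add_del a b hab)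
  rcases lt_or_gt_of_ne hij with hlt | hlt
  · exact key hlt h h'
  · rw [add_comm]
    exact key hlt h' h

theorem isRoot_eps_del {m n : ℕ} (a : Fin (m / 2)) (i : Fin n) {η η' : ℂ} (h : η = 1 ∨ η = -1)
    (h' : η' = 1 ∨ η' = -1) : IsRoot (η • eps a + η' • del i : Weight m n) := by
  rcases h with rfl | rfl <;> rcases h' with rfl | rfl
  · exact Or.inl (by simpa using IsPositiveRoot.eps_add_del a i)
  · exact Or.inl (by simpa [sub_eq_add_neg] using IsPositiveRoot.eps_sub_del a i)
  · exact Or.inr (by simpa [sub_eq_add_neg, add_comm] using IsPositiveRoot.eps_sub_del a i)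
  · exact Or.inr (by simpa [add_comm] using IsPositiveRoot.eps_add_del a i)

theorem single_inl_vecMul_metric {m n : ℕ} (i : Fin m) :
    Matrix.vecMul (Pi.single (Sum.inl i) 1) (metric m n) = Pi.single (Sum.inl i) 1 := by
  ext j
  rcases j with j | j <;> simp [metric, Matrix.one_apply, Pi.single_apply, eq_comm]

theorem single_inr_zero_vecMul_metric {m n : ℕ} (i : Fin n) :
    Matrix.vecMul (Pi.single (Sum.inr (i, 0)) 1) (metric m n)
      = (-(1 / 2) : ℂ) • Pi.single (Sum.inr (i, 1)) 1 := by
  ext j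
  rcases j with j | ⟨j, y⟩
  · simp [metric]
  · fin_cases y <;> by_cases h : i = j <;>
      simp [metric, sympl, h, eq_comm]

theorem single_inr_one_vecMul_metric {m n : ℕ} (i : Fin n) :
    Matrix.vecMul (Pi.single (Sum.inr (i, 1)) 1) (metric m n)
      = (1 / 2 : ℂ) • Pi.single (Sum.inr (i, 0)) 1 := by
  ext j
  rcases j with j | ⟨j, y⟩
  · simp [metric]
  · fin_cases y <;> by_cases h : i = j <;>
      simp [metric, sympl, h, eq_comm]

theorem vecMulVec_single_single {m n : ℕ} (i j : Idx m n) :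
    Matrix.vecMulVec (Pi.single i (1 : ℂ)) (Pi.single j 1) = Matrix.single i j 1 := by
  rw [Matrix.single_eq_single_vecMulVec_single]

theorem wedge_isoVec {m n : ℕ} (a : Fin (m / 2)) :
    wedge 0 0 (isoVec m n a 1) (isoVec m n a (-1)) = (2 : ℂ) • cartanMat m n (Sum.inl a) := by
  simp only [wedge, isoVec, cartanMat, Matrix.sub_mul, Matrix.vecMulVec_mul, Matrix.smul_mul,
    Matrix.sub_vecMul, Matrix.smul_vecMul, single_inl_vecMul_metric]
  simp only [Matrix.sub_vecMulVec, Matrix.vecMulVec_sub, Matrix.smul_vecMulVec,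
    Matrix.vecMulVec_smul, vecMulVec_single_single, mul_zero, sgn_zero]
  module

theorem wedge_odd {m n : ℕ} (i : Fin n) :
    wedge 1 1 (Pi.single (Sum.inr (i, 0)) 1 : Idx m n → ℂ) (Pi.single (Sum.inr (i, 1)) 1)
      = (1 / 2 : ℂ) • cartanMat m n (Sum.inr i) := by
  simp only [wedge, cartanMat, Matrix.sub_mul, Matrix.vecMulVec_mul, Matrix.smul_mul,
    single_inr_zero_vecMul_metric, single_inr_one_vecMul_metric, Matrix.vecMulVec_smul]
  simp only [vecMulVec_single_single, mul_one, sgn_one]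
  module

/-- `osp(m|2n)` is spanned by root vectors and the Cartan subalgebra. -/
theorem osp_le_of_roots {m n : ℕ} {p : ZMod 2} (Q : Submodule ℂ (Matrix (Idx m n) (Idx m n) ℂ))
    (hroot : ∀ (μ : Weight m n), IsRoot μ → ∀ X : osp m n p, HasWeight X μ → X.1 ∈ Q)
    (hcartan : p = 0 → ∀ s, cartanMat m n s ∈ Q) : osp m n p ≤ Q := by
  have h1 : ∀ (a b : ZMod 2) (ν ν' : Weight m n) (u w : Idx m n → ℂ), IsBasic a ν u →
      IsBasic b ν' w → a + b = p → wedge a b u w ∈ Q := by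
    intro a b ν ν' u w hu hw hab
    subst hab
    -- Weights add under `wedge`, so a wedge of two basic vectors is a root vector whenever the sum
    -- of their weights is a root.
    have hr : IsRoot (ν + ν') → wedge a b u w ∈ Q := by
      intro hr
      refine hroot _ hr ⟨wedge a b u w, wedge_mem hu.isHomogeneousVec hw.isHomogeneousVec⟩ ?_
      intro s
      rw [sbracket_wedge _ _ _ (cartanMat_mem m n s), hu.mulVec, hw.mulVec]
      simp only [wedge, ← Matrix.smul_mul, ← Matrix.add_mul, Matrix.vecMulVec_smul,
        Matrix.smul_vecMulVec, Pi.add_apply]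
      congr 1
      module
    -- An even vector wedged with itself is zero. This disposes of the sums ±2ε_a and of the last
    -- coordinate with itself, which are not roots.
    have hsame : a = 0 → u = w → a = b → wedge a b u w ∈ Q := by
      rintro rfl rfl rfl
      simp [wedge]
    cases hu with
    | iso a η h =>
      cases hw with
      | iso b η' h' =>
        by_cases hab : a = b
        · subst hab
          rcases h with rfl | rfl <;> rcases h' with rfl | rfl
          · exact hsame rfl rfl rfl
          · rw [wedge_isoVec]
            exact Submodule.smul_mem _ _ (hcartan (add_zero 0) _)
          · rw [wedge_swap, wedge_isoVec]
            exact neg_mem (Submodule.smul_mem _ _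
              (Submodule.smul_mem _ _ (hcartan (add_zero 0) _)))
          · exact hsame rfl rfl rfl
        · exact hr (isRoot_eps hab h h')
      | last hm =>
        refine hr ?_
        rw [add_zero]
        rcases h with rfl | rfl
        · exact Or.inl (by simpa using IsPositiveRoot.eps_single a hm)
        · exact Or.inr (by simpa using IsPositiveRoot.eps_single a hm)
      | odd i x =>
        exact hr (isRoot_eps_del a i h (by split_ifs <;> simp))
    | last hm =>
      cases hw with
      | iso b η' h' =>
        refine hr ?_
        rw [zero_add]
        rcases h' with rfl | rfl
        · exact Or.inl (by simpa using IsPositiveRoot.eps_single b hm)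
        · exact Or.inr (by simpa using IsPositiveRoot.eps_single b hm)
      | last hm => exact hsame rfl rfl rfl
      | odd i x =>
        refine hr ?_
        rw [zero_add]
        split_ifs
        · exact Or.inl (by simpa using IsPositiveRoot.del_single i hm)
        · exact Or.inr (by simpa using IsPositiveRoot.del_single i hm)
    | odd i x =>
      cases hw with
      | iso b η' h' =>
        refine hr ?_
        rw [add_comm]
        exact isRoot_eps_del b i h' (by split_ifs <;> simp)
      | last hm =>
        refine hr ?_
        rw [add_zero]
        split_ifs
        · exact Or.inl (by simpa using IsPositiveRoot.del_single i hm)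
        · exact Or.inr (by simpa using IsPositiveRoot.del_single i hm)
      | odd j y =>
        by_cases hij : i = j
        · subst hij
          fin_cases x <;> fin_cases y
          · refine hr (Or.inl ?_)
            simpa [two_smul] using IsPositiveRoot.two_del (m := m) i
          · refine (wedge_odd (m := m) i).symm ▸ Submodule.smul_mem _ _ (hcartan (by decide) _)
          · change wedge 1 1 (Pi.single (Sum.inr (i, 1)) 1) (Pi.single (Sum.inr (i, 0)) 1) ∈ Q
            rw [wedge_swap, wedge_odd]
            exact neg_mem (Submodule.smul_mem _ _
              (Submodule.smul_mem _ _ (hcartan (by decide) _)))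
          · refine hr (Or.inr ?_)
            simpa [two_smul] using IsPositiveRoot.two_del (m := m) i
        · exact hr (isRoot_del hij (by split_ifs <;> simp) (by split_ifs <;> simp))
  have h2 : ∀ i j : Idx m n, par i + par j = p →
      wedge (par i) (par j) (Pi.single i 1) (Pi.single j 1) ∈ Q := by
    intro i j hij
    have hl : ∀ (c : ZMod 2) (w : Idx m n → ℂ), (∀ ν u, IsBasic (par i) ν u →
        wedge (par i) c u w ∈ Q) → wedge (par i) c (Pi.single i 1) w ∈ Q := by
      intro c w h
      refine Submodule.span_induction (p := fun u _ => wedge (par i) c u w ∈ Q) ?_ ?_ ?_ ?_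
        (single_mem_span_isBasic i)
      · rintro u ⟨ν, hu⟩
        exact h ν u hu
      · simp [wedge]
      · intro u v _ _ hu hv
        have : wedge (par i) c (u + v) w = wedge (par i) c u w + wedge (par i) c v w := by
          simp only [wedge, Matrix.add_vecMulVec, Matrix.vecMulVec_add, ← Matrix.add_mul]
          congr 1
          module
        rw [this]
        exact add_mem hu hv
      · intro a u _ hu
        have : wedge (par i) c (a • u) w = a • wedge (par i) c u w := by
          simp only [wedge, Matrix.smul_vecMulVec, Matrix.vecMulVec_smul, ← Matrix.smul_mul]
          congr 1
          module
        rw [this]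
        exact Submodule.smul_mem _ _ hu
    refine hl _ _ fun ν u hu => ?_
    refine Submodule.span_induction (p := fun w _ => wedge (par i) (par j) u w ∈ Q) ?_ ?_ ?_ ?_
      (single_mem_span_isBasic j)
    · rintro w ⟨ν', hw⟩
      exact h1 _ _ _ _ _ _ hu hw hij
    · simp [wedge]
    · intro w v _ _ hw hv
      have : wedge (par i) (par j) u (w + v)
          = wedge (par i) (par j) u w + wedge (par i) (par j) u v := by
        simp only [wedge, Matrix.add_vecMulVec, Matrix.vecMulVec_add, ← Matrix.add_mul]
        congr 1
        module
      rw [this]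
      exact add_mem hw hv
    · intro a w _ hw
      have : wedge (par i) (par j) u (a • w) = a • wedge (par i) (par j) u w := by
        simp only [wedge, Matrix.smul_vecMulVec, Matrix.vecMulVec_smul, ← Matrix.smul_mul]
        congr 1
        module
      rw [this]
      exact Submodule.smul_mem _ _ hw
  intro X hX
  -- X g⁻¹ is super-antisymmetric, hence equal to half its own super-antisymmetrisation; multiplying
  -- back by g turns this into a combination of wedges.
  have h3 : X = ∑ i, ∑ j, (1 / 2 * (X * metricInv m n) i j) •
      wedge (par i) (par j) (Pi.single i 1) (Pi.single j 1) := by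
    have h4 : X * metricInv m n = ∑ i, ∑ j, (1 / 2 * (X * metricInv m n) i j) •
        (Matrix.vecMulVec (Pi.single i 1) (Pi.single j 1) - sgn (par i * par j) •
          Matrix.vecMulVec (Pi.single j 1) (Pi.single i 1)) := by
      ext k l
      simp only [Matrix.sum_apply, Matrix.smul_apply, Matrix.sub_apply, Matrix.vecMulVec_apply,
        smul_eq_mul, mul_sub, Finset.sum_sub_distrib]
      rw [Finset.sum_eq_single k, Finset.sum_eq_single l, Finset.sum_eq_single l,
        Finset.sum_eq_single k]
      · have h5 := mul_metricInv_swap hX k l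
        simp only [Pi.single_eq_same]
        rw [mul_comm (par l) (par k)]
        have h6 := sgn_sq (par k * par l)
        linear_combination (1 / 2 * sgn (par k * par l)) * h5
          - (X * metricInv m n) k l / 2 * h6
      all_goals simp +contextual [Pi.single_apply, eq_comm]
    have h5 : X = (X * metricInv m n) * metric m n := by
      rw [Matrix.mul_assoc, metricInv_mul_metric, Matrix.mul_one]
    conv_lhs => rw [h5, h4]
    simp only [Finset.sum_mul, Matrix.smul_mul]
    rfl
  rw [h3]
  refine sum_mem fun i _ => sum_mem fun j _ => ?_
  by_cases hij : par i + par j = p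
  · exact Submodule.smul_mem _ _ (h2 i j hij)
  · have : (X * metricInv m n) i j = 0 := by
      have hm : metricInv m n ∈ gl m n 0 := by
        intro i j hij
        refine metricInv_eq_zero fun h => hij ?_
        rw [h, CharTwo.add_self_eq_zero]
      have := gl_mul_mem hX.1 hm
      rw [add_zero] at this
      exact this i j hij
    simp [this]

/-! ### Uniqueness of irreducible highest weight modules -/

/-- Coefficients of an element of the Cartan subalgebra on which all positive roots are positive
integers. -/
def heightCoeff (m n : ℕ) : Fin (m / 2) ⊕ Fin n → ℕ
  | Sum.inl a => n + (m / 2 - a)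
  | Sum.inr i => n - i

/-- The value of a weight on the element of the Cartan subalgebra with the coefficients
`heightCoeff`. -/
def height {m n : ℕ} (μ : Weight m n) : ℂ := ∑ s, (heightCoeff m n s : ℂ) * μ s

theorem height_add {m n : ℕ} (μ ν : Weight m n) : height (μ + ν) = height μ + height ν := by
  simp [height, mul_add, Finset.sum_add_distrib]

theorem height_smul {m n : ℕ} (c : ℂ) (μ : Weight m n) : height (c • μ) = c * height μ := by
  simp only [height, Finset.mul_sum, Pi.smul_apply, smul_eq_mul, mul_left_comm]

theorem height_neg {m n : ℕ} (μ : Weight m n) : height (-μ) = -height μ := by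
  simp [height]

theorem height_sub {m n : ℕ} (μ ν : Weight m n) : height (μ - ν) = height μ - height ν := by
  rw [sub_eq_add_neg, height_add, height_neg, sub_eq_add_neg]

theorem height_single {m n : ℕ} (s : Fin (m / 2) ⊕ Fin n) :
    height (Pi.single s 1 : Weight m n) = heightCoeff m n s := by
  rw [height, Finset.sum_eq_single s] <;> simp +contextual

/-- The coefficients decrease strictly along ε₁, …, ε_{⌊m/2⌋}, δ₁, …, δ_n and stay positive, and the
positive roots follow this order. -/
theorem IsPositiveRoot.exists_height {m n : ℕ} {α : Weight m n} (h : IsPositiveRoot α) :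
    ∃ r : ℕ, height α = r + 1 := by
  have key : ∀ {x y : ℕ}, y < x → ∃ r : ℕ, (x : ℂ) - y = r + 1 := by
    intro x y hxy
    refine ⟨x - y - 1, ?_⟩
    rw [← Nat.cast_sub hxy.le, ← Nat.cast_succ]
    congr 1
    omega
  have key2 : ∀ {x y : ℕ}, 0 < x → ∃ r : ℕ, (x : ℂ) + y = r + 1 := by
    intro x y hx
    refine ⟨x + y - 1, ?_⟩
    rw [← Nat.cast_add, ← Nat.cast_succ]
    congr 1
    omega
  cases h with
  | eps_add_eps a b h =>
    rw [height_add, eps, eps, height_single, height_single]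
    exact key2 (by have := a.2; simp only [heightCoeff]; omega)
  | eps_sub_eps a b h =>
    rw [height_sub, eps, eps, height_single, height_single]
    exact key (by have := b.2; simp only [heightCoeff]; omega)
  | eps_single a h =>
    rw [eps, height_single]
    simpa using key2 (y := 0) (show 0 < heightCoeff m n (Sum.inl a) by
      have := a.2; simp only [heightCoeff]; omega)
  | del_add_del i j h =>
    rw [height_add, del, del, height_single, height_single]
    exact key2 (by have := i.2; simp only [heightCoeff]; omega)
  | del_sub_del i j h =>
    rw [height_sub, del, del, height_single, height_single]
    exact key (by have := j.2; simp only [heightCoeff]; omega)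
  | two_del i =>
    rw [height_smul, del, height_single, two_mul]
    exact key2 (by have := i.2; simp only [heightCoeff]; omega)
  | eps_add_del a i =>
    rw [height_add, eps, del, height_single, height_single]
    exact key2 (by have := a.2; simp only [heightCoeff]; omega)
  | eps_sub_del a i =>
    rw [height_sub, eps, del, height_single, height_single]
    exact key (by have := a.2; simp only [heightCoeff]; omega)
  | del_single i h =>
    rw [del, height_single]
    simpa using key2 (y := 0) (show 0 < heightCoeff m n (Sum.inr i) by
      have := i.2; simp only [heightCoeff]; omega)

/-- The element of the Cartan subalgebra with the coefficients `heightCoeff`. -/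
def heightElt (m n : ℕ) : osp m n 0 := ∑ s, (heightCoeff m n s : ℂ) • cartan m n s

theorem coe_heightElt (m n : ℕ) :
    (heightElt m n : Matrix (Idx m n) (Idx m n) ℂ)
      = ∑ s, (heightCoeff m n s : ℂ) • cartanMat m n s := by
  rw [heightElt, AddSubmonoidClass.coe_finsetSum]
  rfl

theorem HasWeight.sbracket_heightElt {m n : ℕ} {p : ZMod 2} {X : osp m n p} {μ : Weight m n}
    (h : HasWeight X μ) : sbracket 0 p (heightElt m n).1 X.1 = height μ • X.1 := by
  have h' : ∀ s, cartanMat m n s * X.1 - X.1 * cartanMat m n s = μ s • X.1 := by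
    intro s
    simpa [sbracket] using h s
  rw [coe_heightElt, sbracket, zero_mul, sgn_zero, one_smul, Finset.sum_mul, Finset.mul_sum,
    ← Finset.sum_sub_distrib, height, Finset.sum_smul]
  refine Finset.sum_congr rfl fun s _ => ?_
  rw [Matrix.smul_mul, Matrix.mul_smul, ← smul_sub, h', smul_smul]

namespace Rep

variable {m n : ℕ} {V W : Type*} [AddCommGroup V] [Module ℂ V] [AddCommGroup W] [Module ℂ W]

/-- The negative root vectors. -/
def negRootVectors (m n : ℕ) (p : ZMod 2) : Set (osp m n p) :=
  {X | ∃ α, IsPositiveRoot α ∧ HasWeight X (-α)}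

/-- Positive root vectors kill `v`, the Cartan subalgebra scales it, and negative ones define the
closure; these span the algebra. With `isSubmodule_closure` this makes the closure of an even `v` a
submodule. -/
theorem IsHighestWeightVector.act_mem {ρ : Rep m n V} {μ : Weight m n} {v : V}
    (hv : ρ.IsHighestWeightVector μ v) (p : ZMod 2) (X : osp m n p) :
    ρ.act p X v ∈ ρ.closure (negRootVectors m n) v := by
  let Q := ((ρ.closure (negRootVectors m n) v).comap ((ρ.act p).flip v)).map (osp m n p).subtype
  have hQ : osp m n p ≤ Q := by
    refine osp_le_of_roots Q (fun α hα X hX => ⟨X, ?_, rfl⟩) ?_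
    · change ρ.act p X v ∈ ρ.closure (negRootVectors m n) v
      rcases hα with hα | hα
      · rw [hv.2.2 α hα p X hX]
        exact zero_mem _
      · exact ρ.act_mem_closure (negRootVectors m n) v ⟨-α, hα, by rwa [neg_neg]⟩ (ρ.mem_closure_self _ v)
    · rintro rfl s
      refine ⟨cartan m n s, ?_, rfl⟩
      change ρ.act 0 (cartan m n s) v ∈ ρ.closure (negRootVectors m n) v
      rw [hv.2.1 s]
      exact Submodule.smul_mem _ _ (ρ.mem_closure_self _ v)
  obtain ⟨Y, hY, hYX⟩ := hQ X.2
  have : Y = X := Subtype.ext hYX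
  exact this ▸ hY

theorem IsHighestWeightVector.act_heightElt {ρ : Rep m n V} {μ : Weight m n} {v : V}
    (hv : ρ.IsHighestWeightVector μ v) : ρ.act 0 (heightElt m n) v = height μ • v := by
  simp only [heightElt, map_sum, map_smul, LinearMap.sum_apply, LinearMap.smul_apply, hv.2.1,
    height, Finset.sum_smul, smul_smul]

/-- Each negative root vector lowers the eigenvalue of `heightElt` by a positive integer, so nothing
but multiples of `v` stays at the top. -/
theorem IsHighestWeightVector.closure_le {ρ : Rep m n V} {μ : Weight m n} {v : V}
    (hv : ρ.IsHighestWeightVector μ v) :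
    ρ.closure (negRootVectors m n) v ≤ Submodule.span ℂ {v} ⊔
      ⨆ r : ℕ, (ρ.act 0 (heightElt m n)).eigenspace (height μ - (r + 1)) := by
  have hact : ∀ p, ∀ X ∈ negRootVectors m n p, ∃ r : ℕ, ∀ (c : ℂ) (w : V),
      ρ.act 0 (heightElt m n) w = c • w →
      ρ.act 0 (heightElt m n) (ρ.act p X w) = (c - (r + 1)) • ρ.act p X w := by
    rintro p X ⟨α, hα, hX⟩
    obtain ⟨r, hr⟩ := hα.exists_height
    refine ⟨r, fun c w hw => ?_⟩
    rw [act_act, hw, zero_mul, sgn_zero, one_smul, map_smul]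
    -- The bracket lives in parity `0 + p`, which agrees with `p` only propositionally; hence the
    -- transport.
    have h1 : (⟨sbracket 0 p (heightElt m n).1 X.1, sbracket_mem (heightElt m n).2 X.2⟩ :
        osp m n (0 + p)) = cast (by rw [zero_add]) (height (-α) • X) := by
      have h2 : ∀ (q : ZMod 2) (h : q = p) (Y : osp m n q), Y.1 = height (-α) • X.1 →
          Y = cast (by rw [h]) (height (-α) • X) := by
        rintro q rfl Y hY
        exact Subtype.ext hY
      exact h2 _ (zero_add p) _ hX.sbracket_heightElt
    have h3 : ∀ (q : ZMod 2) (h : q = p) (Y : osp m n p),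
        ρ.act q (cast (by rw [h]) Y) w = ρ.act p Y w := by
      rintro q rfl Y
      rfl
    rw [h1, h3 _ (zero_add p), map_smul, LinearMap.smul_apply, height_neg, hr]
    module
  refine ρ.closure_le _ (Submodule.mem_sup_left (Submodule.mem_span_singleton_self v)) ?_
  intro p X hX w hw
  obtain ⟨r, hr⟩ := hact p X hX
  refine Submodule.mem_sup_right ?_
  obtain ⟨a, ha, b, hb, rfl⟩ := Submodule.mem_sup.1 hw
  rw [map_add]
  refine add_mem ?_ ?_
  · obtain ⟨c, rfl⟩ := Submodule.mem_span_singleton.1 ha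
    rw [map_smul]
    refine Submodule.smul_mem _ _ (Submodule.mem_iSup_of_mem r ?_)
    rw [Module.End.mem_eigenspace_iff]
    exact hr _ v hv.act_heightElt
  · clear hw
    induction hb using Submodule.iSup_induction' with
    | mem i x hx =>
      refine Submodule.mem_iSup_of_mem (i + r + 1) ?_
      rw [Module.End.mem_eigenspace_iff] at hx ⊢
      rw [hr _ x hx]
      push_cast
      congr 1
      ring
    | zero => simp
    | add x y hx hy hx' hy' =>
      rw [map_add]
      exact add_mem hx' hy'

theorem IsHighestWeightVector.mem_span {ρ : Rep m n V} {μ : Weight m n} {v : V}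
    (hv : ρ.IsHighestWeightVector μ v) {w : V} (hw : w ∈ ρ.closure (negRootVectors m n) v)
    (hw' : ρ.act 0 (heightElt m n) w = height μ • w) : w ∈ Submodule.span ℂ {v} := by
  obtain ⟨a, ha, b, hb, rfl⟩ := Submodule.mem_sup.1 (hv.closure_le hw)
  obtain ⟨c, rfl⟩ := Submodule.mem_span_singleton.1 ha
  have h1 : b ∈ (ρ.act 0 (heightElt m n)).eigenspace (height μ) := by
    rw [Module.End.mem_eigenspace_iff]
    rw [map_add, map_smul, hv.act_heightElt, smul_add, smul_comm] at hw'
    exact add_left_cancel hw'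
  have h2 := (ρ.act 0 (heightElt m n)).eigenspaces_iSupIndep (height μ)
  have h3 : (⨆ r : ℕ, (ρ.act 0 (heightElt m n)).eigenspace (height μ - (r + 1))) ≤
      ⨆ (j) (_ : j ≠ height μ), (ρ.act 0 (heightElt m n)).eigenspace j := by
    refine iSup_le fun r => le_iSup₂_of_le (height μ - (r + 1)) ?_ le_rfl
    intro h
    have : ((r : ℂ) + 1) = 0 := by linear_combination -h
    exact Nat.cast_add_one_ne_zero r this
  have : b = 0 := Submodule.disjoint_def.1 h2 b h1 (h3 hb)
  rw [this, add_zero]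
  exact ha

/-- Irreducible modules with even highest weight vectors of the same weight are isomorphic. -/
theorem isomorphic_of_highestWeight {ρ : Rep m n V} {σ : Rep m n W} {μ : Weight m n}
    (hρ : ρ.IsIrreducible) (hσ : σ.IsIrreducible) {v : V} {w : W} (hv : v ∈ ρ.deg 0)
    (hw : w ∈ σ.deg 0) (hv' : ρ.IsHighestWeightVector μ v)
    (hw' : σ.IsHighestWeightVector μ w) : ρ.Isomorphic σ := by
  have hu : (ρ.prod σ).IsHighestWeightVector μ (v, w) := by
    refine ⟨fun h => hv'.1 (Prod.ext_iff.1 h).1, fun s => ?_, fun α hα p X hX => ?_⟩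
    · rw [prod_act, hv'.2.1, hw'.2.1]
      rfl
    · rw [prod_act, hv'.2.2 α hα p X hX, hw'.2.2 α hα p X hX]
      rfl
  -- `M` will be the graph of the isomorphism.
  set M := (ρ.prod σ).closure (negRootVectors m n) (v, w) with hM
  have hMsub : (ρ.prod σ).IsSubmodule M :=
    isSubmodule_closure _ _ (show (v, w) ∈ (ρ.deg 0).prod (σ.deg 0) from ⟨hv, hw⟩) hu.act_mem
  have hvw : (v, w) ∈ M := mem_closure_self _ _ _
  have hdis := Submodule.disjoint_def.1 σ.isCompl.disjoint
  have hdis' := Submodule.disjoint_def.1 ρ.isCompl.disjoint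
  -- These `x` form a submodule of an irreducible module. Were it everything, `(v, 0)` would be a
  -- vector of top height in `M`, hence proportional to `(v, w)`, which is impossible as `v` and `w`
  -- are nonzero.
  have hl : ∀ x, (x, (0 : W)) ∈ M → x = 0 := by
    have h1 : ρ.IsSubmodule (M.comap (LinearMap.inl ℂ V W)) := by
      refine isSubmodule_of (fun p X x hx => ?_) fun x hx => ?_
      · have := hMsub.1 p X _ hx
        simpa [prod_act] using this
      · obtain ⟨a, b, ha, ha', hb, hb', hab⟩ := hMsub.exists_decomp (v := (x, (0 : W))) hx
        obtain ⟨a1, a2⟩ := a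
        obtain ⟨b1, b2⟩ := b
        have h2 : a2 + b2 = 0 := (Prod.ext_iff.1 hab).2
        have h3 : a2 = 0 := hdis a2 ha'.2 (by
          rw [eq_neg_of_add_eq_zero_left h2]; exact neg_mem hb'.2)
        have h4 : b2 = 0 := by rwa [h3, zero_add] at h2
        subst h3 h4
        exact ⟨a1, b1, ha, ha'.1, hb, hb'.1, (Prod.ext_iff.1 hab).1⟩
    rcases hρ.2 _ h1 with h2 | h2
    · intro x hx
      have : x ∈ M.comap (LinearMap.inl ℂ V W) := hx
      rwa [h2, Submodule.mem_bot] at this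
    · have h3 : v ∈ M.comap (LinearMap.inl ℂ V W) := h2 ▸ Submodule.mem_top
      have h4 := hu.mem_span (w := (v, (0 : W))) h3 (by
        rw [prod_act, hv'.act_heightElt, map_zero]
        simp)
      obtain ⟨c, hc⟩ := Submodule.mem_span_singleton.1 h4
      have hc1 : c • v = v := (Prod.ext_iff.1 hc).1
      have hc2 : c • w = 0 := (Prod.ext_iff.1 hc).2
      rcases smul_eq_zero.1 hc2 with h5 | h5
      · rw [h5, zero_smul] at hc1
        exact absurd hc1.symm hv'.1
      · exact absurd h5 hw'.1
  have hr : ∀ x, ((0 : V), x) ∈ M → x = 0 := by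
    have h1 : σ.IsSubmodule (M.comap (LinearMap.inr ℂ V W)) := by
      refine isSubmodule_of (fun p X x hx => ?_) fun x hx => ?_
      · have := hMsub.1 p X _ hx
        simpa [prod_act] using this
      · obtain ⟨a, b, ha, ha', hb, hb', hab⟩ := hMsub.exists_decomp (v := ((0 : V), x)) hx
        obtain ⟨a1, a2⟩ := a
        obtain ⟨b1, b2⟩ := b
        have h2 : a1 + b1 = 0 := (Prod.ext_iff.1 hab).1
        have h3 : a1 = 0 := hdis' a1 ha'.1 (by
          rw [eq_neg_of_add_eq_zero_left h2]; exact neg_mem hb'.1)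
        have h4 : b1 = 0 := by rwa [h3, zero_add] at h2
        subst h3 h4
        exact ⟨a2, b2, ha, ha'.2, hb, hb'.2, (Prod.ext_iff.1 hab).2⟩
    rcases hσ.2 _ h1 with h2 | h2
    · intro x hx
      have : x ∈ M.comap (LinearMap.inr ℂ V W) := hx
      rwa [h2, Submodule.mem_bot] at this
    · have h3 : w ∈ M.comap (LinearMap.inr ℂ V W) := h2 ▸ Submodule.mem_top
      have h4 := hu.mem_span (w := ((0 : V), w)) h3 (by
        rw [prod_act, hw'.act_heightElt, map_zero]
        simp)
      obtain ⟨c, hc⟩ := Submodule.mem_span_singleton.1 h4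
      have hc1 : c • v = 0 := (Prod.ext_iff.1 hc).1
      have hc2 : c • w = w := (Prod.ext_iff.1 hc).2
      rcases smul_eq_zero.1 hc1 with h5 | h5
      · rw [h5, zero_smul] at hc2
        exact absurd hc2.symm hw'.1
      · exact absurd h5 hv'.1
  have hsub1 : ρ.IsSubmodule (M.map (LinearMap.fst ℂ V W)) := by
    refine isSubmodule_of ?_ ?_
    · rintro p X _ ⟨u, hu, rfl⟩
      exact ⟨_, hMsub.1 p X u hu, rfl⟩
    · rintro _ ⟨u, hu, rfl⟩
      obtain ⟨a, b, ha, ha', hb, hb', rfl⟩ := hMsub.exists_decomp hu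
      exact ⟨a.1, b.1, ⟨a, ha, rfl⟩, ha'.1, ⟨b, hb, rfl⟩, hb'.1, rfl⟩
  have hsub2 : σ.IsSubmodule (M.map (LinearMap.snd ℂ V W)) := by
    refine isSubmodule_of ?_ ?_
    · rintro p X _ ⟨u, hu, rfl⟩
      exact ⟨_, hMsub.1 p X u hu, rfl⟩
    · rintro _ ⟨u, hu, rfl⟩
      obtain ⟨a, b, ha, ha', hb, hb', rfl⟩ := hMsub.exists_decomp hu
      exact ⟨a.2, b.2, ⟨a, ha, rfl⟩, ha'.2, ⟨b, hb, rfl⟩, hb'.2, rfl⟩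
  have hsurj1 : ∀ x, ∃ y, (x, y) ∈ M := by
    intro x
    rcases hρ.2 _ hsub1 with h | h
    · exact absurd ((Submodule.eq_bot_iff _).1 h v ⟨_, hvw, rfl⟩) hv'.1
    · obtain ⟨⟨a, b⟩, hab, rfl⟩ : x ∈ M.map (LinearMap.fst ℂ V W) := h ▸ Submodule.mem_top
      exact ⟨b, hab⟩
  have hsurj2 : ∀ y, ∃ x, (x, y) ∈ M := by
    intro y
    rcases hσ.2 _ hsub2 with h | h
    · exact absurd ((Submodule.eq_bot_iff _).1 h w ⟨_, hvw, rfl⟩) hw'.1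
    · obtain ⟨⟨a, b⟩, hab, rfl⟩ : y ∈ M.map (LinearMap.snd ℂ V W) := h ▸ Submodule.mem_top
      exact ⟨a, hab⟩
  have hb1 : Function.Bijective ((LinearMap.fst ℂ V W).comp M.subtype) := by
    constructor
    · rw [injective_iff_map_eq_zero]
      rintro ⟨⟨a, b⟩, hab⟩ h
      have ha : a = 0 := h
      subst ha
      have := hr b hab
      subst this
      rfl
    · intro x
      obtain ⟨y, hy⟩ := hsurj1 x
      exact ⟨⟨_, hy⟩, rfl⟩
  have hb2 : Function.Bijective ((LinearMap.snd ℂ V W).comp M.subtype) := by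
    constructor
    · rw [injective_iff_map_eq_zero]
      rintro ⟨⟨a, b⟩, hab⟩ h
      have ha : b = 0 := h
      subst ha
      have := hl a hab
      subst this
      rfl
    · intro x
      obtain ⟨y, hy⟩ := hsurj2 x
      exact ⟨⟨_, hy⟩, rfl⟩
  have i1 : ((ρ.prod σ).sub M hMsub).Isomorphic ρ :=
    ⟨LinearEquiv.ofBijective _ hb1, fun p u hu => hu.1, fun p X u => rfl⟩
  have i2 : ((ρ.prod σ).sub M hMsub).Isomorphic σ :=
    ⟨LinearEquiv.ofBijective _ hb2, fun p u hu => hu.2, fun p X u => rfl⟩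
  exact i1.symm.trans i2

theorem IsL.isomorphic {ρ : Rep m n V} {σ : Rep m n W} {k : ℕ} (hρ : ρ.IsL k) (hσ : σ.IsL k) :
    ρ.Isomorphic σ := by
  obtain ⟨h1, v, hv, hv'⟩ := hρ
  obtain ⟨h2, w, hw, hw'⟩ := hσ
  exact isomorphic_of_highestWeight h1 h2 hv hw hv' hw'

end Rep

theorem metric_mul_metricInv_apply {m n : ℕ} (i j : Idx m n) :
    ∑ k, metric m n i k * metricInv m n k j = if i = j then 1 else 0 := by
  rw [← Matrix.mul_apply, metric_mul_metricInv, Matrix.one_apply]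

theorem metricInv_mul_metric_apply {m n : ℕ} (i j : Idx m n) :
    ∑ k, metricInv m n i k * metric m n k j = if i = j then 1 else 0 := by
  rw [← Matrix.mul_apply, metricInv_mul_metric, Matrix.one_apply]

/-! ### Super Weyl algebra relations -/

/-- The relations between the coordinates `x` and the derivatives `d` of a superspace. -/
structure IsWeyl {r n : ℕ} {A : Type*} [Ring A] [Algebra ℂ A] (x d : Idx r n → A) : Prop where
  xx : ∀ i j, x i * x j = sgn (par i * par j) • (x j * x i)
  dd : ∀ i j, d i * d j = sgn (par i * par j) • (d j * d i)
  dx : ∀ i j, d i * x j = sgn (par i * par j) • (x j * d i) + if i = j then 1 else 0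

section

variable {r n : ℕ} {A : Type*} [Ring A] [Algebra ℂ A]

/-- The coordinates with raised indices. -/
def sharp (x : Idx r n → A) (a : Idx r n) : A := ∑ l, metricInv r n a l • x l

/-- The square of the radius. -/
def rsq (x : Idx r n → A) : A := ∑ j, x j * sharp x j

/-- The Euler operator. -/
def euler (x d : Idx r n → A) : A := ∑ j, x j * d j

/-- The Laplace operator. -/
def lap (d : Idx r n → A) : A := ∑ b, ∑ c, metric r n b c • (d c * d b)

theorem sum_metric_smul_sharp (x : Idx r n → A) (b : Idx r n) :
    ∑ c, metric r n b c • sharp x c = x b := by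
  simp only [sharp, Finset.smul_sum, smul_smul]
  rw [Finset.sum_comm]
  simp only [← Finset.sum_smul, metric_mul_metricInv_apply]
  simp

theorem sum_metric_smul_sharp' (x : Idx r n → A) (c : Idx r n) :
    ∑ b, (metric r n b c * sgn (par c)) • sharp x b = x c := by
  rw [← sum_metric_smul_sharp x c]
  refine Finset.sum_congr rfl fun b _ => ?_
  rw [metric_swap c b, mul_right_comm, sgn_sq, one_mul]

/-- Both factors carry their indices in the same order, so each odd coordinate contributes -1: the
contraction is the superdimension. -/
theorem sum_metric_mul_metricInv :
    ∑ b, ∑ c, metric r n b c * metricInv r n b c = (r : ℂ) - 2 * n := by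
  have h : ∀ b : Idx r n, ∑ c, metric r n b c * metricInv r n b c = sgn (par b) := by
    intro b
    have := metric_mul_metricInv_apply b b
    rw [if_pos rfl] at this
    rw [← mul_one (sgn (par b)), ← this, Finset.mul_sum]
    refine Finset.sum_congr rfl fun c _ => ?_
    rw [metricInv_swap b c]
    linear_combination -(metric r n b c * metricInv r n b c) * sgn_sq (par b)
  simp only [h]
  simp
  ring

namespace IsWeyl

variable {x d : Idx r n → A} (h : IsWeyl x d)
include h

theorem x_sharp (a b : Idx r n) : x a * sharp x b = sgn (par a * par b) • (sharp x b * x a) := by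
  simp only [sharp, Finset.mul_sum, Finset.sum_mul, Finset.smul_sum, mul_smul_comm,
    smul_mul_assoc, smul_smul]
  refine Finset.sum_congr rfl fun l _ => ?_
  by_cases hl : par b = par l
  · rw [h.xx, smul_smul, hl, mul_comm]
  · rw [metricInv_eq_zero hl]
    simp

theorem d_sharp (a b : Idx r n) : d a * sharp x b = sgn (par a * par b) • (sharp x b * d a)
    + metricInv r n b a • 1 := by
  simp only [sharp, Finset.mul_sum, Finset.sum_mul, Finset.smul_sum, mul_smul_comm,
    smul_mul_assoc, smul_smul]
  have h1 : metricInv r n b a • (1 : A)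
      = ∑ l, metricInv r n b l • (if a = l then (1 : A) else 0) := by
    simp
  rw [h1, ← Finset.sum_add_distrib]
  refine Finset.sum_congr rfl fun l _ => ?_
  by_cases hl : par b = par l
  · rw [h.dx, hl, smul_add, smul_smul, mul_comm]
  · rw [metricInv_eq_zero hl]
    simp

theorem euler_x (a : Idx r n) : euler x d * x a = x a * euler x d + x a := by
  have h1 : x a = ∑ j, x j * (if j = a then (1 : A) else 0) := by simp
  conv_rhs => rw [euler, Finset.mul_sum]; arg 2; rw [h1]
  rw [euler, Finset.sum_mul, ← Finset.sum_add_distrib]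
  refine Finset.sum_congr rfl fun j _ => ?_
  rw [mul_assoc, h.dx, mul_add, mul_smul_comm, ← mul_assoc, h.xx, smul_mul_assoc, smul_smul,
    sgn_sq, one_smul, mul_assoc]

theorem d_euler (a : Idx r n) : d a * euler x d = euler x d * d a + d a := by
  have h1 : d a = ∑ j, (if a = j then (1 : A) else 0) * d j := by simp
  conv_rhs => rw [euler, Finset.sum_mul]; arg 2; rw [h1]
  rw [euler, Finset.mul_sum, ← Finset.sum_add_distrib]
  refine Finset.sum_congr rfl fun j _ => ?_
  rw [← mul_assoc, h.dx, add_mul, smul_mul_assoc, mul_assoc (x j), h.dd, mul_smul_comm,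
    smul_smul, sgn_sq, one_smul, mul_assoc]

theorem euler_sharp (a : Idx r n) : euler x d * sharp x a = sharp x a * euler x d + sharp x a := by
  simp only [sharp, Finset.mul_sum, Finset.sum_mul, mul_smul_comm, smul_mul_assoc, h.euler_x,
    smul_add, Finset.sum_add_distrib]

theorem euler_rsq : euler x d * rsq x = rsq x * euler x d + 2 * rsq x := by
  rw [rsq, Finset.mul_sum, Finset.sum_mul, Finset.mul_sum, ← Finset.sum_add_distrib]
  refine Finset.sum_congr rfl fun j _ => ?_
  rw [← mul_assoc, h.euler_x, add_mul, mul_assoc (x j), h.euler_sharp]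
  noncomm_ring

theorem rsq_x (a : Idx r n) : rsq x * x a = x a * rsq x := by
  rw [rsq, Finset.sum_mul, Finset.mul_sum]
  refine Finset.sum_congr rfl fun j _ => ?_
  rw [← mul_assoc, h.xx a j, smul_mul_assoc, mul_assoc (x j) (x a), h.x_sharp a j, mul_smul_comm,
    smul_smul, sgn_sq, one_smul, mul_assoc]

theorem rsq_sharp (a : Idx r n) : rsq x * sharp x a = sharp x a * rsq x := by
  simp only [sharp, Finset.mul_sum, Finset.sum_mul, mul_smul_comm, smul_mul_assoc, h.rsq_x]

theorem d_rsq (a : Idx r n) : d a * rsq x = rsq x * d a + 2 * sharp x a := by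
  have h1 : ∀ j, d a * (x j * sharp x j) = x j * sharp x j * d a
      + ((sgn (par a * par j) * metricInv r n j a) • x j
      + (if a = j then (1 : A) else 0) * sharp x j) := by
    intro j
    rw [← mul_assoc, h.dx, add_mul, smul_mul_assoc, mul_assoc (x j), h.d_sharp, mul_add,
      mul_smul_comm, smul_add, smul_smul, sgn_sq, one_smul, mul_smul_comm, smul_smul, mul_one]
    noncomm_ring
  rw [rsq, Finset.mul_sum, Finset.sum_congr rfl fun j _ => h1 j, Finset.sum_add_distrib,
    Finset.sum_add_distrib, ← Finset.sum_mul, two_mul]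
  congr 2
  · refine Finset.sum_congr rfl fun j _ => ?_
    by_cases hj : par a = par j
    · rw [metricInv_swap a j, ← hj, sgn_mul_self, ← mul_assoc, sgn_sq, one_mul]
    · rw [metricInv_eq_zero hj, metricInv_eq_zero (Ne.symm hj)]
      simp
  · simp

theorem lap_d (a : Idx r n) : lap d * d a = d a * lap d := by
  simp only [lap, Finset.sum_mul, Finset.mul_sum, smul_mul_assoc, mul_smul_comm]
  refine Finset.sum_congr rfl fun b _ => Finset.sum_congr rfl fun c _ => ?_
  by_cases hbc : par b = par c
  · rw [mul_assoc, h.dd b a, mul_smul_comm, ← mul_assoc, h.dd c a, smul_mul_assoc, smul_smul,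
      smul_smul, hbc, mul_assoc, sgn_sq, mul_one, mul_assoc]
  · rw [metric_eq_zero hbc]
    simp

theorem lap_sharp (a : Idx r n) : lap d * sharp x a = sharp x a * lap d + 2 * d a := by
  have h1 : ∀ b c, metric r n b c • (d c * d b) * sharp x a
      = sharp x a * (metric r n b c • (d c * d b))
        + (metricInv r n a c * metric r n c b) • d b
        + (metricInv r n a b * metric r n b c) • d c := by
    intro b c
    by_cases hbc : par b = par c
    · have h2 : d c * d b * sharp x a = sharp x a * (d c * d b)
        + (sgn (par b * par a) * metricInv r n a c) • d b + metricInv r n a b • d c := by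
        rw [mul_assoc, h.d_sharp, mul_add, mul_smul_comm, ← mul_assoc, h.d_sharp, add_mul,
          smul_mul_assoc, smul_add, smul_smul, hbc, sgn_sq, one_smul, smul_mul_assoc, one_mul,
          smul_smul, mul_smul_comm, mul_one, mul_assoc]
      rw [smul_mul_assoc, h2, smul_add, smul_add, smul_smul, smul_smul, mul_smul_comm,
        mul_comm (metricInv r n a b)]
      congr 3
      by_cases hac : par a = par c
      · rw [metric_swap b c, hbc, hac, sgn_mul_self]
        ring
      · rw [metricInv_eq_zero hac]
        ring
    · rw [metric_eq_zero hbc, metric_eq_zero (Ne.symm hbc)]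
      simp
  simp only [lap, Finset.sum_mul, h1, Finset.sum_add_distrib]
  have h2 : ∑ b, ∑ c, (metricInv r n a c * metric r n c b) • d b = d a := by
    simp only [← Finset.sum_smul, metricInv_mul_metric_apply]
    simp
  have h3 : ∑ b, ∑ c, (metricInv r n a b * metric r n b c) • d c = d a := by
    rw [Finset.sum_comm]
    simp only [← Finset.sum_smul, metricInv_mul_metric_apply]
    simp
  rw [h2, h3, Finset.mul_sum]
  simp only [Finset.mul_sum]
  noncomm_ring

/-- Together with `euler_rsq` and `lap_euler` this is the 𝔰𝔩₂-relation of harmonic analysis, with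
the superdimension in place of the dimension. It is where the number r - 2n enters `casimir_K`. -/
theorem lap_rsq : lap d * rsq x = rsq x * lap d + 4 * euler x d
    + algebraMap ℂ A (2 * ((r : ℂ) - 2 * n)) := by
  have h1 : ∀ b c, metric r n b c • (d c * d b) * rsq x
      = rsq x * (metric r n b c • (d c * d b)) + 2 * (metric r n b c • (sharp x c * d b))
        + 2 * ((metric r n b c * sgn (par c)) • (sharp x b * d c))
        + 2 * (metric r n b c * metricInv r n b c) • 1 := by
    intro b c
    by_cases hbc : par b = par c
    · have h2 : d c * d b * rsq x = rsq x * (d c * d b) + 2 * (sharp x c * d b)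
          + 2 * (sgn (par c) • (sharp x b * d c)) + 2 * metricInv r n b c • 1 := by
        have h3 := h.d_sharp c b
        rw [hbc, sgn_mul_self] at h3
        rw [mul_assoc, h.d_rsq, mul_add, ← mul_assoc, h.d_rsq, ← hbc]
        rw [hbc]
        have : d c * (2 * sharp x b) = 2 * (d c * sharp x b) := by noncomm_ring
        rw [this, h3]
        noncomm_ring
      rw [smul_mul_assoc, h2]
      simp only [smul_add, mul_smul_comm, smul_smul]
    · rw [metric_eq_zero hbc]
      simp
  simp only [lap, Finset.sum_mul, h1, Finset.sum_add_distrib]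
  have h2 : ∑ b, ∑ c, 2 * (metric r n b c • (sharp x c * d b)) = 2 * euler x d := by
    simp only [← smul_mul_assoc, ← Finset.mul_sum, ← Finset.sum_mul, sum_metric_smul_sharp]
    rfl
  have h3 : ∑ b, ∑ c, 2 * ((metric r n b c * sgn (par c)) • (sharp x b * d c))
      = 2 * euler x d := by
    rw [Finset.sum_comm]
    simp only [← smul_mul_assoc, ← Finset.mul_sum, ← Finset.sum_mul, sum_metric_smul_sharp']
    rfl
  have h4 : ∑ b, ∑ c, 2 * (metric r n b c * metricInv r n b c) • (1 : A)
      = algebraMap ℂ A (2 * ((r : ℂ) - 2 * n)) := by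
    simp only [← Finset.sum_smul, ← Finset.mul_sum, sum_metric_mul_metricInv]
    rw [map_mul, Algebra.algebraMap_eq_smul_one ((r : ℂ) - 2 * n), map_ofNat]
  rw [h2, h3, h4, Finset.mul_sum]
  simp only [Finset.mul_sum]
  noncomm_ring

theorem lap_euler : lap d * euler x d = euler x d * lap d + 2 * lap d := by
  simp only [lap, Finset.sum_mul, Finset.mul_sum, smul_mul_assoc, mul_smul_comm,
    ← Finset.sum_add_distrib]
  refine Finset.sum_congr rfl fun b _ => Finset.sum_congr rfl fun c _ => ?_
  rw [← smul_add]
  congr 1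
  rw [mul_assoc, h.d_euler, mul_add, ← mul_assoc, h.d_euler]
  noncomm_ring

end IsWeyl

end

/-! ### Polynomials on the superspace `ℂ^{r|2n}` -/

/-- A model of the polynomials on `ℂ^{r|2n}`: multiplication operators `x`, derivatives `d`, the
constant polynomial `vac` and the rescalings `refl` of the coordinates. -/
structure Fock (r n : ℕ) (P : Type*) [AddCommGroup P] [Module ℂ P] where
  x : Idx r n → Module.End ℂ P
  d : Idx r n → Module.End ℂ P
  isWeyl : IsWeyl x d
  vac : P
  vac_ne : vac ≠ 0
  d_vac : ∀ i, d i vac = 0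
  refl : (Idx r n → ℂ) → Module.End ℂ P
  refl_vac : ∀ χ, refl χ vac = vac
  refl_x : ∀ χ i, refl χ * x i = χ i • (x i * refl χ)
  span : ∀ S : Submodule ℂ P, vac ∈ S → (∀ i, ∀ f ∈ S, x i f ∈ S) → S = ⊤

/-- The polynomials on `ℂ^{r|2n}`. -/
abbrev SuperPoly (r n : ℕ) : Type :=
  TensorProduct ℂ (MvPolynomial (Fin r) ℂ) (ExteriorAlgebra ℂ (Fin n × Fin 2 → ℂ))

namespace SuperPoly

open TensorProduct

variable (r n : ℕ)

/-- The multiplication operators. -/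
def x : Idx r n → Module.End ℂ (SuperPoly r n)
  | Sum.inl i => (LinearMap.mulLeft ℂ (MvPolynomial.X i)).rTensor _
  | Sum.inr o => (LinearMap.mulLeft ℂ (ExteriorAlgebra.ι ℂ (Pi.single o 1))).lTensor _

/-- The derivatives. -/
def d : Idx r n → Module.End ℂ (SuperPoly r n)
  | Sum.inl i => (MvPolynomial.pderiv i).toLinearMap.rTensor _
  | Sum.inr o => LinearMap.lTensor _ (CliffordAlgebra.contractLeft (LinearMap.proj o))

/-- The rescalings of the coordinates. -/
def refl (χ : Idx r n → ℂ) : Module.End ℂ (SuperPoly r n) :=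
  TensorProduct.map
    (MvPolynomial.aeval fun i => χ (Sum.inl i) • (MvPolynomial.X i : MvPolynomial (Fin r) ℂ)).toLinearMap
    (ExteriorAlgebra.map (LinearMap.pi fun o =>
      χ (Sum.inr o) • (LinearMap.proj o : (Fin n × Fin 2 → ℂ) →ₗ[ℂ] ℂ))).toLinearMap

theorem ext_tmul {f g : Module.End ℂ (SuperPoly r n)} (h : ∀ a b, f (a ⊗ₜ b) = g (a ⊗ₜ b)) :
    f = g := TensorProduct.ext' h

theorem isWeyl : IsWeyl (x r n) (d r n) := by
  refine ⟨fun i j => ext_tmul r n fun a b => ?_, fun i j => ext_tmul r n fun a b => ?_,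
    fun i j => ext_tmul r n fun a b => ?_⟩
  · rcases i with i | i <;> rcases j with j | j
    · simp [x, mul_left_comm]
    · simp [x]
    · simp [x]
    · have := ExteriorAlgebra.ι_add_mul_swap (R := ℂ) (Pi.single i 1 : Fin n × Fin 2 → ℂ)
        (Pi.single j 1)
      simp only [x, par_inr, mul_one, sgn_one, Module.End.mul_apply, LinearMap.lTensor_tmul,
        LinearMap.mulLeft_apply, LinearMap.smul_apply, neg_smul, one_smul, ← mul_assoc,
        eq_neg_of_add_eq_zero_left this]
      rw [neg_mul, TensorProduct.tmul_neg]
  · rcases i with i | i <;> rcases j with j | j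
    · have : (MvPolynomial.pderiv i) ((MvPolynomial.pderiv j) a)
          = (MvPolynomial.pderiv j) ((MvPolynomial.pderiv i) a) := by
        have h0 : ⁅(MvPolynomial.pderiv i : Derivation ℂ (MvPolynomial (Fin r) ℂ) _),
            (MvPolynomial.pderiv j : Derivation ℂ (MvPolynomial (Fin r) ℂ) _)⁆ = 0 := by
          refine MvPolynomial.derivation_ext fun k => ?_
          rw [Derivation.commutator_apply]
          simp [MvPolynomial.pderiv_X, Pi.single_apply, apply_ite]
        have h1 := DFunLike.congr_fun h0 a
        rw [Derivation.commutator_apply] at h1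
        exact sub_eq_zero.1 h1
      simp [d, this]
    · simp [d]
    · simp [d]
    · have := CliffordAlgebra.contractLeft_comm (Q := (0 : QuadraticForm ℂ (Fin n × Fin 2 → ℂ)))
        (d := LinearMap.proj i) (d' := LinearMap.proj j) b
      simp only [d, par_inr, mul_one, sgn_one, Module.End.mul_apply, LinearMap.lTensor_tmul,
        LinearMap.smul_apply, neg_smul, one_smul]
      rw [← TensorProduct.tmul_neg]
      exact congrArg _ this
  · rcases i with i | i <;> rcases j with j | j
    · by_cases hij : i = j
      · subst hij
        simp [d, x, TensorProduct.add_tmul]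
      · simp [d, x, hij, MvPolynomial.pderiv_X_of_ne (Ne.symm hij)]
    · simp [d, x]
    · simp [d, x]
    · have := CliffordAlgebra.contractLeft_ι_mul
        (Q := (0 : QuadraticForm ℂ (Fin n × Fin 2 → ℂ))) (d := LinearMap.proj i) (Pi.single j 1) b
      simp only [d, x, par_inr, mul_one, sgn_one, Module.End.mul_apply, LinearMap.lTensor_tmul,
        LinearMap.smul_apply, neg_smul, one_smul, LinearMap.mulLeft_apply,
        LinearMap.add_apply]
      refine (congrArg _ this).trans ?_
      rw [TensorProduct.tmul_sub, sub_eq_neg_add]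
      congr 1
      by_cases hij : i = j
      · subst hij
        simp
      · simp [hij]

theorem span_top (S : Submodule ℂ (SuperPoly r n)) (h1 : (1 : MvPolynomial (Fin r) ℂ) ⊗ₜ 1 ∈ S)
    (hx : ∀ i, ∀ f ∈ S, x r n i f ∈ S) : S = ⊤ := by
  have h2 : ∀ b : ExteriorAlgebra ℂ (Fin n × Fin 2 → ℂ),
      (1 : MvPolynomial (Fin r) ℂ) ⊗ₜ[ℂ] b ∈ S := by
    intro b
    induction b using CliffordAlgebra.left_induction with
    | algebraMap c =>
      rw [Algebra.algebraMap_eq_smul_one, TensorProduct.tmul_smul]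
      exact Submodule.smul_mem _ _ h1
    | add a b ha hb =>
      rw [TensorProduct.tmul_add]
      exact add_mem ha hb
    | ι_mul b v hb =>
      have hv : v = ∑ o, v o • (Pi.single o 1 : Fin n × Fin 2 → ℂ) := by
        ext o
        simp [Finset.sum_apply, Pi.single_apply]
      rw [hv, map_sum, Finset.sum_mul, TensorProduct.tmul_sum]
      refine sum_mem fun o _ => ?_
      rw [map_smul, smul_mul_assoc, TensorProduct.tmul_smul]
      exact Submodule.smul_mem _ _ (hx (Sum.inr o) _ hb)
  rw [eq_top_iff]
  intro f _
  induction f using TensorProduct.induction_on with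
  | zero => exact zero_mem _
  | add f g hf hg => exact add_mem (hf trivial) (hg trivial)
  | tmul a b =>
    induction a using MvPolynomial.induction_on with
    | C c =>
      rw [← MvPolynomial.algebraMap_eq, Algebra.algebraMap_eq_smul_one, ← TensorProduct.smul_tmul']
      exact Submodule.smul_mem _ _ (h2 b)
    | add p q hp hq =>
      rw [TensorProduct.add_tmul]
      exact add_mem (hp trivial) (hq trivial)
    | mul_X p i hp =>
      rw [mul_comm]
      exact hx (Sum.inl i) _ (hp trivial)

/-- The polynomials on `ℂ^{r|2n}` with their operators. -/
def fock : Fock r n (SuperPoly r n) where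
  x := x r n
  d := d r n
  isWeyl := isWeyl r n
  vac := 1 ⊗ₜ 1
  vac_ne := by
    intro h
    -- Evaluation at the origin, on both tensor factors, sends the constant polynomial to 1.
    have h1 := congrArg (TensorProduct.lift ((LinearMap.mul ℂ ℂ).compl₁₂
      (MvPolynomial.aeval (fun _ => (0 : ℂ))).toLinearMap
      (ExteriorAlgebra.algebraMapInv (R := ℂ) (M := Fin n × Fin 2 → ℂ)).toLinearMap)) h
    simp at h1
  d_vac i := by
    rcases i with i | i
    · simp [d]
    · simp only [d, LinearMap.lTensor_tmul]
      refine (congrArg _ (CliffordAlgebra.contractLeft_one _ _)).trans ?_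
      simp
  refl := refl r n
  refl_vac χ := by simp [refl]
  refl_x χ i := by
    refine ext_tmul r n fun a b => ?_
    rcases i with i | i
    · simp [refl, x, TensorProduct.smul_tmul']
    · have : (LinearMap.pi fun o => χ (Sum.inr o) •
          (LinearMap.proj o : (Fin n × Fin 2 → ℂ) →ₗ[ℂ] ℂ)) (Pi.single i 1)
          = χ (Sum.inr i) • Pi.single i 1 := by
        ext o
        by_cases h : o = i
        · subst h
          simp
        · simp [h]
      simp [refl, x, this]
  span S h1 h2 := span_top r n S h1 h2

end SuperPoly

/-! ### The Euler grading and the parity on polynomials -/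

namespace Fock

variable {r n : ℕ} {P : Type*} [AddCommGroup P] [Module ℂ P] (F : Fock r n P)

/-- An induction over monomials: the constant generates everything under the multiplication
operators. It lets operator identities be derived from commutation relations alone. -/
theorem end_ext {f g : Module.End ℂ P} (h1 : f F.vac = g F.vac)
    (h2 : ∀ i v, f v = g v → f (F.x i v) = g (F.x i v)) : f = g := by
  have h := F.span (LinearMap.eqLocus f g) h1 h2
  refine LinearMap.ext fun v => ?_
  have : v ∈ LinearMap.eqLocus f g := h ▸ Submodule.mem_top
  exact this

theorem d_x (i j : Idx r n) (v : P) : F.d i (F.x j v)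
    = sgn (par i * par j) • F.x j (F.d i v) + if i = j then v else 0 := by
  have := LinearMap.congr_fun (F.isWeyl.dx i j) v
  simp only [Module.End.mul_apply, LinearMap.add_apply, LinearMap.smul_apply] at this
  rw [this]
  split_ifs <;> simp

theorem refl_x_apply (χ : Idx r n → ℂ) (i : Idx r n) (v : P) :
    F.refl χ (F.x i v) = χ i • F.x i (F.refl χ v) := LinearMap.congr_fun (F.refl_x χ i) v

theorem d_refl (χ : Idx r n → ℂ) (i : Idx r n) :
    F.d i * F.refl χ = χ i • (F.refl χ * F.d i) := by
  refine F.end_ext ?_ fun j v h => ?_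
  · simp [F.refl_vac, F.d_vac]
  · simp only [Module.End.mul_apply, LinearMap.smul_apply] at h ⊢
    rw [refl_x_apply, map_smul, d_x, h, d_x, map_add, map_smul, map_smul, refl_x_apply]
    by_cases hij : i = j
    · subst hij
      simp only [if_true]
    · simp only [hij, if_false, map_zero]
      module

theorem refl_one_sq (χ : Idx r n → ℂ) (hχ : ∀ i, χ i * χ i = 1) :
    F.refl χ * F.refl χ = 1 := by
  refine F.end_ext ?_ fun j v h => ?_
  · simp [F.refl_vac]
  · simp only [Module.End.mul_apply, Module.End.one_apply] at h ⊢
    rw [refl_x_apply, map_smul, refl_x_apply, smul_smul, hχ, one_smul, h]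

/-- The Euler operator. -/
def E : Module.End ℂ P := euler F.x F.d

theorem E_vac : F.E F.vac = 0 := by
  simp [E, euler, F.d_vac]

theorem E_x (i : Idx r n) (v : P) : F.E (F.x i v) = F.x i (F.E v) + F.x i v :=
  LinearMap.congr_fun (F.isWeyl.euler_x i) v

theorem d_E (i : Idx r n) (v : P) : F.d i (F.E v) = F.E (F.d i v) + F.d i v :=
  LinearMap.congr_fun (F.isWeyl.d_euler i) v

/-- The homogeneous polynomials of degree `e`. -/
def homog (e : ℂ) : Submodule ℂ P := F.E.eigenspace e

theorem mem_homog {e : ℂ} {v : P} : v ∈ F.homog e ↔ F.E v = e • v :=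
  Module.End.mem_eigenspace_iff

theorem vac_mem_homog : F.vac ∈ F.homog 0 := by
  rw [mem_homog, E_vac, zero_smul]

theorem x_mem_homog (i : Idx r n) {e : ℂ} {v : P} (hv : v ∈ F.homog e) :
    F.x i v ∈ F.homog (e + 1) := by
  rw [mem_homog] at hv ⊢
  rw [E_x, hv, map_smul]
  module

theorem d_mem_homog (i : Idx r n) {e : ℂ} {v : P} (hv : v ∈ F.homog e) :
    F.d i v ∈ F.homog (e - 1) := by
  rw [mem_homog] at hv ⊢
  have := F.d_E i v
  rw [hv, map_smul] at this
  rw [sub_smul, this]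
  module

theorem iSup_homog : ⨆ e : ℕ, F.homog e = ⊤ := by
  refine F.span _ (Submodule.mem_iSup_of_mem 0 (by simpa using F.vac_mem_homog)) ?_
  intro i f hf
  induction hf using Submodule.iSup_induction' with
  | mem e v hv =>
    refine Submodule.mem_iSup_of_mem (e + 1) ?_
    push_cast
    exact F.x_mem_homog i hv
  | zero => simp
  | add v w _ _ hv hw =>
    rw [map_add]
    exact add_mem hv hw

theorem disjoint_homog {e : ℂ} {p : ℕ → Prop} (hp : ∀ e' : ℕ, p e' → (e' : ℂ) ≠ e) :
    Disjoint (F.homog e) (⨆ (e' : ℕ) (_ : p e'), F.homog e') := by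
  refine (F.E.eigenspaces_iSupIndep e).mono_right ?_
  exact iSup₂_le fun e' he' => le_iSup₂_of_le (e' : ℂ) (hp e' he') le_rfl

/-- Eigenspaces of the Euler operator are independent, and those with natural eigenvalues already
fill the space. -/
theorem homog_eq_bot {e : ℂ} (he : ∀ e' : ℕ, (e' : ℂ) ≠ e) : F.homog e = ⊥ := by
  have h := F.disjoint_homog (p := fun _ => True) fun e' _ => he e'
  simp only [iSup_true, F.iSup_homog] at h
  exact disjoint_top.1 h

theorem mem_homog_zero {v : P} (hv : v ∈ F.homog 0) : ∃ c : ℂ, v = c • F.vac := by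
  have h1 : Submodule.span ℂ {F.vac} ⊔ (⨆ (e : ℕ) (_ : e ≠ 0), F.homog e) = ⊤ := by
    refine F.span _ (Submodule.mem_sup_left (Submodule.mem_span_singleton_self _)) ?_
    intro i f hf
    refine Submodule.mem_sup_right ?_
    have h2 : Submodule.span ℂ {F.vac} ⊔ (⨆ (e : ℕ) (_ : e ≠ 0), F.homog e)
        ≤ (⨆ (e : ℕ) (_ : e ≠ 0), F.homog e).comap (F.x i) := by
      refine sup_le ?_ (iSup₂_le fun e he => ?_)
      · rw [Submodule.span_singleton_le_iff_mem]
        refine Submodule.mem_iSup_of_mem 1 (Submodule.mem_iSup_of_mem one_ne_zero ?_)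
        simpa using F.x_mem_homog i F.vac_mem_homog
      · intro v hv
        refine Submodule.mem_iSup_of_mem (e + 1) (Submodule.mem_iSup_of_mem (by omega) ?_)
        push_cast
        exact F.x_mem_homog i hv
    exact h2 hf
  have h3 : v ∈ Submodule.span ℂ {F.vac} ⊔ (⨆ (e : ℕ) (_ : e ≠ 0), F.homog e) :=
    h1 ▸ Submodule.mem_top
  obtain ⟨a, ha, b, hb, rfl⟩ := Submodule.mem_sup.1 h3
  obtain ⟨c, rfl⟩ := Submodule.mem_span_singleton.1 ha
  have h4 : b ∈ F.homog 0 :=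
    (Submodule.add_mem_iff_right _ (Submodule.smul_mem _ c F.vac_mem_homog)).1 hv
  have h5 : b = 0 := Submodule.disjoint_def.1
    (F.disjoint_homog (e := 0) (p := fun e => e ≠ 0) fun e he => Nat.cast_ne_zero.2 he) b h4 hb
  exact ⟨c, by rw [h5, add_zero]⟩

/-- A nonzero subspace that is stable under the Euler operator and some of the derivatives contains
a nonzero homogeneous polynomial which is annihilated by these derivatives. -/
theorem exists_homog_of_stable {U : Submodule ℂ P} (hU : U ≠ ⊥) (hE : ∀ v ∈ U, F.E v ∈ U)
    {I : Set (Idx r n)} (hd : ∀ i ∈ I, ∀ v ∈ U, F.d i v ∈ U) :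
    ∃ (e : ℕ) (v : P), v ∈ U ∧ v ≠ 0 ∧ v ∈ F.homog e ∧ ∀ i ∈ I, F.d i v = 0 := by
  -- E - a kills the component of degree `a` and rescales the others by nonzero factors, so
  -- induction on the number of components extracts each of them from `U`.
  have key : ∀ (s : Finset ℕ) (f : ℕ → P), (∀ e ∈ s, f e ∈ F.homog e) → ∑ e ∈ s, f e ∈ U →
      ∀ e ∈ s, f e ∈ U := by
    intro s
    induction s using Finset.induction_on with
    | empty => simp
    | insert a s ha ih =>
      intro f hf hs
      have h1 : ∑ e ∈ s, ((e : ℂ) - a) • f e ∈ U := by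
        have h2 : ∑ e ∈ s, ((e : ℂ) - a) • f e
            = F.E (∑ e ∈ insert a s, f e) - (a : ℂ) • ∑ e ∈ insert a s, f e := by
          rw [map_sum, Finset.smul_sum, ← Finset.sum_sub_distrib, Finset.sum_insert ha,
            F.mem_homog.1 (hf a (Finset.mem_insert_self a s)), sub_self, zero_add]
          refine Finset.sum_congr rfl fun e he => ?_
          rw [F.mem_homog.1 (hf e (Finset.mem_insert_of_mem he)), sub_smul]
        rw [h2]
        exact sub_mem (hE _ hs) (Submodule.smul_mem _ _ hs)
      have h3 : ∀ e ∈ s, f e ∈ U := by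
        intro e he
        have h4 := ih (fun e => ((e : ℂ) - a) • f e)
          (fun e he => Submodule.smul_mem _ _ (hf e (Finset.mem_insert_of_mem he))) h1 e he
        refine (Submodule.smul_mem_iff _ ?_).1 h4
        rw [sub_ne_zero, Ne, Nat.cast_inj]
        rintro rfl
        exact ha he
      intro e he
      rcases Finset.mem_insert.1 he with rfl | he
      · rw [Finset.sum_insert ha] at hs
        exact (Submodule.add_mem_iff_left _ (sum_mem h3)).1 hs
      · exact h3 e he
  have h1 : ∃ e : ℕ, ∃ v ∈ U, v ≠ 0 ∧ v ∈ F.homog e := by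
    obtain ⟨v, hv, hv0⟩ := Submodule.exists_mem_ne_zero_of_ne_bot hU
    have h2 : v ∈ ⨆ e : ℕ, F.homog e := F.iSup_homog ▸ Submodule.mem_top
    obtain ⟨f, hf, rfl⟩ := (Submodule.mem_iSup_iff_exists_finsupp _ _).1 h2
    have h3 : ∃ e ∈ f.support, f e ≠ 0 := by
      by_contra! h
      exact hv0 (Finset.sum_eq_zero h)
    obtain ⟨e, he, he0⟩ := h3
    exact ⟨e, f e, key f.support f (fun e _ => hf e) hv e he, he0, hf e⟩
  classical
  -- The degree is chosen least possible in `U`; a nonzero derivative would have a smaller one.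
  obtain ⟨v, hv, hv0, hve⟩ := Nat.find_spec h1
  refine ⟨Nat.find h1, v, hv, hv0, hve, fun i hi => ?_⟩
  by_contra h
  rcases Nat.eq_zero_or_pos (Nat.find h1) with h2 | h2
  · have h3 := F.d_mem_homog i hve
    rw [F.homog_eq_bot fun e' he' => ?_] at h3
    · exact h ((Submodule.mem_bot ℂ).1 h3)
    · rw [h2] at he'
      have : ((e' + 1 : ℕ) : ℂ) = 0 := by push_cast; rw [he']; simp
      exact absurd (Nat.cast_eq_zero.1 this) (by omega)
  · refine Nat.find_min h1 (m := Nat.find h1 - 1) (by omega) ⟨F.d i v, hd i hi v hv, h, ?_⟩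
    rw [Nat.cast_sub h2, Nat.cast_one]
    exact F.d_mem_homog i hve

/-! ### The parity -/

/-- The parity operator. -/
def parity : Module.End ℂ P := F.refl fun i => sgn (par i)

theorem parity_sq (v : P) : F.parity (F.parity v) = v :=
  LinearMap.congr_fun (F.refl_one_sq (fun i => sgn (par i)) fun _ => sgn_sq _) v

theorem parity_x (i : Idx r n) : F.parity * F.x i = sgn (par i) • (F.x i * F.parity) :=
  F.refl_x _ i

theorem parity_d (i : Idx r n) : F.parity * F.d i = sgn (par i) • (F.d i * F.parity) := by
  rw [parity, F.d_refl, smul_smul, sgn_sq, one_smul]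

/-- The polynomials of parity `p`. -/
def deg (p : ZMod 2) : Submodule ℂ P := F.parity.eigenspace (sgn p)

theorem mem_deg {p : ZMod 2} {v : P} : v ∈ F.deg p ↔ F.parity v = sgn p • v :=
  Module.End.mem_eigenspace_iff

theorem vac_mem_deg : F.vac ∈ F.deg 0 := by
  rw [mem_deg, parity, F.refl_vac, sgn_zero, one_smul]

theorem isCompl_deg : IsCompl (F.deg 0) (F.deg 1) := by
  constructor
  · rw [Submodule.disjoint_def]
    intro v h0 h1
    rw [mem_deg] at h0 h1
    rw [h0, sgn_zero, sgn_one, one_smul, neg_one_smul] at h1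
    have h2 : (2 : ℂ) • v = 0 := by
      rw [two_smul]
      nth_rewrite 1 [h1]
      exact neg_add_cancel v
    exact (smul_eq_zero.1 h2).resolve_left two_ne_zero
  · rw [codisjoint_iff, eq_top_iff]
    intro v _
    refine Submodule.mem_sup.2 ⟨(1 / 2 : ℂ) • (v + F.parity v), ?_, (1 / 2 : ℂ) •
      (v - F.parity v), ?_, by module⟩
    · rw [mem_deg, map_smul, map_add, parity_sq, sgn_zero]
      module
    · rw [mem_deg, map_smul, map_sub, parity_sq, sgn_one]
      module

theorem mem_deg_of_parity {A : Module.End ℂ P} {p q : ZMod 2}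
    (hA : F.parity * A = sgn p • (A * F.parity)) {v : P} (hv : v ∈ F.deg q) :
    A v ∈ F.deg (p + q) := by
  rw [mem_deg] at hv ⊢
  have := LinearMap.congr_fun hA v
  simp only [Module.End.mul_apply, LinearMap.smul_apply] at this
  rw [this, hv, map_smul, sgn_add, mul_smul]

end Fock

/-! ### The conformal representation -/

/-- The operator `∑ X_{ij} x_i ∂_j`. -/
def quadOp {m n : ℕ} {A : Type*} [Ring A] [Algebra ℂ A] (x d : Idx m n → A)
    (X : Matrix (Idx m n) (Idx m n) ℂ) : A := ∑ i, ∑ j, X i j • (x i * d j)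

/-- The sum contracts the super-antisymmetric matrix X g⁻¹ with the supersymmetric products x_i x_l.
-/
theorem sum_smul_mul_sharp {m n : ℕ} {A : Type*} [Ring A] [Algebra ℂ A] {x : Idx m n → A}
    (hx : ∀ i j, x i * x j = sgn (par i * par j) • (x j * x i)) {p : ZMod 2}
    {X : Matrix (Idx m n) (Idx m n) ℂ} (hX : X ∈ osp m n p) :
    ∑ i, ∑ j, X i j • (x i * sharp x j) = 0 := by
  have h1 : ∑ i, ∑ j, X i j • (x i * sharp x j)
      = ∑ i, ∑ l, (X * metricInv m n) i l • (x i * x l) := by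
    refine Finset.sum_congr rfl fun i _ => ?_
    simp only [sharp, Finset.mul_sum, Finset.smul_sum, Matrix.mul_apply, Finset.sum_smul,
      mul_smul_comm, smul_smul]
    exact Finset.sum_comm
  have h2 : ∑ i, ∑ l, (X * metricInv m n) i l • (x i * x l)
      = -∑ i, ∑ l, (X * metricInv m n) i l • (x i * x l) := by
    conv_lhs => rw [Finset.sum_comm]
    rw [← Finset.sum_neg_distrib]
    refine Finset.sum_congr rfl fun i _ => ?_
    rw [← Finset.sum_neg_distrib]
    refine Finset.sum_congr rfl fun l _ => ?_
    rw [mul_metricInv_swap hX i l, hx i l, smul_smul, ← neg_smul]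
    congr 1
    ring
  have h3 : (2 : ℂ) • ∑ i, ∑ l, (X * metricInv m n) i l • (x i * x l) = 0 := by
    rw [two_smul]
    nth_rewrite 1 [h2]
    exact neg_add_cancel _
  rw [h1]
  calc _ = (1 / 2 : ℂ) • (2 : ℂ) • ∑ i, ∑ l, (X * metricInv m n) i l • (x i * x l) := by
        rw [smul_smul]
        norm_num
    _ = 0 := by rw [h3, smul_zero]

/-- Operators with the deformed Weyl relations of the functions on a cone define a representation
of `osp(m|2n)`. -/
theorem quadOp_sbracket {m n : ℕ} {A : Type*} [Ring A] [Algebra ℂ A] {x d d' : Idx m n → A}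
    {c : Idx m n → ℂ} (hx : ∀ i j, x i * x j = sgn (par i * par j) • (x j * x i))
    (hd : ∀ i j, d' i * d j = sgn (par i * par j) • (d' j * d i))
    (hdx : ∀ i j, d i * x j = sgn (par i * par j) • (x j * d' i) + (if i = j then 1 else 0)
      - c j • sharp x i)
    {p q : ZMod 2} {X Y : Matrix (Idx m n) (Idx m n) ℂ} (hX : X ∈ osp m n p)
    (hY : Y ∈ osp m n q) :
    quadOp x d (sbracket p q X Y)
      = quadOp x d X * quadOp x d Y - sgn (p * q) • (quadOp x d Y * quadOp x d X) := by
  -- The second-order part of the product. It is supersymmetric in `X` and `Y`, so it cancels in the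
  -- bracket, leaving the first-order part of the matrix products.
  let B (X Y : Matrix (Idx m n) (Idx m n) ℂ) : A := ∑ i, ∑ j, ∑ k, ∑ l,
    (X i j * Y k l * sgn (par j * par k)) • (x i * x k * (d' j * d l))
  have key : ∀ {p q : ZMod 2} {X Y : Matrix (Idx m n) (Idx m n) ℂ}, X ∈ osp m n p →
      Y ∈ osp m n q → quadOp x d X * quadOp x d Y = B X Y + quadOp x d (X * Y) := by
    intro p q X Y hX hY
    have h1 : ∀ i j, x i * d j * quadOp x d Y
        = ∑ k, ∑ l, (Y k l * sgn (par j * par k)) • (x i * x k * (d' j * d l))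
          + ∑ l, Y j l • (x i * d l)
          - x i * sharp x j * ∑ k, ∑ l, (Y k l * c k) • d l := by
      intro i j
      have h2 : ∀ k l, x i * d j * (x k * d l)
          = sgn (par j * par k) • (x i * x k * (d' j * d l))
            + (if j = k then x i * d l else 0) - c k • (x i * sharp x j * d l) := by
        intro k l
        rw [mul_assoc (x i), ← mul_assoc (d j), hdx]
        split_ifs <;>
          simp only [sub_mul, add_mul, mul_sub, mul_add, smul_mul_assoc, mul_smul_comm, mul_assoc,
            one_mul, zero_mul, mul_zero]
      have h3 : ∑ l, Y j l • (x i * d l)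
          = ∑ k, ∑ l, Y k l • (if j = k then x i * d l else 0) := by
        symm
        rw [Finset.sum_eq_single j]
        · simp only [if_true]
        · intro b _ hb
          simp only [if_neg hb.symm, smul_zero, Finset.sum_const_zero]
        · simp
      rw [h3]
      simp only [quadOp, Finset.mul_sum, ← Finset.sum_add_distrib, ← Finset.sum_sub_distrib]
      refine Finset.sum_congr rfl fun k _ => Finset.sum_congr rfl fun l _ => ?_
      rw [mul_smul_comm, h2, smul_sub, smul_add, smul_smul, smul_smul, mul_smul_comm]
    have h4 : quadOp x d X * quadOp x d Y
        = ∑ i, ∑ j, X i j • (x i * d j * quadOp x d Y) := by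
      conv_lhs => rw [quadOp, Finset.sum_mul]
      refine Finset.sum_congr rfl fun i _ => ?_
      rw [Finset.sum_mul]
      refine Finset.sum_congr rfl fun j _ => ?_
      rw [smul_mul_assoc]
    rw [h4]
    simp only [h1, smul_sub, smul_add, Finset.sum_sub_distrib, Finset.sum_add_distrib]
    -- The deformation terms with `c` are multiples of Σ X_ij x_i x^j, which is zero.
    have h5 : ∑ i, ∑ j, X i j • (x i * sharp x j * ∑ k, ∑ l, (Y k l * c k) • d l) = 0 := by
      have h6 : ∀ (i j : Idx m n) (S : A), X i j • (x i * sharp x j * S)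
          = X i j • (x i * sharp x j) * S := fun i j S => (smul_mul_assoc _ _ _).symm
      simp only [h6, ← Finset.sum_mul]
      rw [sum_smul_mul_sharp hx hX, zero_mul]
    rw [h5, sub_zero]
    congr 1
    · simp only [B, Finset.smul_sum, smul_smul, mul_assoc]
    · simp only [quadOp, Matrix.mul_apply, Finset.sum_smul, Finset.smul_sum, smul_smul]
      refine Finset.sum_congr rfl fun i _ => ?_
      exact Finset.sum_comm
  have hB : B X Y = sgn (p * q) • B Y X := by
    simp only [B, Finset.smul_sum]
    have e : ∀ (f : Idx m n → Idx m n → Idx m n → Idx m n → A),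
        ∑ k, ∑ l, ∑ i, ∑ j, f i j k l = ∑ i, ∑ j, ∑ k, ∑ l, f i j k l := by
      intro f
      calc ∑ k, ∑ l, ∑ i, ∑ j, f i j k l = ∑ k, ∑ i, ∑ l, ∑ j, f i j k l :=
            Finset.sum_congr rfl fun k _ => Finset.sum_comm
        _ = ∑ i, ∑ k, ∑ l, ∑ j, f i j k l := Finset.sum_comm
        _ = ∑ i, ∑ k, ∑ j, ∑ l, f i j k l :=
            Finset.sum_congr rfl fun i _ => Finset.sum_congr rfl fun k _ => Finset.sum_comm
        _ = _ := Finset.sum_congr rfl fun i _ => Finset.sum_comm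
    conv_rhs => rw [e fun i j k l =>
      sgn (p * q) • (Y k l * X i j * sgn (par l * par i)) • (x k * x i * (d' l * d j))]
    refine Finset.sum_congr rfl fun i _ => Finset.sum_congr rfl fun j _ =>
      Finset.sum_congr rfl fun k _ => Finset.sum_congr rfl fun l _ => ?_
    by_cases h1 : par i + par j = p
    · by_cases h2 : par k + par l = q
      · rw [hx k i, hd l j, smul_mul_smul_comm, smul_smul, smul_smul]
        congr 1
        rw [← h1, ← h2]
        rcases zmod_two_cases (par i) with h3 | h3 <;> rcases zmod_two_cases (par j) with h4 | h4 <;>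
          rcases zmod_two_cases (par k) with h5 | h5 <;>
          rcases zmod_two_cases (par l) with h6 | h6 <;>
          simp [h3, h4, h5, h6, show (1 + 1 : ZMod 2) = 0 by decide, mul_comm]
      · rw [hY.1 k l h2]
        simp
    · rw [hX.1 i j h1]
      simp
  have hlin : quadOp x d (sbracket p q X Y)
      = quadOp x d (X * Y) - sgn (p * q) • quadOp x d (Y * X) := by
    simp only [quadOp, sbracket, Matrix.sub_apply, Matrix.smul_apply, sub_smul, smul_eq_mul,
      mul_smul, Finset.sum_sub_distrib, Finset.smul_sum]
  rw [hlin, key hX hY, key hY hX, hB, smul_add]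
  abel

/-- The inclusion of the coordinates of `ℂ^{r|2n}` in those of `ℂ^{r+2|2n}`, as all but the first
two. -/
def emb {r n : ℕ} : Idx r n → Idx (r + 2) n := Sum.map (fun j => j.succ.succ) id

theorem idx_cases {r n : ℕ} (i : Idx (r + 2) n) :
    i = Sum.inl 0 ∨ i = Sum.inl 1 ∨ ∃ a : Idx r n, i = emb a := by
  rcases i with i | i
  · induction i using Fin.cases with
    | zero => exact Or.inl rfl
    | succ i =>
      induction i using Fin.cases with
      | zero => exact Or.inr (Or.inl rfl)
      | succ i => exact Or.inr (Or.inr ⟨Sum.inl i, rfl⟩)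
  · exact Or.inr (Or.inr ⟨Sum.inr i, rfl⟩)

theorem sum_idx {r n : ℕ} {A : Type*} [AddCommMonoid A] (f : Idx (r + 2) n → A) :
    ∑ i, f i = f (Sum.inl 0) + f (Sum.inl 1) + ∑ a, f (emb a) := by
  rw [Fintype.sum_sum_type, Fin.sum_univ_succ, Fin.sum_univ_succ, Fintype.sum_sum_type]
  simp only [add_assoc]
  rfl

@[simp]
theorem par_emb {r n : ℕ} (a : Idx r n) : par (emb a) = par a := by
  rcases a with a | a <;> rfl

@[simp]
theorem emb_inj {r n : ℕ} {a b : Idx r n} : emb a = emb b ↔ a = b := by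
  rcases a with a | a <;> rcases b with b | b <;> simp [emb]

@[simp]
theorem inl_zero_ne_emb {r n : ℕ} (a : Idx r n) : (Sum.inl 0 : Idx (r + 2) n) ≠ emb a := by
  rcases a with a | a
  · simpa [emb] using (Fin.succ_ne_zero _).symm
  · simp [emb]

@[simp]
theorem inl_one_ne_emb {r n : ℕ} (a : Idx r n) : (Sum.inl 1 : Idx (r + 2) n) ≠ emb a := by
  rcases a with a | a
  · simp only [emb, Sum.map_inl, ne_eq, Sum.inl.injEq]
    rw [← Fin.succ_zero_eq_one, Fin.succ_inj]
    exact (Fin.succ_ne_zero _).symm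
  · simp [emb]

theorem metricInv_emb {r n : ℕ} (a b : Idx r n) :
    metricInv (r + 2) n (emb a) (emb b) = metricInv r n a b := by
  rcases a with a | a <;> rcases b with b | b <;>
    simp [metricInv, emb, Matrix.one_apply]

theorem metricInv_inl_left {m n : ℕ} (i : Fin m) (j : Idx m n) :
    metricInv m n (Sum.inl i) j = if Sum.inl i = j then 1 else 0 := by
  rcases j with j | j <;> simp [metricInv, Matrix.one_apply]

theorem metricInv_inl_right {m n : ℕ} (i : Fin m) (j : Idx m n) :
    metricInv m n j (Sum.inl i) = if j = Sum.inl i then 1 else 0 := by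
  rcases j with j | j <;> simp [metricInv, Matrix.one_apply]

theorem sharp_inl {m n : ℕ} {A : Type*} [Ring A] [Algebra ℂ A] (x : Idx m n → A) (i : Fin m) :
    sharp x (Sum.inl i) = x (Sum.inl i) := by
  simp [sharp, metricInv_inl_left]

theorem sharp_emb {r n : ℕ} {A : Type*} [Ring A] [Algebra ℂ A] (x : Idx (r + 2) n → A)
    (a : Idx r n) : sharp x (emb a) = sharp (fun b => x (emb b)) a := by
  rw [sharp, sum_idx, metricInv_inl_right, metricInv_inl_right, if_neg (inl_zero_ne_emb a).symm,
    if_neg (inl_one_ne_emb a).symm]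
  simp [sharp, metricInv_emb]

/-! ### Functions on the isotropic cone and the conformal action -/

namespace Fock

variable {r n : ℕ} {P : Type*} [AddCommGroup P] [Module ℂ P] (F : Fock r n P)

/-- The square of the radius. -/
def R2 : Module.End ℂ P := rsq F.x

/-- The coordinates on the cone in `ℂ^{r+2|2n}`. -/
def coneX : Idx (r + 2) n → Module.End ℂ P :=
  Sum.elim (Fin.cons ((1 / 2 : ℂ) • (1 - F.R2)) (Fin.cons ((Complex.I / 2) • (1 + F.R2))
    fun i => F.x (Sum.inl i))) fun o => F.x (Sum.inr o)

/-- The derivatives on functions of degree `κ` on the cone in `ℂ^{r+2|2n}`. -/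
def coneD (κ : ℂ) : Idx (r + 2) n → Module.End ℂ P :=
  Sum.elim (Fin.cons (κ • 1 - F.E) (Fin.cons ((-Complex.I) • (κ • 1 - F.E))
    fun i => F.d (Sum.inl i))) fun o => F.d (Sum.inr o)

/-- The structure constants of the relations between `coneD` and `coneX`. -/
def coneC : Idx (r + 2) n → ℂ :=
  Sum.elim (Fin.cons 1 (Fin.cons (-Complex.I) fun _ => 0)) fun _ => 0

theorem coneX_zero : F.coneX (Sum.inl 0) = (1 / 2 : ℂ) • (1 - F.R2) := rfl

theorem coneX_one : F.coneX (Sum.inl 1) = (Complex.I / 2) • (1 + F.R2) := rfl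

theorem coneX_emb (a : Idx r n) : F.coneX (emb a) = F.x a := by
  rcases a with a | a <;> rfl

theorem coneD_zero (κ : ℂ) : F.coneD κ (Sum.inl 0) = κ • 1 - F.E := rfl

theorem coneD_one (κ : ℂ) : F.coneD κ (Sum.inl 1) = (-Complex.I) • (κ • 1 - F.E) := rfl

theorem coneD_emb (κ : ℂ) (a : Idx r n) : F.coneD κ (emb a) = F.d a := by
  rcases a with a | a <;> rfl

theorem coneC_zero : coneC (Sum.inl 0 : Idx (r + 2) n) = 1 := rfl

theorem coneC_one : coneC (Sum.inl 1 : Idx (r + 2) n) = -Complex.I := rfl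

theorem coneC_emb (a : Idx r n) : coneC (emb a) = 0 := by
  rcases a with a | a <;> rfl

theorem R2_x (a : Idx r n) : F.R2 * F.x a = F.x a * F.R2 := F.isWeyl.rsq_x a

theorem d_R2 (a : Idx r n) : F.d a * F.R2 = F.R2 * F.d a + (2 : ℂ) • sharp F.x a := by
  rw [R2, F.isWeyl.d_rsq, two_smul, two_mul]

theorem E_R2 : F.E * F.R2 = F.R2 * F.E + (2 : ℂ) • F.R2 := by
  rw [R2, E, F.isWeyl.euler_rsq, two_smul, two_mul]

theorem coneX_coneX (i j : Idx (r + 2) n) :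
    F.coneX i * F.coneX j = sgn (par i * par j) • (F.coneX j * F.coneX i) := by
  rcases idx_cases i with rfl | rfl | ⟨a, rfl⟩ <;> rcases idx_cases j with rfl | rfl | ⟨b, rfl⟩ <;>
    simp only [coneX_zero, coneX_one, coneX_emb, par_inl, par_emb, mul_zero, zero_mul, sgn_zero,
      smul_mul_assoc, mul_smul_comm, mul_sub, sub_mul, mul_add, add_mul, mul_one, one_mul,
      R2_x]
  all_goals try module
  exact F.isWeyl.xx a b

/-- The operators differentiate the extension s^κ f(x/s) with s = X₀ - iX₁ and restrict to s = 1.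
Differentiation lowers the degree by one, so the second derivative is taken at κ - 1; the relation
is the commutation of partial derivatives. -/
theorem coneD_coneD (κ : ℂ) (i j : Idx (r + 2) n) :
    F.coneD (κ - 1) i * F.coneD κ j
      = sgn (par i * par j) • (F.coneD (κ - 1) j * F.coneD κ i) := by
  have h1 : ∀ a, F.d a * F.E = F.E * F.d a + F.d a := F.isWeyl.d_euler
  rcases idx_cases i with rfl | rfl | ⟨a, rfl⟩ <;> rcases idx_cases j with rfl | rfl | ⟨b, rfl⟩ <;>
    simp only [coneD_zero, coneD_one, coneD_emb, par_inl, par_emb, mul_zero, zero_mul, sgn_zero,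
      smul_mul_assoc, mul_smul_comm, mul_sub, sub_mul, mul_one, one_mul, h1]
  all_goals try module
  exact F.isWeyl.dd a b

/-- With s = X₀ - iX₁ and Q the quadratic form, the extension of X₀ from the cone used by `coneD` is
X₀ - Q/(2s), and that of X₁ is X₁ + iQ/(2s). Since ∂_i Q = 2X^i, differentiating these corrections
produces the terms with `coneC`, with values 1 and -i. -/
theorem coneD_coneX (κ : ℂ) (i j : Idx (r + 2) n) :
    F.coneD κ i * F.coneX j = sgn (par i * par j) • (F.coneX j * F.coneD (κ - 1) i)
      + (if i = j then 1 else 0) - coneC j • sharp F.coneX i := by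
  have h1 : ∀ a, F.E * F.x a = F.x a * F.E + F.x a := F.isWeyl.euler_x
  have h2 : sharp (fun b => F.coneX (emb b)) = sharp F.x := by
    congr 1
    ext1 b
    exact F.coneX_emb b
  have h3 : (Sum.inl 0 : Idx (r + 2) n) ≠ Sum.inl 1 := by simp
  have hI := Complex.I_mul_I
  rcases idx_cases i with rfl | rfl | ⟨a, rfl⟩ <;> rcases idx_cases j with rfl | rfl | ⟨b, rfl⟩
  · simp only [coneX_zero, coneD_zero, coneC_zero, sharp_inl, par_inl, mul_zero, sgn_zero,
      smul_mul_assoc, mul_smul_comm, mul_sub, sub_mul, mul_one, one_mul, E_R2, if_true]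
    module
  · rw [if_neg h3]
    simp only [coneX_zero, coneX_one, coneD_zero, coneC_one, sharp_inl, par_inl, mul_zero,
      sgn_zero, smul_mul_assoc, mul_smul_comm, mul_sub, sub_mul, mul_add, add_mul, mul_one,
      one_mul, E_R2]
    module
  · rw [if_neg (inl_zero_ne_emb b)]
    simp only [coneX_emb, coneD_zero, coneC_emb, par_inl, zero_mul, sgn_zero,
      smul_mul_assoc, mul_smul_comm, mul_sub, sub_mul, mul_one, one_mul, h1]
    module
  · rw [if_neg h3.symm]
    simp only [coneX_zero, coneX_one, coneD_one, coneC_zero, sharp_inl, par_inl, mul_zero,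
      sgn_zero, smul_mul_assoc, mul_smul_comm, mul_sub, sub_mul, mul_one,
      one_mul, E_R2]
    module
  · have e1 : -Complex.I * (Complex.I / 2) = 1 / 2 := by linear_combination (-1 / 2) * hI
    have e2 : Complex.I / 2 * -Complex.I = 1 / 2 := by linear_combination (-1 / 2) * hI
    rw [sharp_inl, coneX_one, coneD_one, coneD_one, coneC_one, smul_mul_smul_comm,
      smul_mul_smul_comm, smul_smul (-Complex.I), e1, e2]
    simp only [par_inl, mul_zero, sgn_zero, smul_mul_assoc, mul_smul_comm, mul_sub, sub_mul,
      mul_add, add_mul, mul_one, one_mul, E_R2, if_true]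
    module
  · rw [if_neg (inl_one_ne_emb b)]
    simp only [coneX_emb, coneD_one, coneC_emb, par_inl, zero_mul, sgn_zero,
      smul_mul_assoc, mul_smul_comm, mul_sub, sub_mul, mul_one, one_mul, h1]
    module
  · rw [if_neg (inl_zero_ne_emb a).symm]
    simp only [coneX_zero, coneD_emb, coneC_zero, sharp_emb, h2, par_inl, mul_zero, sgn_zero,
      smul_mul_assoc, mul_smul_comm, mul_sub, sub_mul, mul_one, one_mul, d_R2]
    module
  · rw [if_neg (inl_one_ne_emb a).symm]
    simp only [coneX_one, coneD_emb, coneC_one, sharp_emb, h2, par_inl, mul_zero, sgn_zero,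
      smul_mul_assoc, mul_smul_comm, mul_add, add_mul, mul_one, one_mul, d_R2]
    module
  · simp only [coneX_emb, coneD_emb, coneC_emb, par_emb, zero_smul, sub_zero, emb_inj]
    exact F.isWeyl.dx a b

theorem parity_sharp (a : Idx r n) :
    F.parity * sharp F.x a = sgn (par a) • (sharp F.x a * F.parity) := by
  simp only [sharp, Finset.mul_sum, Finset.sum_mul, Finset.smul_sum, mul_smul_comm,
    smul_mul_assoc, smul_smul]
  refine Finset.sum_congr rfl fun l _ => ?_
  by_cases hl : par a = par l
  · rw [F.parity_x, smul_smul, hl, mul_comm]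
  · rw [metricInv_eq_zero hl]
    simp

theorem parity_R2 : F.parity * F.R2 = F.R2 * F.parity := by
  simp only [R2, rsq, Finset.mul_sum, Finset.sum_mul]
  refine Finset.sum_congr rfl fun j _ => ?_
  rw [← mul_assoc, F.parity_x, smul_mul_assoc, mul_assoc, F.parity_sharp, mul_smul_comm,
    smul_smul, sgn_sq, one_smul, mul_assoc]

theorem parity_E : F.parity * F.E = F.E * F.parity := by
  simp only [E, euler, Finset.mul_sum, Finset.sum_mul]
  refine Finset.sum_congr rfl fun j _ => ?_
  rw [← mul_assoc, F.parity_x, smul_mul_assoc, mul_assoc, F.parity_d, mul_smul_comm,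
    smul_smul, sgn_sq, one_smul, mul_assoc]

theorem parity_coneX (i : Idx (r + 2) n) :
    F.parity * F.coneX i = sgn (par i) • (F.coneX i * F.parity) := by
  rcases idx_cases i with rfl | rfl | ⟨a, rfl⟩
  · simp only [coneX_zero, mul_smul_comm, smul_mul_assoc, mul_sub, sub_mul, mul_one, one_mul,
      parity_R2, par_inl, sgn_zero, one_smul]
  · simp only [coneX_one, mul_smul_comm, smul_mul_assoc, mul_add, add_mul, mul_one, one_mul,
      parity_R2, par_inl, sgn_zero, one_smul]
  · rw [coneX_emb, par_emb, parity_x]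

theorem parity_coneD (κ : ℂ) (i : Idx (r + 2) n) :
    F.parity * F.coneD κ i = sgn (par i) • (F.coneD κ i * F.parity) := by
  rcases idx_cases i with rfl | rfl | ⟨a, rfl⟩
  · simp only [coneD_zero, mul_smul_comm, smul_mul_assoc, mul_sub, sub_mul, mul_one, one_mul,
      parity_E, par_inl, sgn_zero, one_smul]
  · simp only [coneD_one, mul_smul_comm, smul_mul_assoc, mul_sub, sub_mul, mul_one, one_mul,
      parity_E, par_inl, sgn_zero, one_smul]
  · rw [coneD_emb, par_emb, parity_d]

/-- The representation of `osp(r+2|2n)` on the functions of degree `κ` on the cone. -/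
def rep (κ : ℂ) : Rep (r + 2) n P where
  deg := F.deg
  isCompl := F.isCompl_deg
  act p :=
    { toFun := fun X => quadOp F.coneX (F.coneD κ) X.1
      map_add' := fun X Y => by
        simp only [quadOp, Submodule.coe_add, Matrix.add_apply, add_smul, Finset.sum_add_distrib]
      map_smul' := fun c X => by
        simp only [quadOp, SetLike.val_smul, Matrix.smul_apply, smul_eq_mul, mul_smul,
          Finset.smul_sum, RingHom.id_apply] }
  act_deg p q X v hv := by
    refine F.mem_deg_of_parity ?_ hv
    simp only [quadOp, Finset.mul_sum, Finset.sum_mul, Finset.smul_sum, LinearMap.coe_mk,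
      AddHom.coe_mk, mul_smul_comm, smul_mul_assoc]
    refine Finset.sum_congr rfl fun i _ => Finset.sum_congr rfl fun j _ => ?_
    by_cases hij : par i + par j = p
    · rw [← mul_assoc, F.parity_coneX, smul_mul_assoc, mul_assoc, F.parity_coneD, mul_smul_comm,
        smul_smul, smul_smul, mul_assoc, ← sgn_add, hij, smul_smul, mul_comm, mul_assoc]
    · rw [X.2.1 i j hij]
      simp
  act_bracket p q X Y :=
    quadOp_sbracket F.coneX_coneX (F.coneD_coneD κ) (F.coneD_coneX κ) X.2 Y.2

end Fock

/-! ### Restriction to smaller orthosymplectic superalgebras -/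

theorem extend_refl {m n : ℕ} (h : m ≤ m) (X : Matrix (Idx m n) (Idx m n) ℂ) :
    extend h n X = X := by
  have h1 : idxIncl h n = id := by
    ext1 i
    rcases i with i | i <;> rfl
  have h2 : inclMat h n = 1 := by
    ext i j
    simp [inclMat, h1, Matrix.one_apply]
  rw [extend, h2]
  simp

theorem Rep.restrict_refl {m n : ℕ} {V : Type*} [AddCommGroup V] [Module ℂ V] (ρ : Rep m n V)
    (h : m ≤ m) : ρ.restrict h = ρ := by
  have h1 : ∀ p, ρ.act p ∘ₗ ospIncl h n p = ρ.act p := by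
    intro p
    ext1 X
    exact congrArg (ρ.act p) (Subtype.ext (extend_refl h X.1))
  cases ρ
  simp only [Rep.restrict, Rep.mk.injEq, true_and]
  ext1 p
  exact h1 p

theorem quadOp_extend {m' m n : ℕ} (h : m' ≤ m) {A : Type*} [Ring A] [Algebra ℂ A]
    (x d : Idx m n → A) (X : Matrix (Idx m' n) (Idx m' n) ℂ) :
    quadOp x d (extend h n X)
      = quadOp (fun i => x (idxIncl h n i)) (fun i => d (idxIncl h n i)) X := by
  have h1 : ∀ i j, extend h n X i j = ∑ b, ∑ a, (if i = idxIncl h n a then 1 else 0) * X a b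
      * (if j = idxIncl h n b then 1 else 0) := by
    intro i j
    simp only [extend, Matrix.mul_apply, inclMat, Matrix.transpose_apply, Finset.sum_mul]
  have h2 : ∀ (i j : Idx m n) (a b : Idx m' n), ((if i = idxIncl h n a then 1 else 0) * X a b
      * (if j = idxIncl h n b then 1 else 0)) • (x i * d j)
      = if i = idxIncl h n a then
          (if j = idxIncl h n b then X a b • (x i * d j) else 0) else 0 := by
    intro i j a b
    split_ifs <;> simp
  simp only [quadOp, h1, Finset.sum_smul, h2]
  calc _ = ∑ i, ∑ b, ∑ a, ∑ j, (if i = idxIncl h n a then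
          (if j = idxIncl h n b then X a b • (x i * d j) else 0) else 0) := by
        refine Finset.sum_congr rfl fun i _ => ?_
        rw [Finset.sum_comm]
        exact Finset.sum_congr rfl fun b _ => Finset.sum_comm
    _ = ∑ b, ∑ a, ∑ i, ∑ j, (if i = idxIncl h n a then
          (if j = idxIncl h n b then X a b • (x i * d j) else 0) else 0) := by
        rw [Finset.sum_comm]
        exact Finset.sum_congr rfl fun b _ => Finset.sum_comm
    _ = ∑ b, ∑ a, X a b • (x (idxIncl h n a) * d (idxIncl h n b)) := by
        refine Finset.sum_congr rfl fun b _ => Finset.sum_congr rfl fun a _ => ?_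
        rw [Finset.sum_eq_single (idxIncl h n a), Finset.sum_eq_single (idxIncl h n b)]
        · simp only [if_true]
        · intro j _ hj
          simp only [if_neg hj, if_true]
        · simp
        · intro i _ hi
          simp only [if_neg hi, Finset.sum_const_zero]
        · simp
    _ = _ := Finset.sum_comm

theorem idxIncl_emb {r' r n : ℕ} (h : r' ≤ r) (h' : r' + 2 ≤ r + 2) (a : Idx r' n) :
    idxIncl h' n (emb a) = emb (idxIncl h n a) := by
  rcases a with a | a <;> rfl

theorem sharp_idxIncl {m' m n : ℕ} (h : m' ≤ m) {A : Type*} [Ring A] [Algebra ℂ A]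
    (x : Idx m n → A) (i : Idx m' n) :
    sharp x (idxIncl h n i) = sharp (fun j => x (idxIncl h n j)) i := by
  rcases i with i | i
  · rw [sharp_inl, idxIncl, Sum.map_inl, sharp_inl]
  · simp [sharp, idxIncl, metricInv]

/-! ### Vectors of weight `ε₁ + α` -/

/-- ε₁ is the first of all coordinates, so it never occurs with a negative sign in a positive root.
-/
theorem IsPositiveRoot.eval_zero {m n : ℕ} {α : Weight m n} (h : IsPositiveRoot α)
    (hm : 0 < m / 2) : α (Sum.inl ⟨0, hm⟩) = 0 ∨ α (Sum.inl ⟨0, hm⟩) = 1 := by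
  have key : ∀ a : Fin (m / 2), (eps a : Weight m n) (Sum.inl ⟨0, hm⟩) = 0 ∨
      (eps a : Weight m n) (Sum.inl ⟨0, hm⟩) = 1 := by
    intro a
    rw [eps, Pi.single_apply]
    split_ifs <;> simp
  have key2 : ∀ a b : Fin (m / 2), a < b → (eps b : Weight m n) (Sum.inl ⟨0, hm⟩) = 0 := by
    intro a b hab
    rw [eps, Pi.single_apply, if_neg]
    intro h
    rw [← Sum.inl_injective h] at hab
    simp [Fin.lt_def] at hab
  have key3 : ∀ i : Fin n, (del i : Weight m n) (Sum.inl ⟨0, hm⟩) = 0 := by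
    intro i
    simp [del]
  cases h with
  | eps_add_eps a b h => simpa [key2 a b h] using key a
  | eps_sub_eps a b h => simpa [key2 a b h] using key a
  | eps_single a h => exact key a
  | del_add_del i j h => simp [key3]
  | del_sub_del i j h => simp [key3]
  | two_del i => simp [key3]
  | eps_add_del a i => simpa [key3] using key a
  | eps_sub_del a i => simpa [key3] using key a
  | del_single i h => simp [key3]

theorem IsPositiveRoot.ne_zero {m n : ℕ} {α : Weight m n} (h : IsPositiveRoot α) : α ≠ 0 := by
  rintro rfl
  obtain ⟨r, hr⟩ := h.exists_height
  have : height (0 : Weight m n) = 0 := by simp [height]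
  rw [this] at hr
  exact Nat.cast_add_one_ne_zero r hr.symm

/-- The highest weight vector of the natural module. -/
def topVec (r n : ℕ) : Idx (r + 2) n → ℂ := isoVec (r + 2) n ⟨0, by omega⟩ 1

/-- The lowest weight vector of the natural module. -/
def botVec (r n : ℕ) : Idx (r + 2) n → ℂ := isoVec (r + 2) n ⟨0, by omega⟩ (-1)

theorem topVec_eq (r n : ℕ) : topVec r n
    = Pi.single (Sum.inl 0) 1 - Complex.I • Pi.single (Sum.inl 1) 1 := by
  rw [topVec, isoVec, one_mul]
  rfl

theorem botVec_eq (r n : ℕ) : botVec r n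
    = Pi.single (Sum.inl 0) 1 + Complex.I • Pi.single (Sum.inl 1) 1 := by
  rw [botVec, isoVec, neg_one_mul, neg_smul, sub_neg_eq_add]
  rfl

theorem isBasic_topVec (r n : ℕ) : IsBasic 0 ((1 : ℂ) • eps ⟨0, by omega⟩) (topVec r n) :=
  IsBasic.iso _ _ (Or.inl rfl)

theorem isBasic_botVec (r n : ℕ) : IsBasic 0 ((-1 : ℂ) • eps ⟨0, by omega⟩) (botVec r n) :=
  IsBasic.iso _ _ (Or.inr rfl)

theorem mulVec_topVec {r n : ℕ} (X : Matrix (Idx (r + 2) n) (Idx (r + 2) n) ℂ)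
    (i : Idx (r + 2) n) :
    X.mulVec (topVec r n) i = X i (Sum.inl 0) - Complex.I * X i (Sum.inl 1) := by
  rw [topVec_eq, Matrix.mulVec_sub, Matrix.mulVec_smul]
  simp

/-- The image would have weight ε₁ + α, which is not a weight of the natural module: its
ε₁-coefficient is 2, or it is 1, where ε₁ is the only weight and α would vanish. -/
theorem HasWeight.mulVec_topVec {r n : ℕ} {p : ZMod 2} {X : osp (r + 2) n p}
    {α : Weight (r + 2) n} (hX : HasWeight X α) (hα : IsPositiveRoot α) :
    X.1.mulVec (topVec r n) = 0 := by
  set u := X.1.mulVec (topVec r n) with hu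
  have h1 : ∀ s, (cartanMat (r + 2) n s).mulVec u
      = (α s + (eps ⟨0, by omega⟩ : Weight (r + 2) n) s) • u := by
    intro s
    have h2 := hX s
    rw [sbracket, zero_mul, sgn_zero, one_smul, sub_eq_iff_eq_add] at h2
    rw [hu, Matrix.mulVec_mulVec, h2, Matrix.add_mulVec, ← Matrix.mulVec_mulVec,
      (isBasic_topVec r n).mulVec, Matrix.mulVec_smul, Matrix.smul_mulVec, ← add_smul, one_smul]
  have h3 := h1 (Sum.inl ⟨0, by omega⟩)
  rw [cartanMat_inl_mulVec] at h3
  have h4 : (eps ⟨0, by omega⟩ : Weight (r + 2) n) (Sum.inl ⟨0, by omega⟩) = 1 := by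
    simp [eps]
  rw [h4] at h3
  set c := α (Sum.inl ⟨0, by omega⟩) + 1 with hc
  replace h3 : Complex.I • (Pi.single (Sum.inl 0) (u (Sum.inl 1))
      - Pi.single (Sum.inl 1) (u (Sum.inl 0))) = c • u := h3
  have hc0 : c ≠ 0 := by
    rcases hα.eval_zero (show 0 < (r + 2) / 2 by omega) with h | h <;> rw [hc, h] <;> norm_num
  have e0 : Complex.I * u (Sum.inl 1) = c * u (Sum.inl 0) := by
    simpa using congrFun h3 (Sum.inl 0)
  have e1 : -(Complex.I * u (Sum.inl 0)) = c * u (Sum.inl 1) := by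
    simpa using congrFun h3 (Sum.inl 1)
  have e2 : ∀ i, i ≠ Sum.inl 0 → i ≠ Sum.inl 1 → u i = 0 := by
    intro i hi0 hi1
    have h5 := congrFun h3 i
    simp only [Pi.smul_apply, Pi.sub_apply, smul_eq_mul] at h5
    rw [Pi.single_eq_of_ne hi0, Pi.single_eq_of_ne hi1] at h5
    simpa [hc0] using h5.symm
  rcases hα.eval_zero (show 0 < (r + 2) / 2 by omega) with h | h
  · have hc1 : c = 1 := by rw [hc, h, zero_add]
    rw [hc1, one_mul] at e0 e1
    have h5 : u = u (Sum.inl 0) • topVec r n := by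
      ext i
      rw [topVec_eq]
      by_cases hi0 : i = Sum.inl 0
      · subst hi0
        simp
      · by_cases hi1 : i = Sum.inl 1
        · subst hi1
          simp [← e1]
          ring
        · rw [e2 i hi0 hi1]
          simp [hi0, hi1]
    obtain ⟨s, hs⟩ : ∃ s, α s ≠ 0 := by
      by_contra! h6
      exact hα.ne_zero (funext h6)
    have h6 := h1 s
    rw [h5, Matrix.mulVec_smul, (isBasic_topVec r n).mulVec, ← h5, add_smul, one_smul,
      smul_comm, ← h5, right_eq_add, smul_eq_zero] at h6
    exact h6.resolve_left hs
  · have hc1 : c = 2 := by rw [hc, h]; norm_num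
    rw [hc1] at e0 e1
    have h5 : u (Sum.inl 0) = 0 := by
      linear_combination (-2 / 3) * e0 + (-Complex.I / 3) * e1
        + (-1 / 3) * u (Sum.inl 0) * Complex.I_mul_I
    have h6 : u (Sum.inl 1) = 0 := by
      rw [h5] at e1
      linear_combination (-1 / 2) * e1
    ext i
    by_cases hi0 : i = Sum.inl 0
    · subst hi0
      exact h5
    · by_cases hi1 : i = Sum.inl 1
      · subst hi1
        exact h6
      · exact e2 i hi0 hi1

/-- This says that X·top is orthogonal to the isotropic vector top, because X is skew for the form;
so X·top has no component along `botVec`. -/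
theorem mulVec_topVec_zero {r n : ℕ} {p : ZMod 2} (X : osp (r + 2) n p) :
    X.1.mulVec (topVec r n) (Sum.inl 0) = Complex.I * X.1.mulVec (topVec r n) (Sum.inl 1) := by
  have h : ∀ i j : Fin (r + 2), X.1 (Sum.inl j) (Sum.inl i) + X.1 (Sum.inl i) (Sum.inl j) = 0 := by
    intro i j
    have := X.2.2 (Sum.inl i) (Sum.inl j)
    simpa [Matrix.mul_apply, metric, Matrix.one_apply] using this
  have h00 := h 0 0
  have h01 := h 0 1
  have h11 := h 1 1
  rw [mulVec_topVec, mulVec_topVec]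
  linear_combination (1 / 2) * h00 - Complex.I * h01 + (X.1 (Sum.inl 1) (Sum.inl 1)) * Complex.I_mul_I
    - h11 / 2

/-! ### Raising and lowering elements -/

theorem isHomogeneousVec_metricInv {m n : ℕ} (i : Idx m n) :
    IsHomogeneousVec (par i) (metricInv m n i) :=
  fun _ hj => metricInv_eq_zero (Ne.symm hj)

theorem quadOp_wedge {m n : ℕ} {A : Type*} [Ring A] [Algebra ℂ A] (x d : Idx m n → A)
    (a b : ZMod 2) (u w : Idx m n → ℂ) :
    quadOp x d (wedge a b u w)
      = (∑ i, u i • x i) * (∑ j, Matrix.vecMul w (metric m n) j • d j)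
        - sgn (a * b) • ((∑ i, w i • x i) * (∑ j, Matrix.vecMul u (metric m n) j • d j)) := by
  have h : ∀ i j, wedge a b u w i j = u i * Matrix.vecMul w (metric m n) j
      - sgn (a * b) * (w i * Matrix.vecMul u (metric m n) j) := by
    intro i j
    rw [wedge, Matrix.sub_mul, Matrix.smul_mul, Matrix.vecMulVec_mul, Matrix.vecMulVec_mul]
    rfl
  simp only [quadOp, h, Finset.sum_mul_sum, Finset.smul_sum, ← Finset.sum_sub_distrib, sub_smul,
    smul_mul_smul_comm, mul_smul]

theorem metricInv_vecMul_metric {m n : ℕ} (i : Idx m n) :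
    Matrix.vecMul (metricInv m n i) (metric m n) = Pi.single i 1 := by
  ext j
  have := metricInv_mul_metric_apply i j
  rw [Pi.single_apply]
  simp only [Matrix.vecMul, dotProduct]
  rw [this]
  simp only [eq_comm]

theorem topVec_vecMul_metric (r n : ℕ) :
    Matrix.vecMul (topVec r n) (metric (r + 2) n) = topVec r n := by
  rw [topVec_eq, Matrix.sub_vecMul, Matrix.smul_vecMul, single_inl_vecMul_metric,
    single_inl_vecMul_metric]

theorem botVec_vecMul_metric (r n : ℕ) :
    Matrix.vecMul (botVec r n) (metric (r + 2) n) = botVec r n := by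
  rw [botVec_eq, Matrix.add_vecMul, Matrix.smul_vecMul, single_inl_vecMul_metric,
    single_inl_vecMul_metric]

/-- The raising element of weight `ε₁ + α` for a coordinate of weight `α`. -/
def raiseElt {r n : ℕ} (a : Idx r n) : osp (r + 2) n (0 + par a) :=
  ⟨wedge 0 (par a) (topVec r n) (metricInv (r + 2) n (emb a)),
    wedge_mem (isBasic_topVec r n).isHomogeneousVec
      (par_emb a ▸ isHomogeneousVec_metricInv (emb a))⟩

/-- The lowering element of weight `-ε₁ + α` for a coordinate of weight `α`. -/
def lowerElt {r n : ℕ} (a : Idx r n) : osp (r + 2) n (0 + par a) :=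
  ⟨wedge 0 (par a) (botVec r n) (metricInv (r + 2) n (emb a)),
    wedge_mem (isBasic_botVec r n).isHomogeneousVec
      (par_emb a ▸ isHomogeneousVec_metricInv (emb a))⟩

/-- The set of lowering elements. -/
def lowerElts (r n : ℕ) (p : ZMod 2) : Set (osp (r + 2) n p) :=
  {X | ∃ a : Idx r n, p = 0 + par a ∧
    X.1 = wedge 0 (par a) (botVec r n) (metricInv (r + 2) n (emb a))}

theorem sum_idx_smul {r n : ℕ} {M : Type*} [AddCommGroup M] [Module ℂ M]
    (f : Idx (r + 2) n → M) (u : Idx (r + 2) n → ℂ) :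
    ∑ i, u i • f i = u (Sum.inl 0) • f (Sum.inl 0) + u (Sum.inl 1) • f (Sum.inl 1)
      + ∑ a, u (emb a) • f (emb a) := sum_idx _

theorem sum_topVec_smul {r n : ℕ} {M : Type*} [AddCommGroup M] [Module ℂ M]
    (f : Idx (r + 2) n → M) : ∑ i, topVec r n i • f i
      = f (Sum.inl 0) - Complex.I • f (Sum.inl 1) := by
  rw [sum_idx_smul, topVec_eq]
  simp [(inl_zero_ne_emb _).symm, (inl_one_ne_emb _).symm]
  abel

theorem sum_botVec_smul {r n : ℕ} {M : Type*} [AddCommGroup M] [Module ℂ M]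
    (f : Idx (r + 2) n → M) : ∑ i, botVec r n i • f i
      = f (Sum.inl 0) + Complex.I • f (Sum.inl 1) := by
  rw [sum_idx_smul, botVec_eq]
  simp [(inl_zero_ne_emb _).symm, (inl_one_ne_emb _).symm]

theorem sum_single_smul {m n : ℕ} {M : Type*} [AddCommGroup M] [Module ℂ M]
    (f : Idx m n → M) (i : Idx m n) : ∑ j, (Pi.single i 1 : Idx m n → ℂ) j • f j = f i := by
  rw [Finset.sum_eq_single i]
  · simp
  · intro j _ hj
    simp [hj]
  · simp

/-! ### Lowering operators and irreducible submodules of the restrictions -/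

namespace Fock

variable {r n : ℕ} {P : Type*} [AddCommGroup P] [Module ℂ P] (F : Fock r n P)

/-- The lowering operators. -/
def K (κ : ℂ) (a : Idx r n) : Module.End ℂ P :=
  (2 : ℂ) • (sharp F.x a * (F.E - κ • 1)) - F.R2 * F.d a

section

variable {r' : ℕ} (h : r' ≤ r) (h' : r' + 2 ≤ r + 2) (κ : ℂ)

theorem restrict_act (p : ZMod 2) (X : osp (r' + 2) n p) :
    ((F.rep κ).restrict h').act p X = quadOp (fun i => F.coneX (idxIncl h' n i))
      (fun i => F.coneD κ (idxIncl h' n i)) X.1 := quadOp_extend h' _ _ X.1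

/-- The slice of the cone is normalised by X₀ - iX₁ = 1; by the equation of the cone X₀ + iX₁ is
then -R², as in `coneX_bot`. -/
theorem coneX_top : ∑ i, topVec r' n i • F.coneX (idxIncl h' n i) = 1 := by
  rw [sum_topVec_smul]
  change (1 / 2 : ℂ) • (1 - F.R2) - Complex.I • (Complex.I / 2) • (1 + F.R2) = 1
  rw [smul_smul, show Complex.I * (Complex.I / 2) = -1 / 2 by
    linear_combination (1 / 2) * Complex.I_mul_I]
  module

theorem coneX_bot : ∑ i, botVec r' n i • F.coneX (idxIncl h' n i) = -F.R2 := by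
  rw [sum_botVec_smul]
  change (1 / 2 : ℂ) • (1 - F.R2) + Complex.I • (Complex.I / 2) • (1 + F.R2) = -F.R2
  rw [smul_smul, show Complex.I * (Complex.I / 2) = -1 / 2 by
    linear_combination (1 / 2) * Complex.I_mul_I]
  module

/-- The extended functions depend on X₀ and X₁ only through X₀ - iX₁, which is constant in this
isotropic direction. -/
theorem coneD_top : ∑ i, topVec r' n i • F.coneD κ (idxIncl h' n i) = 0 := by
  rw [sum_topVec_smul]
  change (κ • 1 - F.E) - Complex.I • (-Complex.I) • (κ • 1 - F.E) = 0
  rw [smul_smul, show Complex.I * -Complex.I = 1 by linear_combination -Complex.I_mul_I]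
  module

theorem coneD_bot : ∑ i, botVec r' n i • F.coneD κ (idxIncl h' n i)
    = (2 : ℂ) • (κ • 1 - F.E) := by
  rw [sum_botVec_smul]
  change (κ • 1 - F.E) + Complex.I • (-Complex.I) • (κ • 1 - F.E) = _
  rw [smul_smul, show Complex.I * -Complex.I = 1 by linear_combination -Complex.I_mul_I]
  module

include h in
theorem coneX_metricInv (a : Idx r' n) :
    ∑ i, metricInv (r' + 2) n (emb a) i • F.coneX (idxIncl h' n i)
      = sharp F.x (idxIncl h n a) := by
  change sharp (fun i => F.coneX (idxIncl h' n i)) (emb a) = _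
  rw [sharp_emb, sharp_idxIncl]
  congr 1
  ext1 b
  rw [idxIncl_emb h, coneX_emb]

theorem restrict_lower (a : Idx r' n) (p : ZMod 2) (X : osp (r' + 2) n p)
    (hX : X.1 = wedge 0 (par a) (botVec r' n) (metricInv (r' + 2) n (emb a))) :
    ((F.rep κ).restrict h').act p X = F.K κ (idxIncl h n a) := by
  rw [restrict_act, hX, quadOp_wedge, metricInv_vecMul_metric, botVec_vecMul_metric,
    sum_single_smul, coneX_bot, coneD_bot, F.coneX_metricInv h, idxIncl_emb h, coneD_emb, K,
    zero_mul, sgn_zero, one_smul, neg_mul, mul_smul_comm, ← neg_sub (F.E), mul_neg]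
  module

theorem restrict_raise (a : Idx r' n) :
    ((F.rep κ).restrict h').act _ (raiseElt a) = F.d (idxIncl h n a) := by
  rw [restrict_act, raiseElt, quadOp_wedge, metricInv_vecMul_metric, topVec_vecMul_metric,
    sum_single_smul, coneX_top, coneD_top, idxIncl_emb h, coneD_emb, one_mul, mul_zero, smul_zero,
    sub_zero]

/-- Consequently every submodule is stable under the Euler operator. -/
theorem restrict_cartan_zero :
    ((F.rep κ).restrict h').act 0 (cartan (r' + 2) n (Sum.inl ⟨0, by omega⟩))
      = κ • 1 - F.E := by
  have h1 : (cartan (r' + 2) n (Sum.inl ⟨0, by omega⟩)).1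
      = (1 / 2 : ℂ) • wedge 0 0 (topVec r' n) (botVec r' n) := by
    rw [topVec, botVec, wedge_isoVec, smul_smul]
    norm_num [cartan]
  have h2 : ∀ (x d : Idx (r' + 2) n → Module.End ℂ P) (c : ℂ)
      (X : Matrix (Idx (r' + 2) n) (Idx (r' + 2) n) ℂ), quadOp x d (c • X) = c • quadOp x d X := by
    intro x d c X
    simp only [quadOp, Finset.smul_sum, Matrix.smul_apply, smul_eq_mul, mul_smul]
  rw [restrict_act, h1, h2, quadOp_wedge, topVec_vecMul_metric, botVec_vecMul_metric, coneX_top,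
    coneD_top, coneD_bot, one_mul]
  simp only [mul_zero, smul_zero, sub_zero, smul_smul]
  norm_num

include h in
/-- The action on a homogeneous function that is annihilated by the derivatives. -/
theorem restrict_act_of_d_eq_zero {f : P} {j : ℂ} (hf : f ∈ F.homog j)
    (hd : ∀ a : Idx r' n, F.d (idxIncl h n a) f = 0) (p : ZMod 2) (X : osp (r' + 2) n p) :
    ((F.rep κ).restrict h').act p X f
      = (κ - j) • ∑ i, X.1.mulVec (topVec r' n) i • F.coneX (idxIncl h' n i) f := by
  rw [restrict_act, quadOp, LinearMap.sum_apply, Finset.smul_sum]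
  refine Finset.sum_congr rfl fun i _ => ?_
  rw [LinearMap.sum_apply, sum_idx, mulVec_topVec]
  have h1 : ∀ a : Idx r' n, (X.1 i (emb a) • (F.coneX (idxIncl h' n i)
      * F.coneD κ (idxIncl h' n (emb a)))) f = 0 := by
    intro a
    rw [idxIncl_emb h, coneD_emb, LinearMap.smul_apply, Module.End.mul_apply, hd, map_zero,
      smul_zero]
  simp only [h1, Finset.sum_const_zero, add_zero]
  rw [F.mem_homog] at hf
  change X.1 i (Sum.inl 0) • (F.coneX (idxIncl h' n i)) ((κ • 1 - F.E) f)
    + X.1 i (Sum.inl 1) • (F.coneX (idxIncl h' n i)) (((-Complex.I) • (κ • 1 - F.E)) f) = _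
  have h2 : (κ • 1 - F.E) f = (κ - j) • f := by
    rw [LinearMap.sub_apply, hf, sub_smul]
    rfl
  rw [LinearMap.smul_apply, h2]
  simp only [map_smul]
  module

-- On such `f` only the derivatives along X₀ and X₁ survive, and they act by (κ - j)(1, -i), a
-- multiple of the vector top. So `f` inherits its weights and its annihilators from the top vector
-- of the natural module.
include h in
theorem isHighestWeightVector_of {f : P} {j : ℂ} (hf0 : f ≠ 0) (hf : f ∈ F.homog j)
    (hd : ∀ a : Idx r' n, F.d (idxIncl h n a) f = 0) {l : ℕ} (hl : κ - j = l) :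
    ((F.rep κ).restrict h').IsHighestWeightVector (firstWeight (r' + 2) n l) f := by
  refine ⟨hf0, fun s => ?_, fun α hα p X hX => ?_⟩
  · rw [F.restrict_act_of_d_eq_zero h h' κ hf hd, hl]
    have h1 : (cartan (r' + 2) n s).1.mulVec (topVec r' n) = _ := (isBasic_topVec r' n).mulVec s
    have h2 : ∑ i, topVec r' n i • F.coneX (idxIncl h' n i) f = f := by
      have := LinearMap.congr_fun (F.coneX_top h') f
      simpa [LinearMap.sum_apply] using this
    simp only [h1, Pi.smul_apply, smul_eq_mul, one_mul, mul_smul, ← Finset.smul_sum, h2]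
    rw [smul_smul]
    congr 1
    rcases s with s | s
    · by_cases hs : (s : ℕ) = 0
      · have hs' : s = ⟨0, by omega⟩ := Fin.ext hs
        rw [hs']
        simp [firstWeight, eps]
      · have hs' : s ≠ ⟨0, by omega⟩ := fun h => hs (congrArg Fin.val h)
        simp [firstWeight, eps, hs, hs']
    · simp [firstWeight, eps]
  · rw [F.restrict_act_of_d_eq_zero h h' κ hf hd, hX.mulVec_topVec hα]
    simp

/-- The submodule generated by a vector under the lowering operators. -/
def gen (f : P) : Submodule ℂ P := ((F.rep κ).restrict h').closure (lowerElts r' n) f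

theorem mem_gen_self (f : P) : f ∈ F.gen (r' := r') h' κ f := Rep.mem_closure_self _ _ _

theorem K_mem_gen (f : P) (a : Idx r' n) {g : P} (hg : g ∈ F.gen h' κ f) :
    F.K κ (idxIncl h n a) g ∈ F.gen h' κ f := by
  have h1 := F.restrict_lower h h' κ a _ (lowerElt a) rfl
  rw [← h1]
  exact Rep.act_mem_closure _ (lowerElts r' n) f ⟨a, rfl, rfl⟩ hg

theorem gen_le {f : P} {U : Submodule ℂ P} (hf : f ∈ U)
    (hU : ∀ a : Idx r' n, ∀ g ∈ U, F.K κ (idxIncl h n a) g ∈ U) : F.gen h' κ f ≤ U := by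
  refine Rep.closure_le _ _ hf ?_
  rintro p X ⟨a, -, hX⟩ g hg
  rw [F.restrict_lower h h' κ a p X hX]
  exact hU a g hg

-- Since X·top has no component along bottom, X f is a combination of `f` and the (κ - j) x_a f, and
-- the latter are combinations of the K_b f.
include h in
theorem isSubmodule_gen {f : P} {j : ℂ} (hf0 : f ∈ F.deg 0) (hf : f ∈ F.homog j)
    (hd : ∀ a : Idx r' n, F.d (idxIncl h n a) f = 0) :
    ((F.rep κ).restrict h').IsSubmodule (F.gen h' κ f) := by
  refine Rep.isSubmodule_closure _ _ hf0 fun p X => ?_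
  rw [F.restrict_act_of_d_eq_zero h h' κ hf hd, sum_idx_smul, mulVec_topVec_zero, smul_add]
  refine add_mem (Submodule.smul_mem _ _ ?_) ?_
  · have h1 : (Complex.I * X.1.mulVec (topVec r' n) (Sum.inl 1)) •
        F.coneX (idxIncl h' n (Sum.inl 0)) f
        + X.1.mulVec (topVec r' n) (Sum.inl 1) • F.coneX (idxIncl h' n (Sum.inl 1)) f
        = (Complex.I * X.1.mulVec (topVec r' n) (Sum.inl 1)) • f := by
      change _ • ((1 / 2 : ℂ) • (f - F.R2 f)) + _ • ((Complex.I / 2) • (f + F.R2 f)) = _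
      module
    rw [h1]
    exact Submodule.smul_mem _ _ (F.mem_gen_self h' κ f)
  · have h1 : ∀ b : Idx r' n, F.K κ (idxIncl h n b) f
        = (2 * (j - κ)) • sharp F.x (idxIncl h n b) f := by
      intro b
      rw [F.mem_homog] at hf
      simp only [K, LinearMap.sub_apply, LinearMap.smul_apply, Module.End.mul_apply, hd, map_zero,
        sub_zero, hf, Module.End.one_apply, map_sub, map_smul]
      module
    have h2 : ∀ a : Idx r' n, (κ - j) • F.x (idxIncl h n a) f ∈ F.gen h' κ f := by
      intro a
      have h3 : F.x (idxIncl h n a) = ∑ b, metric r' n a b • sharp F.x (idxIncl h n b) := by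
        simp only [sharp_idxIncl]
        exact (sum_metric_smul_sharp (fun b => F.x (idxIncl h n b)) a).symm
      -- K_b f = 2(j - κ) x^b f, and lowering the index with the metric recovers x_a; hence the
      -- factor -1/2.
      have h4 : (κ - j) • F.x (idxIncl h n a) f
          = ∑ b, (-(1 / 2) * metric r' n a b) • F.K κ (idxIncl h n b) f := by
        rw [h3, LinearMap.sum_apply, Finset.smul_sum]
        refine Finset.sum_congr rfl fun b _ => ?_
        rw [h1, LinearMap.smul_apply]
        module
      rw [h4]
      exact sum_mem fun b _ => Submodule.smul_mem _ _
        (F.K_mem_gen h h' κ f b (F.mem_gen_self h' κ f))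
    rw [Finset.smul_sum]
    refine sum_mem fun a _ => ?_
    rw [idxIncl_emb h, coneX_emb, smul_comm]
    exact Submodule.smul_mem _ _ (h2 a)

/-- A criterion for the submodule generated by a highest weight vector to be irreducible. -/
theorem isL_gen {f : P} {j : ℂ} (hf0 : f ≠ 0) (hfdeg : f ∈ F.deg 0) (hf : f ∈ F.homog j)
    (hd : ∀ a : Idx r' n, F.d (idxIncl h n a) f = 0) {l : ℕ} (hl : κ - j = l)
    (hirr : ∀ (e : ℕ), ∀ g ∈ F.gen h' κ f, g ≠ 0 → g ∈ F.homog e →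
      (∀ a : Idx r' n, F.d (idxIncl h n a) g = 0) → f ∈ Submodule.span ℂ {g}) :
    (((F.rep κ).restrict h').sub (F.gen h' κ f) (F.isSubmodule_gen h h' κ hfdeg hf hd)).IsL l := by
  have hsub := F.isSubmodule_gen h h' κ hfdeg hf hd
  have hv := F.isHighestWeightVector_of h h' κ hf0 hf hd hl
  refine ⟨⟨⟨⟨f, F.mem_gen_self h' κ f⟩, 0, fun h0 => hf0 (congrArg Subtype.val h0)⟩,
    fun U hU => ?_⟩, ⟨f, F.mem_gen_self h' κ f⟩, hfdeg,
    fun h0 => hf0 (congrArg Subtype.val h0), fun s => Subtype.ext (hv.2.1 s),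
    fun α hα p X hX => Subtype.ext (hv.2.2 α hα p X hX)⟩
  by_cases hU0 : U = ⊥
  · exact Or.inl hU0
  right
  have hU' := hsub.map_subtype hU
  have h0 : U.map (F.gen h' κ f).subtype ≠ ⊥ := by
    intro h1
    refine hU0 (eq_bot_iff.2 fun w hw => ?_)
    have h2 : (w : P) ∈ U.map (F.gen h' κ f).subtype := ⟨w, hw, rfl⟩
    rw [h1, Submodule.mem_bot] at h2
    exact Subtype.ext h2
  have hE : ∀ v ∈ U.map (F.gen h' κ f).subtype, F.E v ∈ U.map (F.gen h' κ f).subtype := by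
    intro v hv
    have h1 := hU'.1 0 (cartan (r' + 2) n (Sum.inl ⟨0, by omega⟩)) v hv
    rw [restrict_cartan_zero] at h1
    have h2 : F.E v = κ • v - (κ • 1 - F.E) v := by
      rw [LinearMap.sub_apply, LinearMap.smul_apply, Module.End.one_apply]
      abel
    rw [h2]
    exact sub_mem (Submodule.smul_mem _ _ hv) h1
  have hD : ∀ i ∈ Set.range (idxIncl h n), ∀ v ∈ U.map (F.gen h' κ f).subtype,
      F.d i v ∈ U.map (F.gen h' κ f).subtype := by
    rintro _ ⟨a, rfl⟩ v hv
    rw [← F.restrict_raise h h' κ a]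
    exact hU'.1 _ _ v hv
  -- Any nonzero submodule contains a singular vector `g`; by `hirr` it yields `f` back, and `f`
  -- generates everything.
  obtain ⟨e, g, hg, hg0, hge, hgd⟩ := F.exists_homog_of_stable h0 hE hD
  have h1 := hirr e g (Submodule.map_subtype_le _ _ hg) hg0 hge fun a => hgd _ ⟨a, rfl⟩
  obtain ⟨c, hc⟩ := Submodule.mem_span_singleton.1 h1
  have h2 : F.gen h' κ f ≤ U.map (F.gen h' κ f).subtype := by
    refine F.gen_le h h' κ ?_ fun a w hw => ?_
    · exact Set.mem_of_eq_of_mem hc.symm (Submodule.smul_mem _ c hg)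
    · rw [← F.restrict_lower h h' κ a _ (lowerElt a) rfl]
      exact hU'.1 _ _ w hw
  rw [eq_top_iff]
  rintro ⟨w, hw⟩ _
  obtain ⟨w', hw', hww⟩ := h2 hw
  have h3 : w' = ⟨w, hw⟩ := Subtype.ext hww
  exact h3 ▸ hw'

end

theorem eq_smul_vac {v : P} (hd : ∀ i, F.d i v = 0) :
    ∃ c : ℂ, v = c • F.vac := by
  refine F.mem_homog_zero ?_
  rw [mem_homog, zero_smul]
  simp [E, euler, hd]

theorem isSubmodule_gen_vac (κ : ℂ) :
    ((F.rep κ).restrict (le_refl (r + 2))).IsSubmodule (F.gen (le_refl (r + 2)) κ F.vac) :=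
  F.isSubmodule_gen le_rfl le_rfl κ F.vac_mem_deg F.vac_mem_homog fun _ => F.d_vac _

/-- By Euler's identity a polynomial with vanishing derivatives is constant, so the constants are
the only singular vectors. -/
theorem isL_gen_vac (k : ℕ) : (((F.rep (k : ℂ)).restrict (le_refl (r + 2))).sub
    (F.gen (le_refl (r + 2)) (k : ℂ) F.vac) (F.isSubmodule_gen_vac _)).IsL k := by
  refine F.isL_gen le_rfl le_rfl _ F.vac_ne F.vac_mem_deg F.vac_mem_homog (fun _ => F.d_vac _)
    (sub_zero _) fun e g _ hg0 hge hgd => ?_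
  obtain ⟨c, rfl⟩ := F.eq_smul_vac fun i => by
    have h1 : idxIncl (le_refl r) n i = i := by rcases i with i | i <;> rfl
    simpa only [h1] using hgd i
  rw [Submodule.mem_span_singleton]
  have hc : c ≠ 0 := by
    rintro rfl
    exact hg0 (zero_smul _ _)
  exact ⟨c⁻¹, by rw [smul_smul, inv_mul_cancel₀ hc, one_smul]⟩

end Fock

/-- The irreducible modules with highest weight `(k, 0, …, 0)` exist. -/
theorem existsL (r n k : ℕ) : ExistsL (r + 2) n k :=
  ⟨_, _, _, _, (SuperPoly.fock r n).isL_gen_vac k⟩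

namespace Fock

variable {r n : ℕ} {P : Type*} [AddCommGroup P] [Module ℂ P] (F : Fock (r + 1) n P)

/-! ### Splitting off the last even coordinate -/

/-- The last even coordinate. -/
def t : Module.End ℂ P := F.x (Sum.inl (Fin.last r))

/-- The derivative with respect to the last even coordinate. -/
def dt : Module.End ℂ P := F.d (Sum.inl (Fin.last r))

/-- The other coordinates. -/
def y (a : Idx r n) : Module.End ℂ P := F.x (idxIncl r.le_succ n a)

/-- The derivatives with respect to the other coordinates. -/
def dy (a : Idx r n) : Module.End ℂ P := F.d (idxIncl r.le_succ n a)

/-- The degree in the last even coordinate. -/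
def Et : Module.End ℂ P := F.t * F.dt

theorem last_ne (a : Idx r n) : (Sum.inl (Fin.last r) : Idx (r + 1) n) ≠ idxIncl r.le_succ n a := by
  rcases a with a | a
  · intro h
    have h1 := congrArg Fin.val (Sum.inl_injective h)
    simp at h1
    omega
  · simp [idxIncl]

theorem sum_idx_succ {M : Type*} [AddCommMonoid M] (f : Idx (r + 1) n → M) :
    ∑ i, f i = ∑ a, f (idxIncl r.le_succ n a) + f (Sum.inl (Fin.last r)) := by
  rw [Fintype.sum_sum_type, Fintype.sum_sum_type, Fin.sum_univ_castSucc, add_right_comm]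
  rfl

theorem isWeyl_y : IsWeyl F.y F.dy := by
  refine ⟨fun i j => ?_, fun i j => ?_, fun i j => ?_⟩
  · rw [y, y, F.isWeyl.xx, par_idxIncl, par_idxIncl]
  · rw [dy, dy, F.isWeyl.dd, par_idxIncl, par_idxIncl]
  · rw [dy, y, F.isWeyl.dx, par_idxIncl, par_idxIncl]
    simp only [(idxIncl_injective _ n).eq_iff]

theorem t_y (a : Idx r n) (v : P) : F.t (F.y a v) = F.y a (F.t v) := by
  have := LinearMap.congr_fun (F.isWeyl.xx (Sum.inl (Fin.last r)) (idxIncl r.le_succ n a)) v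
  simpa [t, y] using this

theorem dt_dy (a : Idx r n) (v : P) : F.dt (F.dy a v) = F.dy a (F.dt v) := by
  have := LinearMap.congr_fun (F.isWeyl.dd (Sum.inl (Fin.last r)) (idxIncl r.le_succ n a)) v
  simpa [dt, dy] using this

theorem dt_y (a : Idx r n) (v : P) : F.dt (F.y a v) = F.y a (F.dt v) := by
  have := F.d_x (Sum.inl (Fin.last r)) (idxIncl r.le_succ n a) v
  simpa [dt, y, last_ne] using this

theorem dy_t (a : Idx r n) (v : P) : F.dy a (F.t v) = F.t (F.dy a v) := by
  have := F.d_x (idxIncl r.le_succ n a) (Sum.inl (Fin.last r)) v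
  simpa [dy, t, (last_ne a).symm] using this

theorem dt_t (v : P) : F.dt (F.t v) = F.t (F.dt v) + v := by
  have := F.d_x (Sum.inl (Fin.last r)) (Sum.inl (Fin.last r)) v
  simpa [dt, t] using this

theorem sharp_y (a : Idx r n) : sharp F.x (idxIncl r.le_succ n a) = sharp F.y a :=
  sharp_idxIncl _ _ _

theorem t_sharp (a : Idx r n) (v : P) : F.t (sharp F.y a v) = sharp F.y a (F.t v) := by
  simp [sharp, LinearMap.sum_apply, t_y]

theorem dt_sharp (a : Idx r n) (v : P) : F.dt (sharp F.y a v) = sharp F.y a (F.dt v) := by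
  simp [sharp, LinearMap.sum_apply, dt_y]

theorem R2_eq : F.R2 = rsq F.y + F.t * F.t := by
  rw [R2, rsq, sum_idx_succ, sharp_inl]
  simp only [sharp_y]
  rfl

theorem E_eq : F.E = euler F.y F.dy + F.Et := by
  rw [E, euler, sum_idx_succ]
  rfl

theorem dt_rsq (v : P) : F.dt (rsq F.y v) = rsq F.y (F.dt v) := by
  simp [rsq, LinearMap.sum_apply, dt_y, dt_sharp]

theorem t_rsq (v : P) : F.t (rsq F.y v) = rsq F.y (F.t v) := by
  simp [rsq, LinearMap.sum_apply, t_y, t_sharp]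

theorem t_euler (v : P) : F.t (euler F.y F.dy v) = euler F.y F.dy (F.t v) := by
  simp [euler, LinearMap.sum_apply, t_y, dy_t]

theorem dt_euler (v : P) : F.dt (euler F.y F.dy v) = euler F.y F.dy (F.dt v) := by
  simp [euler, LinearMap.sum_apply, dt_y, dt_dy]

theorem t_lap (v : P) : F.t (lap F.dy v) = lap F.dy (F.t v) := by
  simp [lap, LinearMap.sum_apply, dy_t]

theorem dt_lap (v : P) : F.dt (lap F.dy v) = lap F.dy (F.dt v) := by
  simp [lap, LinearMap.sum_apply, dt_dy]

theorem K_y (κ : ℂ) (a : Idx r n) (v : P) : F.K κ (idxIncl r.le_succ n a) v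
    = (2 : ℂ) • sharp F.y a (F.E v - κ • v) - F.R2 (F.dy a v) := by
  rw [K, sharp_y]
  rfl

theorem K_t (κ : ℂ) (v : P) : F.K κ (Sum.inl (Fin.last r)) v
    = (2 : ℂ) • F.t (F.E v - κ • v) - F.R2 (F.dt v) := by
  rw [K, sharp_inl]
  rfl

theorem E_t (v : P) : F.E (F.t v) = F.t (F.E v) + F.t v := F.E_x _ v

theorem E_sharp (a : Idx r n) (v : P) :
    F.E (sharp F.y a v) = sharp F.y a (F.E v) + sharp F.y a v := by
  rw [← sharp_y]
  exact LinearMap.congr_fun (F.isWeyl.euler_sharp _) v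

theorem E_R2_apply (v : P) : F.E (F.R2 v) = F.R2 (F.E v) + (2 : ℂ) • F.R2 v :=
  LinearMap.congr_fun F.E_R2 v

theorem R2_t (v : P) : F.R2 (F.t v) = F.t (F.R2 v) := LinearMap.congr_fun (F.R2_x _) v

theorem R2_sharp (a : Idx r n) (v : P) : F.R2 (sharp F.y a v) = sharp F.y a (F.R2 v) := by
  rw [← sharp_y]
  exact LinearMap.congr_fun (F.isWeyl.rsq_sharp _) v

theorem dt_E (v : P) : F.dt (F.E v) = F.E (F.dt v) + F.dt v := F.d_E _ v

theorem dy_E (a : Idx r n) (v : P) : F.dy a (F.E v) = F.E (F.dy a v) + F.dy a v := F.d_E _ v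

theorem dt_R2 (v : P) : F.dt (F.R2 v) = F.R2 (F.dt v) + (2 : ℂ) • F.t v := by
  have := LinearMap.congr_fun (F.d_R2 (Sum.inl (Fin.last r))) v
  rwa [sharp_inl] at this

theorem dy_R2 (a : Idx r n) (v : P) :
    F.dy a (F.R2 v) = F.R2 (F.dy a v) + (2 : ℂ) • sharp F.y a v := by
  have := LinearMap.congr_fun (F.d_R2 (idxIncl r.le_succ n a)) v
  rwa [sharp_y] at this

/-- Because of this, stability of a sum of branches under K_t only has to be checked on their
generators t^j. -/
theorem K_comm (κ : ℂ) (a : Idx r n) (v : P) :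
    F.K κ (Sum.inl (Fin.last r)) (F.K κ (idxIncl r.le_succ n a) v)
      = F.K κ (idxIncl r.le_succ n a) (F.K κ (Sum.inl (Fin.last r)) v) := by
  simp only [K_y, K_t, map_sub, map_add, map_smul, E_t, E_sharp, E_R2_apply, R2_t, R2_sharp,
    dt_E, dy_E, dt_R2, dy_R2, dt_sharp, dy_t, dt_dy, t_sharp, smul_sub, smul_add]
  module

/-- The operator that separates the summands of the restriction. -/
def casimir (κ μ : ℂ) : Module.End ℂ P :=
  F.t * F.t * lap F.dy + (κ • 1 - F.Et) * ((κ + μ) • 1 - F.Et)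

/-- The operator plays the role of a Casimir element of the smaller algebra: commuting with all K_y,
it is scalar on whatever these generate from a power of t. The parameter must be the superdimension
r - 2n of the y-space, for the commutator of its Laplacian with |y|² to cancel. -/
theorem casimir_K (κ : ℂ) (a : Idx r n) (v : P) :
    F.casimir κ (r - 2 * n) (F.K κ (idxIncl r.le_succ n a) v)
      = F.K κ (idxIncl r.le_succ n a) (F.casimir κ (r - 2 * n) v) := by
  have h1 : ∀ v, lap F.dy (F.dy a v) = F.dy a (lap F.dy v) :=
    LinearMap.congr_fun (F.isWeyl_y.lap_d a)
  have h2 : ∀ v, lap F.dy (sharp F.y a v) = sharp F.y a (lap F.dy v) + (2 : ℂ) • F.dy a v := by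
    intro v
    have := LinearMap.congr_fun (F.isWeyl_y.lap_sharp a) v
    rwa [two_mul, ← two_smul ℂ] at this
  have h3 : ∀ v, lap F.dy (euler F.y F.dy v)
      = euler F.y F.dy (lap F.dy v) + (2 : ℂ) • lap F.dy v := by
    intro v
    have := LinearMap.congr_fun F.isWeyl_y.lap_euler v
    rwa [two_mul, ← two_smul ℂ] at this
  have h4 : ∀ v, lap F.dy (rsq F.y v) = rsq F.y (lap F.dy v) + (4 : ℂ) • euler F.y F.dy v
      + (2 * ((r : ℂ) - 2 * n)) • v := by
    intro v
    have := LinearMap.congr_fun F.isWeyl_y.lap_rsq v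
    simp only [LinearMap.add_apply, Module.End.mul_apply, Module.algebraMap_end_apply,
      Module.End.ofNat_apply] at this
    rw [this, ofNat_smul_eq_nsmul ℂ]
  have h5 : ∀ v, F.dy a (euler F.y F.dy v) = euler F.y F.dy (F.dy a v) + F.dy a v :=
    LinearMap.congr_fun (F.isWeyl_y.d_euler a)
  simp only [K_y, casimir, R2_eq, E_eq, Et, LinearMap.add_apply, LinearMap.sub_apply,
    LinearMap.smul_apply, Module.End.mul_apply, Module.End.one_apply,
    map_sub, map_add, map_smul, h1, h2, h3, h4, h5, dt_t, ← t_lap, dt_lap, dt_euler, dt_rsq,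
    dt_sharp, dy_t, dt_dy, ← t_sharp, ← t_rsq, ← t_euler, smul_sub, smul_add]
  module

end Fock

/-! ### Degree bounds for the irreducible module -/

namespace Fock

section

variable {r n : ℕ} {P : Type*} [AddCommGroup P] [Module ℂ P] (F : Fock r n P)

theorem R2_mem_homog {e : ℂ} {v : P} (hv : v ∈ F.homog e) : F.R2 v ∈ F.homog (e + 2) := by
  rw [mem_homog] at hv ⊢
  have := LinearMap.congr_fun F.E_R2 v
  simp only [Module.End.mul_apply, LinearMap.add_apply, LinearMap.smul_apply] at this
  rw [this, hv, map_smul]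
  module

theorem sharp_mem_homog (a : Idx r n) {e : ℂ} {v : P} (hv : v ∈ F.homog e) :
    sharp F.x a v ∈ F.homog (e + 1) := by
  rw [sharp, LinearMap.sum_apply]
  exact sum_mem fun i _ => Submodule.smul_mem _ _ (F.x_mem_homog i hv)

theorem K_apply_of_mem_homog (κ : ℂ) (a : Idx r n) {e : ℂ} {v : P} (hv : v ∈ F.homog e) :
    F.K κ a v = (2 * (e - κ)) • sharp F.x a v - F.R2 (F.d a v) := by
  rw [mem_homog] at hv
  simp only [K, LinearMap.sub_apply, LinearMap.smul_apply, Module.End.mul_apply, hv,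
    Module.End.one_apply, map_sub, map_smul]
  module

theorem K_mem_homog (κ : ℂ) (a : Idx r n) {e : ℂ} {v : P} (hv : v ∈ F.homog e) :
    F.K κ a v ∈ F.homog (e + 1) := by
  rw [F.K_apply_of_mem_homog κ a hv]
  refine sub_mem (Submodule.smul_mem _ _ (F.sharp_mem_homog a hv)) ?_
  have := F.R2_mem_homog (F.d_mem_homog a hv)
  rwa [show e - 1 + 2 = e + 1 by ring] at this

theorem R2_pow_mem_homog (b : ℕ) {e : ℂ} {v : P} (hv : v ∈ F.homog e) :
    (F.R2 ^ b) v ∈ F.homog (e + 2 * b) := by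
  induction b with
  | zero => simpa using hv
  | succ b ih =>
    rw [pow_succ']
    have := F.R2_mem_homog ih
    rw [Module.End.mul_apply]
    convert this using 2
    push_cast
    ring

theorem d_R2_pow (a : Idx r n) (b : ℕ) (v : P) : F.d a ((F.R2 ^ b) v)
    = (F.R2 ^ b) (F.d a v) + (2 * b : ℂ) • sharp F.x a ((F.R2 ^ (b - 1)) v) := by
  induction b with
  | zero => simp
  | succ b ih =>
    have h1 := LinearMap.congr_fun (F.d_R2 a) ((F.R2 ^ b) v)
    simp only [Module.End.mul_apply, LinearMap.add_apply, LinearMap.smul_apply] at h1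
    have h2 : ∀ w, F.R2 (sharp F.x a w) = sharp F.x a (F.R2 w) :=
      LinearMap.congr_fun (F.isWeyl.rsq_sharp a)
    rw [pow_succ', Module.End.mul_apply, h1, ih, map_add, map_smul, h2, add_tsub_cancel_right,
      Module.End.mul_apply]
    rcases b with _ | b
    · simp
    · rw [add_tsub_cancel_right, pow_succ', Module.End.mul_apply]
      push_cast
      module

/-- The elements of the irreducible module of highest weight `k` have degree at most `2 * k`. -/
theorem gen_vac_le (k : ℕ) : F.gen (le_refl (r + 2)) (k : ℂ) F.vac
    ≤ ⨆ (e : ℕ) (_ : e ≤ 2 * k), F.homog e := by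
  -- The space spanned by the R^{2b} v with deg v = e and b + e ≤ k, whose degrees e + 2b are at
  -- most 2k.
  let W : Submodule ℂ P := ⨆ (b : ℕ) (e : ℕ) (_ : b + e ≤ k), (F.homog e).map (F.R2 ^ b)
  have hW : ∀ b e : ℕ, b + e ≤ k → ∀ v ∈ F.homog e, (F.R2 ^ b) v ∈ W := by
    intro b e hbe v hv
    exact Submodule.mem_iSup_of_mem b (Submodule.mem_iSup_of_mem e
      (Submodule.mem_iSup_of_mem hbe ⟨v, hv, rfl⟩))
  have h1 : F.gen (le_refl (r + 2)) (k : ℂ) F.vac ≤ W := by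
    refine F.gen_le le_rfl le_rfl _ ?_ fun a g hg => ?_
    · exact hW 0 0 (Nat.zero_le _) F.vac (by simpa using F.vac_mem_homog)
    · have h2 : W ≤ W.comap (F.K k (idxIncl le_rfl n a)) := by
        refine iSup_le fun b => iSup_le fun e => iSup_le fun hbe => ?_
        rintro _ ⟨v, hv, rfl⟩
        rw [Submodule.mem_comap, F.K_apply_of_mem_homog _ _ (F.R2_pow_mem_homog b hv), d_R2_pow]
        set i := idxIncl (le_refl r) n a
        have h3 : F.R2 ((F.R2 ^ b) (F.d i v) + (2 * b : ℂ) • sharp F.x i ((F.R2 ^ (b - 1)) v))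
            = (F.R2 ^ (b + 1)) (F.d i v) + (2 * b : ℂ) • sharp F.x i ((F.R2 ^ b) v) := by
          have h4 : ∀ w, F.R2 (sharp F.x i w) = sharp F.x i (F.R2 w) :=
            LinearMap.congr_fun (F.isWeyl.rsq_sharp i)
          rw [map_add, map_smul, h4, pow_succ', Module.End.mul_apply]
          rcases b with _ | b
          · simp
          · rw [add_tsub_cancel_right, pow_succ' F.R2 b, Module.End.mul_apply,
              Module.End.mul_apply]
        have h5 : sharp F.x i ((F.R2 ^ b) v) = (F.R2 ^ b) (sharp F.x i v) := by
          have h4 : Commute (F.R2) (sharp F.x i) := F.isWeyl.rsq_sharp i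
          exact (LinearMap.congr_fun (h4.pow_left b) v).symm
        rw [h3, h5]
        -- The coefficient b + e - k vanishes exactly at the edge of `W`, so the first term cannot
        -- leave `W`; the second one trades a degree for a factor R² and keeps b + e.
        have h6 : (2 * ((e : ℂ) + 2 * b - k)) • (F.R2 ^ b) (sharp F.x i v)
            - ((F.R2 ^ (b + 1)) (F.d i v) + (2 * b : ℂ) • (F.R2 ^ b) (sharp F.x i v))
            = (2 * (b + e - k : ℂ)) • (F.R2 ^ b) (sharp F.x i v)
              - (F.R2 ^ (b + 1)) (F.d i v) := by module
        change (2 * ((e : ℂ) + 2 * b - k)) • (F.R2 ^ b) (sharp F.x i v)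
            - ((F.R2 ^ (b + 1)) (F.d i v) + (2 * b : ℂ) • (F.R2 ^ b) (sharp F.x i v)) ∈ W
        rw [h6]
        refine sub_mem ?_ ?_
        · rcases hbe.eq_or_lt with h7 | h7
          · rw [← h7]
            push_cast
            simp
          · exact Submodule.smul_mem _ _ (hW b (e + 1) h7 _ (by
              push_cast
              exact F.sharp_mem_homog i hv))
        · have h7 := F.d_mem_homog i hv
          rcases e with _ | e
          · have h8 : F.d i v = 0 := by
              rw [F.homog_eq_bot, Submodule.mem_bot] at h7
              · exact h7
              · intro e' he'
                have h8 : ((e' + 1 : ℕ) : ℂ) = 0 := by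
                  push_cast
                  rw [he']
                  simp
                exact absurd h8 (Nat.cast_ne_zero.2 (Nat.succ_ne_zero e'))
            rw [h8, map_zero]
            exact zero_mem _
          · refine hW (b + 1) e (by omega) _ ?_
            simpa using h7
      exact h2 hg
  refine h1.trans (iSup_le fun b => iSup_le fun e => iSup_le fun hbe => ?_)
  rintro _ ⟨v, hv, rfl⟩
  refine Submodule.mem_iSup_of_mem (e + 2 * b) (Submodule.mem_iSup_of_mem (by omega) ?_)
  push_cast
  exact F.R2_pow_mem_homog b hv

/-- Homogeneous elements of degree larger than `k` that are annihilated by an even derivative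
do not lie in the irreducible module of highest weight `k`. -/
theorem le_of_mem_gen_vac {k e : ℕ} {v : P} (i : Fin r) (hv0 : v ≠ 0) (hve : v ∈ F.homog e)
    (hv : F.d (Sum.inl i) v = 0) (hvk : v ∈ F.gen (le_refl (r + 2)) (k : ℂ) F.vac) : e ≤ k := by
  by_contra! hek
  have h1 : ∀ s : ℕ, (F.K k (Sum.inl i) ^ s) v ∈ F.homog (e + s : ℕ) := by
    intro s
    induction s with
    | zero => simpa using hve
    | succ s ih =>
      rw [pow_succ', Module.End.mul_apply]
      have := F.K_mem_homog (k : ℂ) (Sum.inl i) ih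
      convert this using 2
      push_cast
      ring
  -- The commutator of ∂_i and K_i is 2(E - k): for an even coordinate they belong to an 𝔰𝔩₂.
  have h2 : ∀ w, F.d (Sum.inl i) (F.K k (Sum.inl i) w)
      = F.K k (Sum.inl i) (F.d (Sum.inl i) w) + (2 : ℂ) • (F.E w - (k : ℂ) • w) := by
    intro w
    have h3 : ∀ w, F.d (Sum.inl i) (F.x (Sum.inl i) w)
        = F.x (Sum.inl i) (F.d (Sum.inl i) w) + w := by
      intro w
      have := F.d_x (Sum.inl i) (Sum.inl i) w
      simpa using this
    have h4 : ∀ w, F.d (Sum.inl i) (F.R2 w)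
        = F.R2 (F.d (Sum.inl i) w) + (2 : ℂ) • F.x (Sum.inl i) w := by
      intro w
      have := LinearMap.congr_fun (F.d_R2 (Sum.inl i)) w
      rwa [sharp_inl] at this
    simp only [K, sharp_inl, LinearMap.sub_apply, LinearMap.smul_apply, Module.End.mul_apply,
      Module.End.one_apply, map_sub, map_smul, map_add, h3, h4, F.d_E, smul_add, smul_sub]
    module
  have h3 : ∀ s : ℕ, F.d (Sum.inl i) ((F.K k (Sum.inl i) ^ (s + 1)) v)
      = ((s + 1) * (2 * (e - k) + s) : ℂ) • (F.K k (Sum.inl i) ^ s) v := by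
    intro s
    have h4 : ∀ s : ℕ, F.E ((F.K k (Sum.inl i) ^ s) v)
        = (e + s : ℂ) • (F.K k (Sum.inl i) ^ s) v := by
      intro s
      have := (F.mem_homog).1 (h1 s)
      rwa [Nat.cast_add] at this
    induction s with
    | zero =>
      rw [pow_succ', Module.End.mul_apply, h2, h4, pow_zero, Module.End.one_apply, hv, map_zero]
      push_cast
      module
    | succ s ih =>
      rw [pow_succ', Module.End.mul_apply, h2, h4, ih, map_smul, ← Module.End.mul_apply, ← pow_succ']
      push_cast
      module
  -- For e > k the coefficients (s+1)(2(e-k)+s) never vanish, so applying K_i never ends, against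
  -- the bound 2k on the degrees.
  have h4 : ∀ s : ℕ, (F.K k (Sum.inl i) ^ s) v ≠ 0 := by
    intro s
    induction s with
    | zero => simpa using hv0
    | succ s ih =>
      intro h5
      have h6 := h3 s
      rw [h5, map_zero, eq_comm, smul_eq_zero] at h6
      obtain ⟨c, rfl⟩ := Nat.exists_eq_add_of_lt hek
      rcases h6 with h6 | h6
      · have h7 : (((s + 1) * (2 * (c + 1) + s) : ℕ) : ℂ) = 0 := by
          rw [← h6]
          push_cast
          ring
        rw [Nat.cast_eq_zero] at h7
        exact absurd h7 (by positivity)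
      · exact ih h6
  have h5 : ∀ s : ℕ, (F.K k (Sum.inl i) ^ s) v ∈ F.gen (le_refl (r + 2)) (k : ℂ) F.vac := by
    intro s
    induction s with
    | zero => simpa using hvk
    | succ s ih =>
      rw [pow_succ', Module.End.mul_apply]
      exact F.K_mem_gen le_rfl le_rfl (k : ℂ) F.vac (Sum.inl i) ih
  have h6 := F.disjoint_homog (e := ((e + (2 * k) : ℕ) : ℂ)) (p := fun e' => e' ≤ 2 * k)
    fun e' he' h7 => by
      have := Nat.cast_injective h7
      omega
  exact h4 (2 * k) ((Submodule.disjoint_def.1 h6) _ (h1 _) (F.gen_vac_le k (h5 _)))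

end

end Fock

namespace Fock

variable {r n : ℕ} {P : Type*} [AddCommGroup P] [Module ℂ P] (F : Fock (r + 1) n P)

/-! ### The powers of the last even coordinate -/

/-- The powers of the last even coordinate. -/
def tpow (j : ℕ) : P := (F.t ^ j) F.vac

theorem tpow_zero : F.tpow 0 = F.vac := rfl

theorem tpow_succ (j : ℕ) : F.tpow (j + 1) = F.t (F.tpow j) := by
  rw [tpow, pow_succ', Module.End.mul_apply, tpow]

theorem dt_tpow_succ (j : ℕ) : F.dt (F.tpow (j + 1)) = (j + 1 : ℂ) • F.tpow j := by
  induction j with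
  | zero =>
    have h : F.dt F.vac = 0 := F.d_vac _
    rw [tpow_succ, dt_t, tpow_zero, h]
    simp
  | succ j ih =>
    rw [tpow_succ, dt_t, ih, map_smul, ← tpow_succ]
    push_cast
    module

theorem dy_tpow (a : Idx r n) (j : ℕ) : F.dy a (F.tpow j) = 0 := by
  induction j with
  | zero => exact F.d_vac _
  | succ j ih => rw [tpow_succ, dy_t, ih, map_zero]

theorem tpow_mem_homog (j : ℕ) : F.tpow j ∈ F.homog (j : ℂ) := by
  induction j with
  | zero => simpa [tpow_zero] using F.vac_mem_homog
  | succ j ih =>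
    rw [tpow_succ, Nat.cast_succ]
    exact F.x_mem_homog _ ih

theorem tpow_mem_deg (j : ℕ) : F.tpow j ∈ F.deg 0 := by
  induction j with
  | zero => exact F.vac_mem_deg
  | succ j ih =>
    rw [tpow_succ]
    have h1 := F.mem_deg_of_parity (A := F.t) (p := 0) (F.parity_x (Sum.inl (Fin.last r))) ih
    rwa [zero_add] at h1

theorem tpow_ne (j : ℕ) : F.tpow j ≠ 0 := by
  induction j with
  | zero => exact F.vac_ne
  | succ j ih =>
    intro h
    have h1 := F.dt_tpow_succ j
    rw [h, map_zero, eq_comm, smul_eq_zero] at h1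
    exact h1.elim (Nat.cast_add_one_ne_zero j) ih

theorem Et_tpow (j : ℕ) : F.Et (F.tpow j) = (j : ℂ) • F.tpow j := by
  rw [Et, Module.End.mul_apply]
  rcases j with _ | j
  · have h : F.dt F.vac = 0 := F.d_vac _
    rw [tpow_zero, h]
    simp
  · rw [dt_tpow_succ, map_smul, ← tpow_succ]
    push_cast
    rfl

theorem E_tpow (j : ℕ) : F.E (F.tpow j) = (j : ℂ) • F.tpow j := F.mem_homog.1 (F.tpow_mem_homog j)

/-- By induction ∂_t v is a multiple of the previous power, and Euler's identity reduces to (e+1) v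
= t ∂_t v. -/
theorem eq_smul_tpow {e : ℕ} {v : P} (hv : v ∈ F.homog e) (h : ∀ a, F.dy a v = 0) :
    ∃ c : ℂ, v = c • F.tpow e := by
  induction e generalizing v with
  | zero => exact F.mem_homog_zero (by simpa using hv)
  | succ e ih =>
    have h1 : F.dt v ∈ F.homog e := by
      have := F.d_mem_homog (Sum.inl (Fin.last r)) hv
      rwa [Nat.cast_succ, add_sub_cancel_right] at this
    obtain ⟨c, hc⟩ := ih h1 fun a => by rw [← dt_dy, h, map_zero]
    refine ⟨c / (e + 1), ?_⟩
    rw [mem_homog, E_eq] at hv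
    have h2 : euler F.y F.dy v = 0 := by
      rw [euler, LinearMap.sum_apply]
      exact Finset.sum_eq_zero fun a _ => by rw [Module.End.mul_apply, h, map_zero]
    rw [LinearMap.add_apply, h2, zero_add, Et, Module.End.mul_apply, hc, map_smul,
      ← tpow_succ] at hv
    have h3 : ((e : ℂ) + 1) ≠ 0 := Nat.cast_add_one_ne_zero e
    rw [div_eq_inv_mul, mul_smul, hv, smul_smul]
    push_cast
    rw [inv_mul_cancel₀ h3, one_smul]

theorem casimir_tpow (κ μ : ℂ) (j : ℕ) :
    F.casimir κ μ (F.tpow j) = ((κ - j) * (κ + μ - j)) • F.tpow j := by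
  have h1 : lap F.dy (F.tpow j) = 0 := by
    simp [lap, LinearMap.sum_apply, dy_tpow]
  simp only [casimir, LinearMap.add_apply, Module.End.mul_apply, h1, map_zero, zero_add,
    LinearMap.sub_apply, LinearMap.smul_apply, Module.End.one_apply, Et_tpow, map_sub, map_smul]
  module

/-- The reflection of the last even coordinate. -/
def flip : Module.End ℂ P := F.refl fun i => if i = Sum.inl (Fin.last r) then -1 else 1

theorem flip_y (a : Idx r n) (v : P) : F.flip (F.y a v) = F.y a (F.flip v) := by
  rw [y, flip, refl_x_apply, if_neg (last_ne a).symm, one_smul]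

theorem flip_t (v : P) : F.flip (F.t v) = -F.t (F.flip v) := by
  rw [t, flip, refl_x_apply, if_pos rfl, neg_one_smul]

theorem flip_dy (a : Idx r n) (v : P) : F.flip (F.dy a v) = F.dy a (F.flip v) := by
  have := LinearMap.congr_fun (F.d_refl (fun i => if i = Sum.inl (Fin.last r) then -1 else 1)
    (idxIncl r.le_succ n a)) v
  rw [if_neg (last_ne a).symm, one_smul] at this
  exact this.symm

theorem flip_dt (v : P) : F.flip (F.dt v) = -F.dt (F.flip v) := by
  have := LinearMap.congr_fun (F.d_refl (fun i => if i = Sum.inl (Fin.last r) then -1 else 1)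
    (Sum.inl (Fin.last r))) v
  rw [if_pos rfl, neg_one_smul] at this
  exact (neg_eq_iff_eq_neg.2 this).symm

theorem flip_sharp (a : Idx r n) (v : P) : F.flip (sharp F.y a v) = sharp F.y a (F.flip v) := by
  simp [sharp, LinearMap.sum_apply, flip_y]

theorem flip_E (v : P) : F.flip (F.E v) = F.E (F.flip v) := by
  simp [E_eq, euler, Et, LinearMap.sum_apply, flip_y, flip_dy, flip_t, flip_dt]

theorem flip_R2 (v : P) : F.flip (F.R2 v) = F.R2 (F.flip v) := by
  simp [R2_eq, rsq, LinearMap.sum_apply, flip_y, flip_sharp, flip_t]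

theorem flip_K (κ : ℂ) (a : Idx r n) (v : P) : F.flip (F.K κ (idxIncl r.le_succ n a) v)
    = F.K κ (idxIncl r.le_succ n a) (F.flip v) := by
  simp only [K_y, map_sub, map_smul, flip_sharp, flip_E, flip_R2, flip_dy]

theorem flip_tpow (j : ℕ) : F.flip (F.tpow j) = ((-1) ^ j : ℂ) • F.tpow j := by
  induction j with
  | zero => simp [tpow_zero, flip, F.refl_vac]
  | succ j ih =>
    rw [tpow_succ, flip_t, ih, map_smul, pow_succ]
    module

/-! ### The summands of the restriction -/

/-- The submodule of the restriction generated by a power of the last even coordinate. -/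
def branch (k j : ℕ) : Submodule ℂ P := F.gen (Nat.le_succ (r + 2)) (k : ℂ) (F.tpow j)

theorem tpow_mem_branch (k j : ℕ) : F.tpow j ∈ F.branch k j := F.mem_gen_self _ _ _

theorem K_mem_branch (k j : ℕ) (a : Idx r n) {v : P} (hv : v ∈ F.branch k j) :
    F.K k (idxIncl r.le_succ n a) v ∈ F.branch k j := F.K_mem_gen _ _ _ _ a hv

theorem branch_le {k j : ℕ} {U : Submodule ℂ P} (h1 : F.tpow j ∈ U)
    (h2 : ∀ a : Idx r n, ∀ v ∈ U, F.K k (idxIncl r.le_succ n a) v ∈ U) : F.branch k j ≤ U :=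
  F.gen_le r.le_succ (Nat.le_succ (r + 2)) _ h1 h2

theorem isSubmodule_branch (k j : ℕ) :
    ((F.rep (k : ℂ)).restrict (Nat.le_succ (r + 2))).IsSubmodule (F.branch k j) :=
  F.isSubmodule_gen r.le_succ _ _ (F.tpow_mem_deg j) (F.tpow_mem_homog j) fun a => F.dy_tpow a j

/-- The operators K_y raise degrees by one, so nothing of degree below `j` is produced; this blocks
complements in `not_isCompletelyReducible`. -/
theorem branch_le_homog (k j : ℕ) : F.branch k j ≤ ⨆ (e : ℕ) (_ : j ≤ e), F.homog e := by
  refine F.branch_le ?_ fun a v hv => ?_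
  · exact Submodule.mem_iSup_of_mem j (Submodule.mem_iSup_of_mem le_rfl (F.tpow_mem_homog j))
  · have h1 : (⨆ (e : ℕ) (_ : j ≤ e), F.homog e) ≤ (⨆ (e : ℕ) (_ : j ≤ e), F.homog e).comap
        (F.K k (idxIncl r.le_succ n a)) := by
      refine iSup₂_le fun e he v hv => ?_
      refine Submodule.mem_iSup_of_mem (e + 1) (Submodule.mem_iSup_of_mem (by omega) ?_)
      rw [Nat.cast_succ]
      exact F.K_mem_homog _ _ hv
    exact h1 hv

/-- The value of the separating operator on a summand. -/
def branchValue (r n k j : ℕ) : ℂ := ((k : ℂ) - j) * (k + (r - 2 * n) - j)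

theorem casimir_branch {k j : ℕ} {v : P} (hv : v ∈ F.branch k j) :
    F.casimir k (r - 2 * n) v = branchValue r n k j • v := by
  have h : F.branch k j ≤ (F.casimir k (r - 2 * n)).eigenspace (branchValue r n k j) := by
    refine F.branch_le ?_ fun a v hv => ?_
    · rw [Module.End.mem_eigenspace_iff, casimir_tpow, branchValue]
    · rw [Module.End.mem_eigenspace_iff] at hv ⊢
      rw [casimir_K, hv, map_smul]
  exact Module.End.mem_eigenspace_iff.1 (h hv)

theorem flip_branch {k j : ℕ} {v : P} (hv : v ∈ F.branch k j) : F.flip v = ((-1) ^ j : ℂ) • v := by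
  have h : F.branch k j ≤ F.flip.eigenspace ((-1) ^ j) := by
    refine F.branch_le ?_ fun a v hv => ?_
    · rw [Module.End.mem_eigenspace_iff, flip_tpow]
    · rw [Module.End.mem_eigenspace_iff] at hv ⊢
      rw [flip_K, hv, map_smul]
  exact Module.End.mem_eigenspace_iff.1 (h hv)

/-- The values of the separating operators determine the summand, up to a reflection. -/
theorem eq_or_of_branchValue_eq {k j e : ℕ} (h1 : branchValue r n k e = branchValue r n k j)
    (h2 : ((-1) ^ e : ℂ) = (-1) ^ j) :
    e = j ∨ (e ≠ j ∧ Even (e + j) ∧ (e + j : ℤ) = 2 * k + (r - 2 * n)) := by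
  -- `branchValue` is quadratic in `j` and symmetric under j ↦ 2k + (r - 2n) - j.
  have h3 : ((e : ℂ) - j) * (e + j - (2 * k + (r - 2 * n))) = 0 := by
    simp only [branchValue] at h1
    linear_combination h1
  by_cases hej : e = j
  · exact Or.inl hej
  · right
    refine ⟨hej, ?_, ?_⟩
    · rw [Nat.even_add]
      rcases Nat.even_or_odd e with he | he <;> rcases Nat.even_or_odd j with hj | hj
      · simp [he, hj]
      · rw [he.neg_one_pow, hj.neg_one_pow] at h2
        norm_num at h2
      · rw [he.neg_one_pow, hj.neg_one_pow] at h2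
        norm_num at h2
      · simp [Nat.not_even_iff_odd.2 he, Nat.not_even_iff_odd.2 hj]
    · rcases mul_eq_zero.1 h3 with h4 | h4
      · exact absurd (Nat.cast_injective (sub_eq_zero.1 h4)) hej
      · have h5 := sub_eq_zero.1 h4
        exact_mod_cast h5

theorem branch_eq_or {k j e : ℕ} {v : P} (hv0 : v ≠ 0) (hve : v ∈ F.branch k e)
    (hvj : v ∈ F.branch k j) :
    e = j ∨ (e ≠ j ∧ Even (e + j) ∧ (e + j : ℤ) = 2 * k + (r - 2 * n)) := by
  refine eq_or_of_branchValue_eq ?_ ?_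
  · exact smul_left_injective ℂ hv0 ((F.casimir_branch hve).symm.trans (F.casimir_branch hvj))
  · exact smul_left_injective ℂ hv0 ((F.flip_branch hve).symm.trans (F.flip_branch hvj))

/-- A criterion for the irreducibility of a summand. -/
theorem isL_branch {k j l : ℕ} (hl : l + j = k)
    (hirr : ∀ e : ℕ, F.tpow e ∈ F.branch k j → Even (e + j) →
      (e + j : ℤ) = 2 * k + (r - 2 * n) → e = j) :
    (((F.rep (k : ℂ)).restrict (Nat.le_succ (r + 2))).sub (F.branch k j)
      (F.isSubmodule_branch k j)).IsL l := by
  refine F.isL_gen r.le_succ (Nat.le_succ (r + 2)) _ (F.tpow_ne j) (F.tpow_mem_deg j)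
    (F.tpow_mem_homog j) (fun a => F.dy_tpow a j) ?_ fun e g hg hg0 hge hgd => ?_
  · rw [← hl]
    push_cast
    ring
  · obtain ⟨c, rfl⟩ := F.eq_smul_tpow hge hgd
    have hc : c ≠ 0 := by
      rintro rfl
      exact hg0 (zero_smul _ _)
    have h1 : F.tpow e ∈ F.branch k j := (Submodule.smul_mem_iff _ hc).1 hg
    have h2 : e = j := by
      rcases F.branch_eq_or (F.tpow_ne e) (F.tpow_mem_branch k e) h1 with h2 | ⟨-, h3, h4⟩
      · exact h2
      · exact hirr e h1 h3 h4
    rw [Submodule.mem_span_singleton, h2]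
    exact ⟨c⁻¹, by rw [smul_smul, inv_mul_cancel₀ hc, one_smul]⟩

/-- The summands are independent. -/
theorem iSupIndep_branch {k : ℕ} {ι : Type*} (f : ι → ℕ) (hf : Function.Injective f)
    (h : ∀ i j, f i ≠ f j → Even (f i + f j) → (f i + f j : ℤ) ≠ 2 * k + (r - 2 * n)) :
    iSupIndep fun i => F.branch k (f i) := by
  -- One operator recording both invariants: the `branchValue`s and the signs are real, so its
  -- eigenvalue determines them as real and imaginary part.
  let Q : Module.End ℂ P := F.casimir k (r - 2 * n) + Complex.I • F.flip
  have h1 : ∀ j, F.branch k j ≤ Q.eigenspace (branchValue r n k j + Complex.I * (-1) ^ j) := by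
    intro j v hv
    rw [Module.End.mem_eigenspace_iff, LinearMap.add_apply, LinearMap.smul_apply,
      F.casimir_branch hv, F.flip_branch hv]
    module
  have h2 : Function.Injective fun i : ι =>
      branchValue r n k (f i) + Complex.I * (-1) ^ (f i) := by
    intro i j hij
    have h3 : ∀ j, ∃ z : ℝ, branchValue r n k j = z := fun j =>
      ⟨((k : ℝ) - j) * (k + (r - 2 * n) - j), by push_cast [branchValue]; rfl⟩
    have h4 : ∀ j : ℕ, ((-1) ^ j : ℂ) = (((-1) ^ j : ℝ) : ℂ) := fun j => by push_cast; rfl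
    obtain ⟨a, ha⟩ := h3 (f i)
    obtain ⟨b, hb⟩ := h3 (f j)
    simp only [ha, hb, h4] at hij
    have h5 : a = b := by
      simpa only [Complex.add_re, Complex.ofReal_re, Complex.I_mul_re, Complex.ofReal_im, neg_zero,
        add_zero] using congrArg Complex.re hij
    have h6 : ((-1) ^ f i : ℝ) = (-1) ^ f j := by
      simpa only [Complex.add_im, Complex.ofReal_im, Complex.I_mul_im, Complex.ofReal_re,
        zero_add] using congrArg Complex.im hij
    rcases eq_or_of_branchValue_eq (ha.trans ((congrArg _ h5).trans hb.symm))
      ((h4 _).trans ((congrArg _ h6).trans (h4 _).symm)) with h7 | ⟨h7, h8, h9⟩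
    · exact hf h7
    · exact absurd h9 (h i j h7 h8)
  exact (Q.eigenspaces_iSupIndep.comp h2).mono fun i => h1 (f i)

end Fock

namespace Fock

variable {r n : ℕ} {P : Type*} [AddCommGroup P] [Module ℂ P] (F : Fock (r + 1) n P)

/-! ### The action of the lowering operators on the powers of the last coordinate -/

theorem K_y_K_y_tpow (κ : ℂ) (b c : Idx r n) (p : ℕ) :
    F.K κ (idxIncl r.le_succ n c) (F.K κ (idxIncl r.le_succ n b) (F.tpow p))
      = (2 * (p - κ)) • ((2 * (p + 1 - κ)) • sharp F.y c (sharp F.y b (F.tpow p))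
        - metricInv r n b c • F.R2 (F.tpow p)) := by
  have h1 : ∀ w, F.dy c (sharp F.y b w)
      = sgn (par c * par b) • sharp F.y b (F.dy c w) + metricInv r n b c • w := by
    intro w
    have := LinearMap.congr_fun (F.isWeyl_y.d_sharp c b) w
    simpa using this
  simp only [K_y, dy_tpow, E_tpow, E_sharp, h1, map_sub, map_add, map_smul, map_zero, smul_zero,
    sub_zero, zero_add]
  module

/-- Contracting the K_y K_y t^p with the metric leaves only |y|² t^p and t^{p+2}, an invariant
combination available inside the branch of t^p. -/
theorem sum_K_y_K_y_tpow (κ : ℂ) (p : ℕ) :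
    ∑ b, ∑ c, metric r n b c •
      F.K κ (idxIncl r.le_succ n c) (F.K κ (idxIncl r.le_succ n b) (F.tpow p))
      = (2 * (p - κ)) • ((2 * p + 2 - 2 * κ - (r - 2 * n)) • rsq F.y (F.tpow p)
        - ((r : ℂ) - 2 * n) • F.tpow (p + 2)) := by
  have h1 : ∑ b, ∑ c, metric r n b c • sharp F.y c (sharp F.y b (F.tpow p))
      = rsq F.y (F.tpow p) := by
    rw [rsq, LinearMap.sum_apply]
    refine Finset.sum_congr rfl fun b _ => ?_
    rw [Module.End.mul_apply, ← sum_metric_smul_sharp F.y b, LinearMap.sum_apply]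
    rfl
  have h2 : F.R2 (F.tpow p) = rsq F.y (F.tpow p) + F.tpow (p + 2) := by
    rw [R2_eq, tpow_succ, tpow_succ]
    rfl
  have h3 : ∑ b, ∑ c, metric r n b c •
      F.K κ (idxIncl r.le_succ n c) (F.K κ (idxIncl r.le_succ n b) (F.tpow p))
      = (2 * (p - κ)) • ((2 * (p + 1 - κ)) •
          (∑ b, ∑ c, metric r n b c • sharp F.y c (sharp F.y b (F.tpow p)))
        - (∑ b, ∑ c, metric r n b c * metricInv r n b c) • F.R2 (F.tpow p)) := by
    simp only [K_y_K_y_tpow, Finset.smul_sum, Finset.sum_smul, ← Finset.sum_sub_distrib]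
    refine Finset.sum_congr rfl fun b _ => Finset.sum_congr rfl fun c _ => ?_
    module
  rw [h3, h1, sum_metric_mul_metricInv, h2]
  module

variable {k : ℕ} {S : Submodule ℂ P}
  (hS : ∀ a : Idx r n, ∀ v ∈ S, F.K k (idxIncl r.le_succ n a) v ∈ S)

include hS

theorem rsq_sub_mem {p : ℕ} (hp : p ≠ k) (h : F.tpow p ∈ S) :
    (2 * p + 2 - 2 * k - (r - 2 * n) : ℂ) • rsq F.y (F.tpow p)
      - ((r : ℂ) - 2 * n) • F.tpow (p + 2) ∈ S := by
  have h1 : (2 * (p - k) : ℂ) ≠ 0 :=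
    mul_ne_zero two_ne_zero (sub_ne_zero.2 (Nat.cast_injective.ne hp))
  rw [← Submodule.smul_mem_iff _ h1, ← sum_K_y_K_y_tpow]
  exact sum_mem fun b _ => sum_mem fun c _ => Submodule.smul_mem _ _ (hS c _ (hS b _ h))

omit hS in
theorem K_t_tpow_succ (κ : ℂ) (p : ℕ) : F.K κ (Sum.inl (Fin.last r)) (F.tpow (p + 1))
    = (p + 1 - 2 * κ) • F.tpow (p + 2) - (p + 1 : ℂ) • rsq F.y (F.tpow p) := by
  have h2 : F.R2 (F.tpow p) = rsq F.y (F.tpow p) + F.tpow (p + 2) := by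
    rw [R2_eq, tpow_succ, tpow_succ]
    rfl
  rw [K_t, dt_tpow_succ, E_tpow, map_sub, map_smul, map_smul, map_smul, h2, ← tpow_succ]
  push_cast
  module

/-- Eliminates |y|² t^p between `rsq_sub_mem` and `K_t_tpow_succ`. The zeros of the two coefficients
decide which powers of t occur and whether their branches exhaust the module. -/
theorem K_t_tpow_sub_mem {p : ℕ} (hp : p ≠ k) (h : F.tpow p ∈ S) :
    (2 * p + 2 - 2 * k - (r - 2 * n) : ℂ) • F.K k (Sum.inl (Fin.last r)) (F.tpow (p + 1))
      - (2 * (p + 1 - k) * (p + 1 - 2 * k - (r - 2 * n)) : ℂ) • F.tpow (p + 2) ∈ S := by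
  have h1 := Submodule.smul_mem _ (-(p + 1) : ℂ) (F.rsq_sub_mem hS hp h)
  convert h1 using 1
  rw [K_t_tpow_succ]
  module

/-- At p + 1 = k the quadratic term of `K_y_K_y_tpow` drops out, and a single nonzero entry of the
inverse metric isolates R² t^p. -/
theorem R2_tpow_mem [Nonempty (Idx r n)] {p : ℕ} (hp : p + 1 = k) (h : F.tpow p ∈ S) :
    F.R2 (F.tpow p) ∈ S := by
  obtain ⟨b⟩ := ‹Nonempty (Idx r n)›
  obtain ⟨c, hc⟩ : ∃ c, metricInv r n b c ≠ 0 := by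
    by_contra! h1
    have h2 := metricInv_mul_metric_apply b b
    simp [h1] at h2
  have h3 := hS c _ (hS b _ h)
  rw [K_y_K_y_tpow, ← hp] at h3
  have h4 : (2 * ((p : ℂ) - (p + 1 : ℕ))) • ((2 * ((p : ℂ) + 1 - (p + 1 : ℕ)))
      • sharp F.y c (sharp F.y b (F.tpow p)) - metricInv r n b c • F.R2 (F.tpow p))
      = (2 * metricInv r n b c) • F.R2 (F.tpow p) := by
    push_cast
    module
  rw [h4] at h3
  exact (Submodule.smul_mem_iff _ (mul_ne_zero two_ne_zero hc)).1 h3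

end Fock

/-! ### Direct sum decompositions inside a submodule -/

namespace Rep

variable {m n : ℕ} {V : Type*} [AddCommGroup V] [Module ℂ V]

theorem IsSubmodule.restrict {m' : ℕ} (h : m' ≤ m) {ρ : Rep m n V} {U : Submodule ℂ V}
    (hU : ρ.IsSubmodule U) : (ρ.restrict h).IsSubmodule U :=
  ⟨fun p _ v hv => hU.1 p _ v hv, hU.2⟩

theorem isomorphic_sub_comap {ρ : Rep m n V} {U N : Submodule ℂ V} (hU : ρ.IsSubmodule U)
    (hN : ρ.IsSubmodule N) (hNU : N ≤ U) : (ρ.sub N hN).Isomorphic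
      ((ρ.sub U hU).sub (N.comap U.subtype) (hU.comap_subtype hN hNU)) :=
  ⟨(Submodule.comapSubtypeEquivOfLe hNU).symm, fun _ _ hv => hv, fun _ _ _ => rfl⟩

/-- A submodule that is an internal direct sum is isomorphic to the external direct sum. -/
theorem sub_isomorphic_directSum {ι : Type*} {W : ι → Type*} [∀ i, AddCommGroup (W i)]
    [∀ i, Module ℂ (W i)] (ρ : Rep m n V) (σ : ∀ i, Rep m n (W i)) {U : Submodule ℂ V}
    (hU : ρ.IsSubmodule U) (N : ι → Submodule ℂ V) (hN : ∀ i, ρ.IsSubmodule (N i))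
    (hind : iSupIndep N) (hsup : ⨆ i, N i = U)
    (hiso : ∀ i, (σ i).Isomorphic (ρ.sub (N i) (hN i))) :
    (ρ.sub U hU).Isomorphic (directSum σ) := by
  have hle : ∀ i, N i ≤ U := fun i => hsup ▸ le_iSup N i
  have hmap : ∀ i, ((N i).comap U.subtype).map U.subtype = N i := fun i => by
    rw [Submodule.map_comap_subtype, inf_eq_right.2 (hle i)]
  refine isomorphic_directSum _ σ (fun i => (N i).comap U.subtype)
    (fun i => hU.comap_subtype (hN i) (hle i)) ?_ ?_
    fun i => (hiso i).trans (isomorphic_sub_comap hU (hN i) (hle i))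
  · intro i
    rw [Submodule.disjoint_def]
    intro x hx hx'
    have h1 : (x : V) ∈ ⨆ (j) (_ : j ≠ i), N j := by
      have h2 : (x : V) ∈ (⨆ (j) (_ : j ≠ i), (N j).comap U.subtype).map U.subtype := ⟨x, hx', rfl⟩
      simpa only [Submodule.map_iSup, hmap] using h2
    exact Subtype.ext (Submodule.disjoint_def.1 (hind i) _ hx h1)
  · refine Submodule.map_injective_of_injective U.subtype_injective ?_
    rw [Submodule.map_iSup, Submodule.map_top, Submodule.range_subtype, iSup_congr hmap, hsup]

theorem sub_congr_isL {ρ σ : Rep m n V} (h : ρ = σ) {U : Submodule ℂ V} {k : ℕ}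
    {hU : ρ.IsSubmodule U} (hU' : σ.IsSubmodule U) (hL : (ρ.sub U hU).IsL k) :
    (σ.sub U hU').IsL k := by
  subst h
  exact hL

end Rep

/-! ### Powers of the last coordinate in the irreducible module -/

namespace Fock

section

variable {r n : ℕ} {P : Type*} [AddCommGroup P] [Module ℂ P] (F : Fock r n P)

/-- The irreducible submodule of highest weight `k`. -/
def full (k : ℕ) : Submodule ℂ P := F.gen (le_refl (r + 2)) (k : ℂ) F.vac

theorem isSubmodule_full (k : ℕ) : (F.rep (k : ℂ)).IsSubmodule (F.full k) := by
  have := F.isSubmodule_gen_vac k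
  rwa [Rep.restrict_refl] at this

theorem isL_full (k : ℕ) : ((F.rep (k : ℂ)).sub (F.full k) (F.isSubmodule_full k)).IsL k :=
  Rep.sub_congr_isL (Rep.restrict_refl _ _) _ (F.isL_gen_vac k)

theorem K_mem_full (k : ℕ) (i : Idx r n) {v : P} (hv : v ∈ F.full k) : F.K k i v ∈ F.full k := by
  have h1 : idxIncl (le_refl r) n i = i := by rcases i with i | i <;> rfl
  have := F.K_mem_gen le_rfl le_rfl (k : ℂ) F.vac i hv
  rwa [h1] at this

theorem full_le {k : ℕ} {U : Submodule ℂ P} (h1 : F.vac ∈ U)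
    (h2 : ∀ i, ∀ v ∈ U, F.K k i v ∈ U) : F.full k ≤ U :=
  F.gen_le le_rfl le_rfl _ h1 fun _ v hv => h2 _ v hv

end

variable {r n : ℕ} {P : Type*} [AddCommGroup P] [Module ℂ P] (F : Fock (r + 1) n P)

/-- The subspace `full k` is stable under K_t as well, so `K_t_tpow_sub_mem` yields t^{p+2} from t^p
and t^{p+1} as long as p + 1 is neither k nor 2k + (r - 2n). -/
theorem tpow_mem_full {k L : ℕ} (hL : L ≤ k)
    (h1 : ∀ l, 1 ≤ l → l < L → (l : ℤ) ≠ 2 * k + (r - 2 * n)) {l : ℕ} (hl : l ≤ L) :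
    F.tpow l ∈ F.full k := by
  induction l using Nat.strong_induction_on with
  | _ l ih =>
    rcases l with _ | _ | p
    · exact F.mem_gen_self _ _ _
    · have h2 := F.K_mem_full k (Sum.inl (Fin.last r)) (ih 0 (by omega) (by omega))
      have h3 : F.dt F.vac = 0 := F.d_vac _
      rw [K_t, E_tpow, tpow_zero, h3, map_zero, sub_zero, ← sub_smul, map_smul, smul_smul,
        ← tpow_zero, ← tpow_succ, Submodule.smul_mem_iff] at h2
      · exact h2
      · have : (k : ℂ) ≠ 0 := Nat.cast_ne_zero.2 (by omega)
        simpa using this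
    · have h2 := F.K_t_tpow_sub_mem (fun a v hv => F.K_mem_full k _ hv) (p := p) (by omega)
        (ih p (by omega) (by omega))
      have h3 := F.K_mem_full k (Sum.inl (Fin.last r)) (ih (p + 1) (by omega) (by omega))
      have h4 := sub_mem (Submodule.smul_mem _
        (2 * p + 2 - 2 * k - (r - 2 * n) : ℂ) h3) h2
      rw [sub_sub_cancel, Submodule.smul_mem_iff] at h4
      · exact h4
      · refine mul_ne_zero (mul_ne_zero two_ne_zero ?_) ?_
        · have : ((p + 1 : ℕ) : ℂ) ≠ k := Nat.cast_injective.ne (by omega)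
          rw [Nat.cast_succ] at this
          exact sub_ne_zero.2 this
        · have h5 : (((p + 1 : ℕ) : ℤ) : ℂ) ≠ ((2 * k + (r - 2 * n) : ℤ) : ℂ) :=
            Int.cast_injective.ne (h1 (p + 1) (by omega) (by omega))
          push_cast at h5
          rw [sub_sub]
          exact sub_ne_zero.2 h5

theorem branch_le_full {k j : ℕ} (h : F.tpow j ∈ F.full k) : F.branch k j ≤ F.full k :=
  F.branch_le h fun _ _ hv => F.K_mem_full k _ hv

/-- The decomposition of the restriction. -/
theorem full_eq [Nonempty (Idx r n)] {k L : ℕ} (hL : L ≤ k)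
    (h1 : ∀ l, 1 ≤ l → l < L → (l : ℤ) ≠ 2 * k + (r - 2 * n))
    (h2 : ∀ l, 1 ≤ l → l < L → (2 * l : ℤ) ≠ 2 * k + (r - 2 * n))
    (h3 : L = k ∨ (1 ≤ L ∧ (L : ℤ) = 2 * k + (r - 2 * n))) {ι : Type*} (f : ι → ℕ)
    (hf : ∀ j, j ≤ L ↔ ∃ i, f i = j) : ⨆ i, F.branch k (f i) = F.full k := by
  have hmem : ∀ j, j ≤ L → F.branch k j ≤ ⨆ i, F.branch k (f i) := by
    intro j hj
    obtain ⟨i, rfl⟩ := (hf j).1 hj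
    exact le_iSup (fun i => F.branch k (f i)) i
  refine le_antisymm (iSup_le fun i => ?_) ?_
  · exact F.branch_le_full (F.tpow_mem_full hL h1 ((hf _).2 ⟨i, rfl⟩))
  set S := ⨆ i, F.branch k (f i)
  have hy : ∀ a : Idx r n, ∀ v ∈ S, F.K k (idxIncl r.le_succ n a) v ∈ S := by
    intro a v hv
    have : S ≤ S.comap (F.K k (idxIncl r.le_succ n a)) := iSup_le fun i v hv =>
      (le_iSup (fun i => F.branch k (f i)) i) (F.K_mem_branch k (f i) a hv)
    exact this hv
  have htp : ∀ j, j ≤ L → F.tpow j ∈ S := fun j hj => hmem j hj (F.tpow_mem_branch k j)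
  -- Below `L` the power t^{j+1} is itself in `S`. At j = L it need not be, and either `R2_tpow_mem`
  -- or the vanishing of its coefficient takes over.
  have ht : ∀ j, j ≤ L → F.K k (Sum.inl (Fin.last r)) (F.tpow j) ∈ S := by
    intro j hj
    rcases j with _ | p
    · have h4 : F.dt F.vac = 0 := F.d_vac _
      rw [K_t, E_tpow, tpow_zero, h4, map_zero, sub_zero, ← sub_smul, map_smul, smul_smul,
        ← tpow_zero, ← tpow_succ]
      -- K_t·1 = -2k t, and by `h3` the case L = 0 occurs only for k = 0, when this is zero.
      rcases Nat.eq_zero_or_pos L with h5 | h5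
      · have h6 : k = 0 := by omega
        simp [h6]
      · exact Submodule.smul_mem _ _ (htp 1 h5)
    · have h4 : p + 1 ≠ L → F.tpow (p + 2) ∈ S := fun h => htp _ (by omega)
      rcases hj.lt_or_eq with h5 | h5
      · have h6 := F.K_t_tpow_sub_mem hy (p := p) (by omega) (htp p (by omega))
        have h7 := add_mem h6 (Submodule.smul_mem _
          (2 * (p + 1 - k) * (p + 1 - 2 * k - (r - 2 * n)) : ℂ) (h4 h5.ne))
        rw [sub_add_cancel] at h7
        refine (Submodule.smul_mem_iff _ ?_).1 h7
        have h8 : ((2 * ((p + 1 : ℕ) : ℤ) : ℤ) : ℂ) ≠ ((2 * k + (r - 2 * n) : ℤ) : ℂ) :=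
          Int.cast_injective.ne (h2 (p + 1) (by omega) h5)
        intro h9
        refine h8 ?_
        push_cast
        linear_combination h9
      · by_cases h6 : p + 1 = k
        · have h7 := F.R2_tpow_mem hy h6 (htp p (by omega))
          have h8 : F.K k (Sum.inl (Fin.last r)) (F.tpow (p + 1))
              = (-(p + 1) : ℂ) • F.R2 (F.tpow p) := by
            rw [K_t, dt_tpow_succ, E_tpow, h6]
            simp
            module
          rw [h8]
          exact Submodule.smul_mem _ _ h7
        · have h7 : (L : ℤ) = 2 * k + (r - 2 * n) := by
            rcases h3 with h3 | h3
            · omega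
            · exact h3.2
          have h8 : (2 * k + (r - 2 * n) : ℂ) = p + 1 := by
            rw [← h5] at h7
            exact_mod_cast (congrArg (Int.cast : ℤ → ℂ) h7).symm
          have h9 := F.K_t_tpow_sub_mem hy (p := p) (by omega) (htp p (by omega))
          -- At p + 1 = 2k + (r - 2n) the coefficient of t^{p+2} vanishes, while that of K_t t^{p+1}
          -- is p + 1, hence nonzero.
          have h10 : (p + 1 - 2 * k - (r - 2 * n) : ℂ) = 0 := by linear_combination -h8
          have h11 : (2 * p + 2 - 2 * k - (r - 2 * n) : ℂ) = p + 1 := by linear_combination -h8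
          rw [h10, h11, mul_zero, zero_smul, sub_zero] at h9
          exact (Submodule.smul_mem_iff _ (Nat.cast_add_one_ne_zero p)).1 h9
  refine F.full_le (htp 0 (Nat.zero_le _)) fun i v hv => ?_
  have hlast : S ≤ S.comap (F.K k (Sum.inl (Fin.last r))) := by
    refine iSup_le fun i => ?_
    have h4 : F.branch k (f i) ≤ S.comap (F.K k (Sum.inl (Fin.last r))) := by
      refine F.branch_le (ht _ ((hf _).2 ⟨i, rfl⟩)) fun a v hv => ?_
      rw [Submodule.mem_comap] at hv ⊢
      rw [K_comm]
      exact hy a _ hv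
    exact h4
  have hcases : (∃ a, i = idxIncl r.le_succ n a) ∨ i = Sum.inl (Fin.last r) := by
    rcases i with i | i
    · rcases i.eq_castSucc_or_eq_last with ⟨j, rfl⟩ | rfl
      · exact Or.inl ⟨Sum.inl j, rfl⟩
      · exact Or.inr rfl
    · exact Or.inl ⟨Sum.inr i, rfl⟩
  rcases hcases with ⟨a, rfl⟩ | rfl
  · exact hy a v hv
  · exact hlast hv

end Fock

/-! ### Failure of complete reducibility -/

namespace Fock

variable {r n : ℕ} {P : Type*} [AddCommGroup P] [Module ℂ P] (F : Fock (r + 1) n P)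

/-- At 2l = 2k + (r - 2n) the branches of t^{l-1} and t^{l+1} have the same invariants, and the
second is contained in the first. A complement of the second would contain t^{l-1}, hence also
t^{l+1}. -/
theorem not_isCompletelyReducible {k l : ℕ} (hl1 : 1 ≤ l) (hlk : l < k)
    (hl : (2 * l : ℤ) = 2 * k + (r - 2 * n)) :
    ¬ (((F.rep (k : ℂ)).restrict (Nat.le_succ (r + 2))).sub (F.full k)
      ((F.isSubmodule_full k).restrict _)).IsCompletelyReducible := by
  intro hcr
  obtain ⟨p, rfl⟩ : ∃ p, l = p + 1 := ⟨l - 1, by omega⟩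
  set ρ := (F.rep (k : ℂ)).restrict (Nat.le_succ (r + 2)) with hρ
  have hfull : ρ.IsSubmodule (F.full k) := (F.isSubmodule_full k).restrict _
  have hp : F.tpow p ∈ F.full k := F.tpow_mem_full hlk.le (fun l _ _ => by omega) (Nat.le_succ p)
  -- In `rsq_sub_mem` the coefficient of |y|² t^p is zero here, and that of t^{p+2} is not, since l
  -- ≠ k.
  have hpb : F.tpow (p + 2) ∈ F.branch k p := by
    have h1 := F.rsq_sub_mem (fun a _ hv => F.K_mem_branch k p a hv) (p := p) (by omega)
      (F.tpow_mem_branch k p)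
    have h2 : ((r : ℂ) - 2 * n) = 2 * ((p + 1 : ℕ) : ℂ) - 2 * k := by
      have h3 : ((2 * (p + 1 : ℕ) : ℤ) : ℂ) = ((2 * k + (r - 2 * n) : ℤ) : ℂ) := congrArg _ hl
      push_cast at h3 ⊢
      linear_combination -h3
    have h3 : (2 * p + 2 - 2 * k - (r - 2 * n) : ℂ) = 0 := by
      rw [h2]
      push_cast
      ring
    rw [h3, zero_smul, zero_sub, Submodule.neg_mem_iff, Submodule.smul_mem_iff] at h1
    · exact h1
    · rw [h2, ← mul_sub]
      exact mul_ne_zero two_ne_zero (sub_ne_zero.2 (Nat.cast_injective.ne hlk.ne))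
  have hp2 : F.tpow (p + 2) ∈ F.full k := F.branch_le_full hp hpb
  obtain ⟨C, hC, hcompl⟩ := hcr _
    (hfull.comap_subtype (F.isSubmodule_branch k (p + 2)) (F.branch_le_full hp2))
  have hC' := hfull.map_subtype hC
  have hdisj : ∀ v, v ∈ F.branch k (p + 2) → v ∈ C.map (F.full k).subtype → v = 0 := by
    rintro _ h1 ⟨v, hv, rfl⟩
    exact congrArg Subtype.val (Submodule.disjoint_def.1 hcompl.disjoint v h1 hv)
  have hE : ∀ U : Submodule ℂ P, ρ.IsSubmodule U → ∀ v ∈ U, F.E v ∈ U := by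
    intro U hU v hv
    have h1 := hU.1 0 (cartan (r + 2) n (Sum.inl ⟨0, by omega⟩)) v hv
    rw [hρ, restrict_cartan_zero] at h1
    have h2 : F.E v = (k : ℂ) • v - ((k : ℂ) • 1 - F.E) v := by
      rw [LinearMap.sub_apply, LinearMap.smul_apply, Module.End.one_apply]
      abel
    rw [h2]
    exact sub_mem (Submodule.smul_mem _ _ hv) h1
  obtain ⟨u, hu, c, hc, huc⟩ : ∃ u ∈ F.branch k (p + 2), ∃ c ∈ C.map (F.full k).subtype,
      u + c = F.tpow p := by
    have h1 : (⟨F.tpow p, hp⟩ : F.full k) ∈ (F.branch k (p + 2)).comap (F.full k).subtype ⊔ C := by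
      rw [hcompl.sup_eq_top]
      trivial
    obtain ⟨u, hu, c, hc, huc⟩ := Submodule.mem_sup.1 h1
    exact ⟨u, hu, c, ⟨c, hc, rfl⟩, congrArg Subtype.val huc⟩
  -- Both summands are stable under the Euler operator, so the component of t^p has degree `p` too;
  -- but the branch of t^{p+2} begins in degree p + 2.
  have hu0 : F.E u = (p : ℂ) • u := by
    have h1 : F.E u - (p : ℂ) • u = -(F.E c - (p : ℂ) • c) := by
      have h2 := F.E_tpow p
      rw [← huc, map_add, smul_add] at h2
      rw [← sub_eq_zero] at h2 ⊢
      rw [← h2]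
      abel
    rw [← sub_eq_zero]
    refine hdisj _ (sub_mem (hE _ (F.isSubmodule_branch k (p + 2)) u hu)
      (Submodule.smul_mem _ _ hu)) ?_
    rw [h1]
    exact neg_mem (sub_mem (hE _ hC' c hc) (Submodule.smul_mem _ _ hc))
  have hu1 : u = 0 := by
    have h1 := F.disjoint_homog (e := (p : ℂ)) (p := fun e => p + 2 ≤ e) fun e he h2 => by
      have := Nat.cast_injective h2
      omega
    exact Submodule.disjoint_def.1 h1 u (F.mem_homog.2 hu0) (F.branch_le_homog k (p + 2) hu)
  rw [hu1, zero_add] at huc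
  rw [huc] at hc
  have hle : F.branch k p ≤ C.map (F.full k).subtype := by
    refine F.branch_le hc fun a v hv => ?_
    rw [← F.restrict_lower r.le_succ (Nat.le_succ (r + 2)) (k : ℂ) a _ (lowerElt a) rfl]
    exact hC'.1 _ _ v hv
  exact F.tpow_ne (p + 2) (hdisj _ (F.tpow_mem_branch k (p + 2)) (hle hpb))

end Fock

/-! ### Transfer to arbitrary copies of the modules, and the theorem -/

theorem restrict_isomorphic {r n k L : ℕ} [Nonempty (Idx r n)] (hL : L ≤ k)
    (h1 : ∀ l, 1 ≤ l → l < L → (l : ℤ) ≠ 2 * k + (r - 2 * n))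
    (h2 : ∀ l, 1 ≤ l → l < L → (2 * l : ℤ) ≠ 2 * k + (r - 2 * n))
    (h3 : L = k ∨ (1 ≤ L ∧ (L : ℤ) = 2 * k + (r - 2 * n)))
    (h4 : ∀ i j, i ≤ L → j ≤ L → i ≠ j → Even (i + j) → (i + j : ℤ) ≠ 2 * k + (r - 2 * n))
    (h5 : ∀ j ≤ L, ∀ e, ((0 : ℤ) ≤ r - 2 * n → e ≤ k) → Even (e + j) →
      (e + j : ℤ) = 2 * k + (r - 2 * n) → e = j)
    {ι : Type*} (f g : ι → ℕ) (hf : Function.Injective f) (hfL : ∀ j, j ≤ L ↔ ∃ i, f i = j)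
    (hg : ∀ i, g i + f i = k) {V : Type*} [AddCommGroup V] [Module ℂ V] {σ : Rep (r + 1 + 2) n V}
    (hσ : σ.IsL k) {W : ι → Type*} [∀ i, AddCommGroup (W i)] [∀ i, Module ℂ (W i)]
    {σ' : ∀ i, Rep (r + 2) n (W i)} (hσ' : ∀ i, (σ' i).IsL (g i)) :
    (σ.restrict (Nat.le_succ (r + 2))).Isomorphic (Rep.directSum σ') := by
  let F := SuperPoly.fock (r + 1) n
  have hle : ∀ i, f i ≤ L := fun i => (hfL _).2 ⟨i, rfl⟩
  refine ((hσ.isomorphic (F.isL_full k)).restrict (Nat.le_succ (r + 2))).trans ?_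
  refine Rep.sub_isomorphic_directSum ((F.rep (k : ℂ)).restrict (Nat.le_succ (r + 2))) σ'
    ((F.isSubmodule_full k).restrict _) (fun i => F.branch k (f i))
    (fun i => F.isSubmodule_branch k (f i)) ?_ (F.full_eq hL h1 h2 h3 f hfL)
    fun i => (hσ' i).isomorphic (F.isL_branch (hg i) fun e he => h5 _ (hle i) e fun hr => ?_)
  · exact F.iSupIndep_branch f hf fun i j => h4 _ _ (hle i) (hle j)
  -- A nonnegative superdimension forces an even coordinate among the y: for r = 0 it would give n =
  -- 0 and no coordinates at all. The bound of `le_of_mem_gen_vac` needs such a coordinate.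
  · have h6 : 0 < r := by
      rcases Nat.eq_zero_or_pos r with h7 | h7
      · subst h7
        obtain ⟨a | a⟩ := ‹Nonempty (Idx 0 n)›
        · exact a.elim0
        · have := a.1.pos
          omega
      · exact h7
    exact F.le_of_mem_gen_vac (Fin.castSucc ⟨0, h6⟩) (F.tpow_ne e) (F.tpow_mem_homog e)
      (F.dy_tpow (Sum.inl ⟨0, h6⟩) e)
      (F.branch_le_full (F.tpow_mem_full hL h1 (hle i)) he)

theorem not_isCompletelyReducible_restrict {r n k l : ℕ} (hl1 : 1 ≤ l) (hlk : l < k)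
    (hl : (2 * l : ℤ) = 2 * k + (r - 2 * n)) {V : Type*} [AddCommGroup V] [Module ℂ V]
    {σ : Rep (r + 1 + 2) n V} (hσ : σ.IsL k) :
    ¬ (σ.restrict (Nat.le_succ (r + 2))).IsCompletelyReducible := by
  let F := SuperPoly.fock (r + 1) n
  intro h
  exact F.not_isCompletelyReducible hl1 hlk hl
    (h.of_isomorphic ((hσ.isomorphic (F.isL_full k)).restrict (Nat.le_succ (r + 2))))

end Osp

end

theorem mainTheorem3 (m n k : ℕ) (hm : 3 ≤ m) (hmn : ¬(m = 3 ∧ n = 0)) :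
    Osp.ExistsL m n k ∧ (∀ l : ℕ, Osp.ExistsL (m - 1) n l) ∧
    ∀ {V : Type*} [AddCommGroup V] [Module ℂ V] (L : Osp.Rep m n V), L.IsL k →
      (∀ {W : ℕ → Type*} [∀ l, AddCommGroup (W l)] [∀ l, Module ℂ (W l)]
          (L' : ∀ l, Osp.Rep (m - 1) n (W l)), (∀ l, (L' l).IsL l) →
        (((1 < (m : ℤ) - 2 * n) ∨
            ((∃ j : ℕ, (m : ℤ) - 2 * n = 1 - 2 * j) ∧ (k : ℝ) < 2 + (1 - (m : ℝ)) / 2 + n) ∨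
            ((∃ j : ℕ, (m : ℤ) - 2 * n = -2 * j) ∧
              ((k : ℝ) < 2 - (m : ℝ) / 2 + n ∨ 2 - (m : ℝ) + 2 * n < k))) →
          (L.restrict (Nat.sub_le m 1)).Isomorphic
            (Osp.Rep.directSum fun l : {l : ℕ // l ≤ k} => L' l)) ∧
        (((∃ j : ℕ, (m : ℤ) - 2 * n = -2 * j) ∧
            2 - (m : ℝ) / 2 + n ≤ k ∧ (k : ℝ) ≤ 2 - (m : ℝ) + 2 * n) →
          (L.restrict (Nat.sub_le m 1)).Isomorphic
            (Osp.Rep.directSum fun l : {l : ℕ // 3 - (m : ℤ) + 2 * n - k ≤ l ∧ l ≤ k} => L' l))) ∧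
      (((∃ j : ℕ, (m : ℤ) - 2 * n = 1 - 2 * j) ∧ 2 + (1 - (m : ℝ)) / 2 + n ≤ k) →
        ¬ (L.restrict (Nat.sub_le m 1)).IsCompletelyReducible) := by
  -- Two even coordinates are used up by the cone and one is t, leaving r|2n for the y; below μ = r
  -- - 2n = m - 2n - 3.
  obtain ⟨r, rfl⟩ : ∃ r, m = r + 1 + 2 := ⟨m - 3, by omega⟩
  refine ⟨Osp.existsL _ n k, fun l => Osp.existsL r n l, fun {V} _ _ L hL => ⟨fun {W} _ _ L' hL' =>
    ⟨fun hc => ?_, fun hc => ?_⟩, fun hc => ?_⟩⟩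
  · have : Nonempty (Osp.Idx r n) := by
      by_cases hr : r = 0
      · exact ⟨Sum.inr (⟨0, by omega⟩, 0)⟩
      · exact ⟨Sum.inl ⟨0, by omega⟩⟩
    have hc' : (1 < (r + 3 : ℤ) - 2 * n) ∨
            ((∃ j : ℕ, (r + 3 : ℤ) - 2 * n = 1 - 2 * j) ∧ (2 * k : ℤ) < 2 - r + 2 * n) ∨
            ((∃ j : ℕ, (r + 3 : ℤ) - 2 * n = -2 * j) ∧
              ((2 * k : ℤ) < 1 - r + 2 * n ∨ - 1 - (r : ℤ) + 2 * n < k)) := by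
      push_cast at hc
      rcases hc with hc | ⟨⟨j, hj⟩, hc⟩ | ⟨⟨j, hj⟩, hc⟩
      · left
        linarith
      · refine Or.inr (Or.inl ⟨⟨j, by linarith⟩, ?_⟩)
        have : (2 * k : ℝ) < 2 - r + 2 * n := by linarith
        exact_mod_cast this
      · refine Or.inr (Or.inr ⟨⟨j, by linarith⟩, hc.imp (fun hc => ?_) fun hc => ?_⟩)
        · have : (2 * k : ℝ) < 1 - r + 2 * n := by linarith
          exact_mod_cast this
        · have : (-1 - r + 2 * n : ℝ) < k := by linarith
          exact_mod_cast this
    -- The summand with highest weight `l` is the branch of t^{k-l}. The coincidence e + j = 2k + μ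
    -- is excluded by parity for odd μ, by 2k + μ ≤ 0 for even negative μ, and by e, j ≤ k for μ ≥
    -- 0, except where e = j.
    refine Osp.restrict_isomorphic (L := k) le_rfl (fun l _ _ => ?_) (fun l _ _ => ?_) (Or.inl rfl)
      (fun i j _ _ _ he => ?_) (fun j _ e _ he _ => ?_)
      (fun l : {l : ℕ // l ≤ k} => k - l.1) (fun l => l.1) (fun a b hab => ?_)
      (fun j => ⟨fun hj => ⟨⟨k - j, by omega⟩, ?_⟩, ?_⟩) (fun l => ?_) hL fun l => hL' l
    · rcases hc' with h | ⟨⟨d, hd⟩, h⟩ | ⟨⟨d, hd⟩, h⟩ <;> omega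
    · rcases hc' with h | ⟨⟨d, hd⟩, h⟩ | ⟨⟨d, hd⟩, h⟩ <;> omega
    · obtain ⟨c, he⟩ := he
      rcases hc' with h | ⟨⟨d, hd⟩, h⟩ | ⟨⟨d, hd⟩, h⟩ <;> omega
    · obtain ⟨c, he⟩ := he
      rcases hc' with h | ⟨⟨d, hd⟩, h⟩ | ⟨⟨d, hd⟩, h⟩ <;> omega
    · have h1 := a.2
      have h2 := b.2
      exact Subtype.ext (by dsimp only at hab; omega)
    · dsimp only
      omega
    · rintro ⟨i, rfl⟩
      exact Nat.sub_le _ _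
    · have := l.2
      omega
  · have : Nonempty (Osp.Idx r n) := by
      by_cases hr : r = 0
      · exact ⟨Sum.inr (⟨0, by omega⟩, 0)⟩
      · exact ⟨Sum.inl ⟨0, by omega⟩⟩
    push_cast at hc
    obtain ⟨⟨d, hd⟩, hc1, hc2⟩ := hc
    have hc3 : (1 - r + 2 * n : ℤ) ≤ 2 * k := by
      have : (1 - r + 2 * n : ℝ) ≤ 2 * k := by linarith
      exact_mod_cast this
    have hc4 : (k : ℤ) ≤ -1 - r + 2 * n := by
      have : (k : ℝ) ≤ -1 - r + 2 * n := by linarith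
      exact_mod_cast this
    -- The bounds on `k` say that 2k + μ lies between 1 and k - 1. The powers of t stop there, so
    -- the least `l` is k - L₀ = 3 - m + 2n - k. As μ is odd, parity excludes every coincidence.
    obtain ⟨L₀, hL₀⟩ : ∃ L₀ : ℕ, (L₀ : ℤ) = 2 * k + (r - 2 * n) :=
      ⟨(2 * k + (r - 2 * n) : ℤ).toNat, Int.toNat_of_nonneg (by omega)⟩
    refine Osp.restrict_isomorphic (L := L₀) (by omega) (fun l _ _ => by omega)
      (fun l _ _ => by omega) (Or.inr ⟨by omega, hL₀⟩) (fun i j _ _ _ he => ?_)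
      (fun j _ e _ he _ => ?_)
      (fun l : {l : ℕ // 3 - ((r + 1 + 2 : ℕ) : ℤ) + 2 * n - k ≤ l ∧ l ≤ k} => k - l.1)
      (fun l => l.1) (fun a b hab => ?_)
      (fun j => ⟨fun hj => ⟨⟨k - j, by omega⟩, ?_⟩, ?_⟩) (fun l => ?_) hL fun l => hL' l
    · obtain ⟨c, he⟩ := he
      omega
    · obtain ⟨c, he⟩ := he
      omega
    · have h1 := a.2
      have h2 := b.2
      exact Subtype.ext (by dsimp only at hab; omega)
    · dsimp only
      omega
    · rintro ⟨i, rfl⟩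
      have := i.2
      omega
    · have := l.2
      omega
  · push_cast at hc
    obtain ⟨⟨d, hd⟩, hc⟩ := hc
    have hc1 : (2 - r + 2 * n : ℤ) ≤ 2 * k := by
      have : (2 - r + 2 * n : ℝ) ≤ 2 * k := by linarith
      exact_mod_cast this
    -- From m - 2n = 1 - 2d one gets 2k + μ = 2(k - 1 - d), and `l` is half of it.
    obtain ⟨l, hl⟩ : ∃ l : ℕ, (l : ℤ) = k - 1 - d :=
      ⟨(k - 1 - d : ℤ).toNat, Int.toNat_of_nonneg (by omega)⟩
    exact Osp.not_isCompletelyReducible_restrict (l := l) (by omega) (by omega) (by omega) hL
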